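/- **Setting.** Let $\mathcal H_0,\mathcal H_1$ be complex Hilbert spaces, $A_0$, $A_1$ (possibly unbounded) self-adjoint operators in $\mathcal H_0$, $\mathcal H_1$, and $B_{10}:\mathcal H_0\to\mathcal H_1$ bounded, $B_{01}=B_{10}^*$. Let $J^0=(\mu_0^{(1)},\mu_0^{(2)})$ with $-\infty\le\mu_0^{(1)}<\mu_0^{(2)}\le\infty$. The spectrum of $A_0$ is absolutely continuous, $\sigma(A_0)=\overline{J^0}$, and $\sigma(A_1)\subset J^0$. With $E_0$ the spectral measure of $A_0$, put $K_B(\mu)=B_{10}E_0((-\infty,\mu))B_{01}$. Assume that $K_B$ is differentiable in operator norm on $J^0$, that $K_B'$ is continuous on $\overline{J^0}$, and that there is a simply connected domain $D^-$ in the open lower half-plane such that, with $D^+=\{\bar z: z\in D^-\}$, the set $D^-\cup J^0\cup D^+$ is open and $K_B'$ extends holomorphically to it. **Contours.** For $l=\pm1$ let $D^l=D^\pm$. An *admissible contour* $\Gamma^l$ is a simple curve in $D^l$, each bounded part of which has finite length, with $$\mathcal V_0(\Gamma^l)=\int_{\Gamma^l}\|K_B'(\mu)\|\,|d\mu|<\infty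 ,$$ obtained from $J^0$ by a continuous deformation $h(t,s)$, $t\in[0,1]$, $s\in\mathbb R$ ($h(0,\cdot)$ an increasing parametrization of $J^0$, $h(1,\cdot)$ a parametrization of $\Gamma^l$, $h(t,s)\in D^l$ for $t>0$) with fixed end points: $h(t,s)$ tends to the left (right) end point of $J^0$ as $s\to-\infty$ ($s\to+\infty$), uniformly in $t$, an infinite end point being read as the point $\infty$. Moreover, at each of the two ends there is a sequence $s_n\to\mp\infty$ for which the cross-cuts $c_n:t\mapsto h(t,s_n)$ are rectifiable and $\int_{c_n}\|K_B'(\mu)\|(1+|\mu|)^{-1}|d\mu|\to0$. Let $d_0(\Gamma)=\mathrm{dist}(\sigma(A_1),\Gamma)$. Call $\Gamma$ *small* if $\mathcal V_0(\Gamma)<\frac14d_0(\Gamma)^2$, and then put $$r_{\min}(\Gamma)=\tfrac12d_0(\Gamma)-\sqrt{\tfrac14d_0(\Gamma)^2-\mathcal V_0(\Gamma)},\qquad r_{\max}(\Gamma)=d_0(\Gamma)-\sqrt{\mathcal V_0(\Gamma)} .$$ Let $r_0$ be the infimum of $r_{\min}(\Gamma^l)$ over all small admissible contours $\Gamma^l$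 in $D^l$. Fix $l$ and a small admissible contour $\Gamma^l$, let $X^{(l)}$ be the bounded operator in $\mathcal H_1$ with $\|X^{(l)}\|<r_{\max}(\Gamma^l)$ and $$X^{(l)}=\int_{\Gamma^l}K_B'(\mu)\,(A_1+X^{(l)}-\mu)^{-1}\,d\mu ,$$ and put $H_1^{(l)}=A_1+X^{(l)}$. **Theorem.** Assume that $A_1$ has compact resolvent and that $\sigma(A_1)=\{\lambda_1<\lambda_2<\cdots\}$ is infinite with $\lambda_i\to+\infty$ (arbitrary multiplicities being allowed) and $\lambda_{i+1}-\lambda_i\to\infty$. Let $i_0\ge2$ be such that $\lambda_i-\lambda_{i-1}>4r_0$ for all $i\ge i_0$, and let $r>r_0$ be such that $\lambda_i-\lambda_{i-1}>2r$ for all $i\ge i_0$. Let $\gamma_0$ be the circle with centre $(\lambda_1+\lambda_{i_0-1})/2$ and radius $(\lambda_{i_0-1}-\lambda_1)/2+r$, and for $i\ge i_0$ let $\gamma_i$ be the circle with centre $\lambda_i$ and radius $r$. Then all these circles lie in the resolvent set of $H_1^{(l)}$, and the operators $$Q_i^{(l)}=-\frac1{2\pi\mathrm i}\int_{\gamma_i}(H_1^{(l)}-z)^{-1}\,dz,\qquad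 i=0,i_0,i_0+1,\dots,$$ satisfy $$\lim_{n\to\infty}\sum_{0\le i\le n,\ i=0\ \text{or}\ i\ge i_0}Q_i^{(l)}u=u\qquad\text{for every }u\in\mathcal H_1 .$$ If in addition $\sum_{i=1}^\infty(\lambda_{i+1}-\lambda_i)^{-2}<\infty$, then the same strong limit holds for every renumbering (reordering) of the sequence $Q_0^{(l)},Q_{i_0}^{(l)},Q_{i_0+1}^{(l)},\dots$, and there is a constant $C$ such that $\bigl\|\sum_{i\in\mathcal I}Q_i^{(l)}\bigr\|\le C$ for every finite set $\mathcal I$ of indices $i=0$, $i\ge i_0$. -/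

import Mathlib

open Filter Topology MeasureTheory Set
open scoped ENNReal InnerProductSpace

noncomputable section

/-! ### Unbounded operators: resolvent and spectrum -/

section Unbounded

variable {H : Type*} [NormedAddCommGroup H] [InnerProductSpace ℂ H]

/-- The bounded operator `R` is the inverse of `T - z`. -/
def IsResolvent (T : H →ₗ.[ℂ] H) (z : ℂ) (R : H →L[ℂ] H) : Prop :=
  (∀ y : H, ∃ hy : R y ∈ T.domain, T ⟨R y, hy⟩ - z • R y = y) ∧
    ∀ x : T.domain, R (T x - z • (x : H)) = x

theorem IsResolvent.unique {T : H →ₗ.[ℂ] H} {z : ℂ} {R R' : H →L[ℂ] H}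
    (h : IsResolvent T z R) (h' : IsResolvent T z R') : R = R' := by
  ext y
  obtain ⟨hy, e⟩ := h'.1 y
  have := h.2 ⟨R' y, hy⟩
  rwa [e] at this

/-- The resolvent set `ρ(T)`. -/
def unbResolventSet (T : H →ₗ.[ℂ] H) : Set ℂ := {z | ∃ R, IsResolvent T z R}

/-- The spectrum `σ(T)`. -/
def unbSpectrum (T : H →ₗ.[ℂ] H) : Set ℂ := (unbResolventSet T)ᶜ

open Classical in
/-- The resolvent `(T - z)⁻¹` for `z ∈ ρ(T)` (and `0` for `z ∈ σ(T)`). -/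
def unbResolvent (T : H →ₗ.[ℂ] H) (z : ℂ) : H →L[ℂ] H :=
  if h : ∃ R, IsResolvent T z R then h.choose else 0

theorem unbResolvent_eq {T : H →ₗ.[ℂ] H} {z : ℂ} {R : H →L[ℂ] H}
    (h : IsResolvent T z R) : unbResolvent T z = R := by
  have hex : ∃ R, IsResolvent T z R := ⟨R, h⟩
  rw [unbResolvent, dif_pos hex]
  exact hex.choose_spec.unique h

/-- The sum `T + X` of an operator `T` and a bounded operator `X`, with the domain of `T`. -/
def addBounded (T : H →ₗ.[ℂ] H) (X : H →L[ℂ] H) : H →ₗ.[ℂ] H :=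
  (X : H →ₗ[ℂ] H) +ᵥ T

/-- `-(2πi)⁻¹ ∮ (T - z)⁻¹ dz` over the circle with centre `c` and radius `R`. -/
def rieszProjection (T : H →ₗ.[ℂ] H) (c : ℂ) (R : ℝ) : H →L[ℂ] H :=
  -((2 * Real.pi * Complex.I : ℂ)⁻¹ • ∮ z in C(c, R), unbResolvent T z)

end Unbounded

/-! ### Spectral measures -/

section Spectral

/-- A projection-valued measure on the Borel sets of `ℝ` (values on other sets are irrelevant). -/
structure ProjectionMeasure (H : Type*) [NormedAddCommGroup H] [InnerProductSpace ℂ H]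
    [CompleteSpace H] where
  proj : Set ℝ → H →L[ℂ] H
  isStarProjection : ∀ S, MeasurableSet S → IsStarProjection (proj S)
  proj_univ : proj univ = 1
  hasSum_iUnion : ∀ f : ℕ → Set ℝ, (∀ i, MeasurableSet (f i)) →
    Pairwise (Function.onFun Disjoint f) →
    ∀ x, HasSum (fun i => proj (f i) x) (proj (⋃ i, f i) x)

variable {H : Type*} [NormedAddCommGroup H] [InnerProductSpace ℂ H] [CompleteSpace H]

namespace ProjectionMeasure

theorem proj_empty (E : ProjectionMeasure H) (x : H) : E.proj ∅ x = 0 := by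
  have h := E.hasSum_iUnion (fun _ => ∅) (fun _ => MeasurableSet.empty)
    (fun _ _ _ => disjoint_bot_left) x
  exact tendsto_nhds_unique tendsto_const_nhds h.summable.tendsto_atTop_zero

theorem re_inner_nonneg (E : ProjectionMeasure H) (x : H) {S : Set ℝ} (hS : MeasurableSet S) :
    0 ≤ (⟪x, E.proj S x⟫_ℂ).re := by
  have hp := E.isStarProjection S hS
  have h1 : E.proj S x = E.proj S (E.proj S x) := by
    have := congrArg (fun T : H →L[ℂ] H => T x) hp.isIdempotentElem.eq
    exact this.symm
  have h2 : (E.proj S).adjoint = E.proj S := hp.isSelfAdjoint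
  rw [h1, ← ContinuousLinearMap.adjoint_inner_left, h2]
  exact inner_self_nonneg (𝕜 := ℂ) (x := E.proj S x)

/-- The scalar measure `S ↦ ⟨x, E(S) x⟩`. -/
def scalarMeasure (E : ProjectionMeasure H) (x : H) : Measure ℝ :=
  Measure.ofMeasurable (fun S _ => ENNReal.ofReal (⟪x, E.proj S x⟫_ℂ).re)
    (by simp [E.proj_empty x])
    (by
      intro f hf hd
      have h := (E.hasSum_iUnion f hf hd x).mapL (Complex.reCLM ∘L (innerSL ℂ x).restrictScalars ℝ)
      simp only [ContinuousLinearMap.comp_apply, ContinuousLinearMap.coe_restrictScalars',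
        innerSL_apply_apply, Complex.reCLM_apply] at h
      rw [← h.tsum_eq]
      exact ENNReal.ofReal_tsum_of_nonneg (fun i => E.re_inner_nonneg x (hf i)) h.summable)

theorem scalarMeasure_apply (E : ProjectionMeasure H) (x : H) {S : Set ℝ} (hS : MeasurableSet S) :
    E.scalarMeasure x S = ENNReal.ofReal (⟪x, E.proj S x⟫_ℂ).re :=
  Measure.ofMeasurable_apply S hS

/-- `E` is the spectral measure of `A`, that is `A = ∫ t dE(t)`. -/
structure IsSpectralMeasureOf (E : ProjectionMeasure H) (A : H →ₗ.[ℂ] H) : Prop where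
  mem_domain_iff : ∀ x : H, x ∈ A.domain ↔
    ∫⁻ t, ENNReal.ofReal (t ^ 2) ∂(E.scalarMeasure x) < ∞
  inner_apply : ∀ x : A.domain,
    ⟪(x : H), A x⟫_ℂ = ((∫ t, t ∂(E.scalarMeasure (x : H)) : ℝ) : ℂ)

end ProjectionMeasure

end Spectral

/-! ### The function `K_B`, contours, and the operator `V₁(Y, Γ)` -/

/-- The open interval `(a, b)` of the real line, with possibly infinite end points. -/
def realInterval (a b : EReal) : Set ℝ := {x : ℝ | a < (x : EReal) ∧ (x : EReal) < b}

/-- The neighbourhoods in `ℂ` of an end point: those of the point itself if it is finite, those of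
the point at infinity otherwise. -/
def endFilter (e : EReal) : Filter ℂ :=
  if e = ⊥ ∨ e = ⊤ then Bornology.cobounded ℂ else 𝓝 ((e.toReal : ℝ) : ℂ)

/-- The domain `D⁺`, mirror image of `D⁻` in the real axis. -/
def mirror (D : Set ℂ) : Set ℂ := {z | (starRingEnd ℂ) z ∈ D}

/-- `D^l` for `l = ±1`, where `D` stands for `D⁻`. -/
def sideDomain (D : Set ℂ) (l : ℤˣ) : Set ℂ := if l = 1 then mirror D else D

/-- `K_B(t) = B₁₀ E((-∞, t)) B₁₀*`. -/
def couplingFunction {H₀ H₁ : Type*}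
    [NormedAddCommGroup H₀] [InnerProductSpace ℂ H₀] [CompleteSpace H₀]
    [NormedAddCommGroup H₁] [InnerProductSpace ℂ H₁] [CompleteSpace H₁]
    (E : ProjectionMeasure H₀) (B : H₀ →L[ℂ] H₁) (t : ℝ) : H₁ →L[ℂ] H₁ :=
  B ∘L E.proj (Iio t) ∘L B.adjoint

section Contours

variable {H : Type*} [NormedAddCommGroup H] [InnerProductSpace ℂ H]

/-- `K` (on `D⁻ ∪ J ∪ D⁺`) is the analytic continuation of the derivative, in operator norm, of
`KB` on the interval `J = (a, b)`; `D⁻` is a simply connected domain in the lower half-plane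
adjacent to all of `J`, and the derivative is continuous on the closed interval. -/
structure IsContinuedDerivative (a b : EReal) (D : Set ℂ) (KB : ℝ → H →L[ℂ] H)
    (K : ℂ → H →L[ℂ] H) : Prop where
  isOpen : IsOpen D
  isSimplyConnected : IsSimplyConnected D
  subset_lower : D ⊆ {z | z.im < 0}
  isOpen_union : IsOpen (D ∪ (Complex.ofReal '' realInterval a b) ∪ mirror D)
  hasDerivAt : ∀ t ∈ realInterval a b, HasDerivAt KB (K (t : ℂ)) t
  continuousOn : ContinuousOn (fun t : ℝ => K (t : ℂ)) (closure (realInterval a b))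
  differentiableOn :
    DifferentiableOn ℂ K (D ∪ (Complex.ofReal '' realInterval a b) ∪ mirror D)

/-- The cross-cuts `t ↦ h t (s n)`, `0 ≤ t ≤ 1`, are rectifiable and
`∫ ‖K(μ)‖ (1 + |μ|)⁻¹ |dμ|` along them tends to `0`. -/
def CrosscutsVanish (K : ℂ → H →L[ℂ] H) (h : ℝ → ℝ → ℂ) (s : ℕ → ℝ) : Prop :=
  (∀ n, ∃ C, LipschitzOnWith C (fun t => h t (s n)) (Icc 0 1)) ∧
    Tendsto (fun n => ∫ t in (0 : ℝ)..1,
      ‖K (h t (s n))‖ / (1 + ‖h t (s n)‖) * ‖deriv (fun τ => h τ (s n)) t‖) atTop (𝓝 0)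

/-- `h` is a continuous deformation, inside `D`, of the interval `(a, b)` into the curve `γ`.
The end points stay fixed (an infinite end point as the point at infinity), and cross-cuts of the
deformation give vanishing contributions at both ends. -/
structure IsDeformation (a b : EReal) (D : Set ℂ) (K : ℂ → H →L[ℂ] H) (γ : ℝ → ℂ)
    (h : ℝ → ℝ → ℂ) : Prop where
  continuousOn : ContinuousOn (fun p : ℝ × ℝ => h p.1 p.2) (Icc 0 1 ×ˢ univ)
  start : ∃ φ : ℝ → ℝ, StrictMono φ ∧ range φ = realInterval a b ∧ ∀ s, h 0 s = (φ s : ℂ)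
  finish : ∀ s, h 1 s = γ s
  mem : ∀ t ∈ Ioc (0 : ℝ) 1, ∀ s, h t s ∈ D
  left_end : Tendsto (fun p : ℝ × ℝ => h p.1 p.2) (𝓟 (Icc 0 1) ×ˢ atBot) (endFilter a)
  right_end : Tendsto (fun p : ℝ × ℝ => h p.1 p.2) (𝓟 (Icc 0 1) ×ˢ atTop) (endFilter b)
  left_crosscuts : ∃ s : ℕ → ℝ, Tendsto s atTop atBot ∧ CrosscutsVanish K h s
  right_crosscuts : ∃ s : ℕ → ℝ, Tendsto s atTop atTop ∧ CrosscutsVanish K h s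

/-- `γ` parametrizes a `K`-bounded contour in `D` obtained by a deformation of `(a, b)`: a simple
curve, every bounded part of which has finite length, with `∫ ‖K(μ)‖ |dμ|` finite.  (Such a curve
has a locally Lipschitz parametrization by `ℝ`, for instance through its arc length.) -/
structure IsBoundedContour (a b : EReal) (D : Set ℂ) (K : ℂ → H →L[ℂ] H) (γ : ℝ → ℂ) :
    Prop where
  locallyLipschitz : LocallyLipschitz γ
  injective : Function.Injective γ
  mem : ∀ s, γ s ∈ D
  rectifiable : ∀ R : ℝ, IntegrableOn (fun s => ‖deriv γ s‖) {s | ‖γ s‖ ≤ R}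
  deformation : ∃ h, IsDeformation a b D K γ h
  bounded : Integrable (fun s => ‖K (γ s)‖ * ‖deriv γ s‖)

/-- The variation `𝓥₀(B, Γ) = ∫_Γ ‖K'_B(μ)‖ |dμ|`. -/
def variation (K : ℂ → H →L[ℂ] H) (γ : ℝ → ℂ) : ℝ :=
  ∫ s, ‖K (γ s)‖ * ‖deriv γ s‖

/-- `d₀(Γ) = dist(σ(A₁), Γ)`. -/
def contourDist (A₁ : H →ₗ.[ℂ] H) (γ : ℝ → ℂ) : ℝ :=
  ⨅ s, Metric.infDist (γ s) (unbSpectrum A₁)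

/-- The smallness condition `𝓥₀(B, Γ) < d₀(Γ)² / 4`. -/
def IsSmallContour (A₁ : H →ₗ.[ℂ] H) (K : ℂ → H →L[ℂ] H) (γ : ℝ → ℂ) : Prop :=
  variation K γ < contourDist A₁ γ ^ 2 / 4

def rMin (A₁ : H →ₗ.[ℂ] H) (K : ℂ → H →L[ℂ] H) (γ : ℝ → ℂ) : ℝ :=
  contourDist A₁ γ / 2 - √(contourDist A₁ γ ^ 2 / 4 - variation K γ)

def rMax (A₁ : H →ₗ.[ℂ] H) (K : ℂ → H →L[ℂ] H) (γ : ℝ → ℂ) : ℝ :=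
  contourDist A₁ γ - √(variation K γ)

/-- `r₀(B)`: the infimum of `r_min(Γ)` over all small `K`-bounded contours `Γ` in `D`. -/
def rZero (a b : EReal) (D : Set ℂ) (A₁ : H →ₗ.[ℂ] H) (K : ℂ → H →L[ℂ] H) : ℝ :=
  sInf {ρ | ∃ γ, IsBoundedContour a b D K γ ∧ IsSmallContour A₁ K γ ∧ ρ = rMin A₁ K γ}

/-- `V₁(Y, Γ) = ∫_Γ K'_B(μ) (Y - μ)⁻¹ dμ`. -/
def transferV (K : ℂ → H →L[ℂ] H) (γ : ℝ → ℂ) (Y : H →ₗ.[ℂ] H) : H →L[ℂ] H :=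
  ∫ s, deriv γ s • (K (γ s) ∘L unbResolvent Y (γ s))

/-- `X` is the solution of `X = V₁(A₁ + X, Γ)` in the balls of radii `r < r_max(Γ)`. -/
def IsBasicSolution (A₁ : H →ₗ.[ℂ] H) (K : ℂ → H →L[ℂ] H) (γ : ℝ → ℂ) (X : H →L[ℂ] H) : Prop :=
  ‖X‖ < rMax A₁ K γ ∧ X = transferV K γ (addBounded A₁ X)

end Contours

/-! ### The circles `γ_i` and the projections `Q_i` -/

/-- The indices `i = 0, i₀, i₀ + 1, …`. -/
def circleIndex (i₀ : ℕ) : Set ℕ := {i | i = 0 ∨ i₀ ≤ i}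

instance (i₀ : ℕ) : DecidablePred (· ∈ circleIndex i₀) :=
  fun i => inferInstanceAs (Decidable (i = 0 ∨ i₀ ≤ i))

def circleCenter (lam : ℕ → ℝ) (i₀ i : ℕ) : ℝ :=
  if i = 0 then (lam 1 + lam (i₀ - 1)) / 2 else lam i

def circleRadius (lam : ℕ → ℝ) (i₀ : ℕ) (r : ℝ) (i : ℕ) : ℝ :=
  if i = 0 then (lam (i₀ - 1) - lam 1) / 2 + r else r

/-- The projection `Q_i` of `T` over the circle `γ_i`. -/
def circleProjection {H : Type*} [NormedAddCommGroup H] [InnerProductSpace ℂ H]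
    (T : H →ₗ.[ℂ] H) (lam : ℕ → ℝ) (i₀ : ℕ) (r : ℝ) (i : ℕ) : H →L[ℂ] H :=
  rieszProjection T (circleCenter lam i₀ i : ℂ) (circleRadius lam i₀ r i)

end

noncomputable section

/-! ### Primitives on simply connected domains -/

/-! Compactness of the resolvent makes `A₁` diagonal in an orthonormal basis, so `A₁ + X` is a
bounded perturbation of an explicit operator, and a point at distance `δ > ‖X‖` from the spectrum of
`A₁` lies in the resolvent set of the sum. The circles have distance at least `r` from the spectrum,
so everything rests on `‖X‖ ≤ r₀ < r`.

Bound on `X`. On its own contour the fixed point equation gives `‖X‖ (d₀ - ‖X‖) ≤ 𝓥₀`, and `‖X‖ <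
r_max` selects the branch `‖X‖ ≤ r_min`. For another small contour, the Picard iterates from `0`
stay in both `r_min` balls and converge to `X`, provided that the operator integral of a small
perturbation does not depend on the contour (`transferV_eq`). To see this, expand the resolvent in a
Neumann series. Evaluated on an eigenvector, the rightmost factor `(A₁ - μ)⁻¹` is a scalar pole; by
induction all factors become scalar, and polarization leaves integrals of `⟨u, K u⟩ ∏ (p - μ)⁻¹`.
Such a scalar function has a primitive on the simply connected `D^l` that extends to the interval
off the poles. It has limits at both ends of the interval, because `⟨u, K u⟩` is there the
derivative of a bounded increasing function; the cross-cuts carry these limits to the contour, the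
decay of one pole compensating the weight `(1 + |μ|)⁻¹`. So both integrals equal the same difference
of limits (`integral_contour_eq`).

Completeness. By Cauchy's theorem the sum of the first Riesz projections is the one over a large
circle crossing the real axis midway between `λ_n` and `λ_{n+1}`. It differs from the spectral
projection of `A₁` by the integral of an operator of norm at most `2‖X‖ / dist²`. Since the spectrum
is real, `dist ≥ max (δ, |Im z|)` with `δ` half the gap, and the integral is `O(‖X‖ / δ)` uniformly
in the radius (`norm_circleIntegral_le_of_norm_le_inv_sq`). This tends to zero.

Unconditional convergence. Let `P_i` be the spectral projection of `A₁` inside the circle and `N_i =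
Q_i - P_i`. With the circle enlarged to half the gap `ρ_i`, `‖N_i‖ ≤ a_i = 2‖X‖ / ρ_i`, while the
part of `N_i` compressed to the complement of `P_i` is `O(a_i²)`, its first order term being
holomorphic inside the circle. Orthogonality of the `P_i`, Cauchy–Schwarz and `∑ a_i² < ∞` make
`N_i` unconditionally summable in norm (`norm_sum_le_of_specProj`), and `∑ P_i` converges
unconditionally in the strong sense. -/

theorem sub_eq_sub_of_hasDerivAt {s : Set ℂ} (hs : Convex ℝ s) {f G₁ G₂ : ℂ → ℂ}
    (h₁ : ∀ z ∈ s, HasDerivAt G₁ (f z) z) (h₂ : ∀ z ∈ s, HasDerivAt G₂ (f z) z)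
    {x y : ℂ} (hx : x ∈ s) (hy : y ∈ s) : G₁ x - G₂ x = G₁ y - G₂ y := by
  have h : ∀ z ∈ s, HasDerivWithinAt (G₁ - G₂) 0 s z := fun z hz => by
    simpa using ((h₁ z hz).sub (h₂ z hz)).hasDerivWithinAt
  have := hs.norm_image_sub_le_of_norm_hasDerivWithin_le (C := 0) h (by simp) hy hx
  simpa [sub_eq_zero] using this

/-- A copy of a type, with the discrete topology. -/
structure DiscreteCopy (F : Type*) where
  val : F

instance (F : Type*) : TopologicalSpace (DiscreteCopy F) := ⊥

instance (F : Type*) : DiscreteTopology (DiscreteCopy F) := ⟨rfl⟩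

/-- The bundle of germs of primitives of a function: over the ball `ball x (r x)`, the point `v` of
the fibre stands for the germ of `F x + v`. -/
def primitiveBundle {U : Set ℂ} (f : ℂ → ℂ) (r : U → ℝ) (F : U → ℂ → ℂ)
    (hr : ∀ x, 0 < r x) (hF : ∀ x : U, ∀ z ∈ Metric.ball (x : ℂ) (r x), HasDerivAt (F x) (f z) z) :
    FiberBundleCore U U (DiscreteCopy ℂ) where
  baseSet x := Subtype.val ⁻¹' Metric.ball (x : ℂ) (r x)
  isOpen_baseSet x := Metric.isOpen_ball.preimage continuous_subtype_val
  indexAt := id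
  mem_baseSet_at x := Metric.mem_ball_self (hr x)
  coordChange i j x v := ⟨v.val + (F i x - F j x)⟩
  coordChange_self i x _ v := by simp
  continuousOn_coordChange i j := by
    rintro ⟨x, v⟩ ⟨⟨hi, hj⟩, -⟩
    obtain ⟨ε, hε, hball⟩ := Metric.isOpen_iff.1
      (Metric.isOpen_ball.inter Metric.isOpen_ball : IsOpen
        (Metric.ball (i : ℂ) (r i) ∩ Metric.ball (j : ℂ) (r j))) (x : ℂ) ⟨hi, hj⟩
    -- On a ball inside both charts the two primitives differ by a constant, so near `(x, v)` the
    -- coordinate change is constant; this is where discreteness of the fibre is used.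
    refine (continuousAt_const (y := (⟨v.val + (F i x - F j x)⟩ : DiscreteCopy ℂ))).congr ?_
      |>.continuousWithinAt
    have h1 : ∀ᶠ p : U × DiscreteCopy ℂ in 𝓝 (x, v), (p.1 : ℂ) ∈ Metric.ball (x : ℂ) ε :=
      (continuous_subtype_val.comp continuous_fst).continuousAt.eventually_mem
        (Metric.ball_mem_nhds _ hε)
    have h2 : ∀ᶠ p : U × DiscreteCopy ℂ in 𝓝 (x, v), p.2 = v :=
      continuous_snd.continuousAt.eventually_mem
        ((isOpen_discrete {v}).mem_nhds (mem_singleton v))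
    filter_upwards [h1, h2] with p hp hpv
    rw [hpv]
    congr 2
    exact sub_eq_sub_of_hasDerivAt (convex_ball (x : ℂ) ε) (fun z hz => hF i z (hball hz).1)
      (fun z hz => hF j z (hball hz).2) (Metric.mem_ball_self hε) hp
  coordChange_comp i j k x _ v := by
    simp only [DiscreteCopy.mk.injEq]
    ring

/-- A holomorphic function on a simply connected domain has a primitive. -/
theorem IsSimplyConnected.exists_primitive {U : Set ℂ} (hU : IsSimplyConnected U) (hUo : IsOpen U)
    {f : ℂ → ℂ} (hf : DifferentiableOn ℂ f U) : ∃ G : ℂ → ℂ, ∀ z ∈ U, HasDerivAt G (f z) z := by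
  classical
  have hloc : ∀ x : U, ∃ r : ℝ, 0 < r ∧ Metric.ball (x : ℂ) r ⊆ U ∧
      ∃ F : ℂ → ℂ, ∀ z ∈ Metric.ball (x : ℂ) r, HasDerivAt F (f z) z := by
    intro x
    obtain ⟨r, hr, hb⟩ := Metric.isOpen_iff.1 hUo x x.2
    exact ⟨r, hr, hb, (hf.mono hb).isExactOn_ball⟩
  choose r hr hrU F hF using hloc
  let Z := primitiveBundle f r F hr hF
  have := hU.simplyConnectedSpace
  have := hUo.locallyPathConnectedSpace
  obtain ⟨x₀, hx₀⟩ := hU.nonempty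
  have cov : IsCoveringMap Z.proj := IsFiberBundle.isCoveringMap fun x =>
    ⟨Z.localTriv x, Metric.mem_ball_self (hr x)⟩
  -- The germs form a covering of the simply connected `U`, so the identity of `U` lifts to a global
  -- section: a coherent choice of local primitives.
  obtain ⟨S, ⟨-, hS⟩, -⟩ := cov.existsUnique_continuousMap_lifts (ContinuousMap.id U)
    (⟨x₀, hx₀⟩ : U) (⟨⟨x₀, hx₀⟩, (⟨0⟩ : DiscreteCopy ℂ)⟩ : Z.TotalSpace) rfl
  have hSx : ∀ x : U, (S x).1 = x := fun x => congrFun hS x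
  -- the coordinate of the section in the chart at `i`
  let c : U → U → ℂ := fun i x => ((Z.localTriv i) (S x)).2.val
  let v : U → ℂ := fun x => DiscreteCopy.val (F := ℂ) (S x).2
  have hc : ∀ i x : U, c i x = v x + (F x x - F i x) := by
    intro i x
    change v x + (F (S x).1 ((S x).1 : U) - F i ((S x).1 : U)) = _
    rw [hSx]
  let G : ℂ → ℂ := fun z => if h : z ∈ U then F ⟨z, h⟩ z + v ⟨z, h⟩ else 0
  refine ⟨G, fun z hz => ?_⟩
  let i : U := ⟨z, hz⟩
  have hcont : ContinuousAt (fun x : U => (Z.localTriv i) (S x)) i :=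
    ((Z.localTriv i).continuousAt (by
      rw [FiberBundleCore.mem_localTriv_source, hSx]
      exact Metric.mem_ball_self (hr i))).comp S.continuous.continuousAt
  have hlc : ∀ᶠ x in 𝓝 i, c i x = c i i :=
    by
    have h := (continuousAt_snd.comp hcont).eventually_mem (isOpen_discrete {_}
      |>.mem_nhds (mem_singleton _))
    filter_upwards [h] with x hx using congrArg DiscreteCopy.val hx
  have hlc' : ∀ᶠ w in 𝓝 z, ∀ hw : w ∈ U, c i ⟨w, hw⟩ = c i i := by
    rw [show 𝓝 i = comap Subtype.val (𝓝 z) from nhds_subtype_eq_comap, eventually_comap] at hlc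
    filter_upwards [hlc] with w hw hwU using hw _ rfl
  have hG : G =ᶠ[𝓝 z] fun w => F i w + c i i := by
    filter_upwards [hlc', hUo.mem_nhds hz] with w hw hwU
    rw [← hw hwU, hc]
    simp only [G, dif_pos hwU]
    ring
  exact ((hF i z (Metric.mem_ball_self (hr i))).add_const _).congr_of_eventuallyEq hG

/-! ### The fundamental theorem of calculus for Lipschitz functions -/

theorem IntervalIntegrable.ofReal' {f : ℝ → ℝ} {a b : ℝ} (hf : IntervalIntegrable f volume a b) :
    IntervalIntegrable (fun t => (f t : ℂ)) volume a b :=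
  ⟨hf.1.ofReal, hf.2.ofReal⟩

/-- Real and imaginary parts are Lipschitz, hence absolutely continuous, and the real theorem
applies to each. -/
theorem LipschitzOnWith.integral_deriv_eq_sub {g : ℝ → ℂ} {C : NNReal} {a b : ℝ}
    (hg : LipschitzOnWith C g (uIcc a b)) : ∫ t in a..b, deriv g t = g b - g a := by
  have hre : LipschitzOnWith C (fun t => (g t).re) (uIcc a b) := fun x hx y hy =>
    le_trans (by
      rw [edist_dist, edist_dist]
      exact ENNReal.ofReal_le_ofReal (by
        rw [Real.dist_eq, Complex.dist_eq, ← Complex.sub_re]; exact Complex.abs_re_le_norm _))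
      (hg hx hy)
  have him : LipschitzOnWith C (fun t => (g t).im) (uIcc a b) := fun x hx y hy =>
    le_trans (by
      rw [edist_dist, edist_dist]
      exact ENNReal.ofReal_le_ofReal (by
        rw [Real.dist_eq, Complex.dist_eq, ← Complex.sub_im]; exact Complex.abs_im_le_norm _))
      (hg hx hy)
  have are := hre.absolutelyContinuousOnInterval
  have aim := him.absolutelyContinuousOnInterval
  have h1 := are.integral_deriv_eq_sub
  have h2 := aim.integral_deriv_eq_sub
  have hcongr : ∫ t in a..b, deriv g t =
      ∫ t in a..b, ((deriv (fun t => (g t).re) t : ℝ) : ℂ) +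
        ((deriv (fun t => (g t).im) t : ℝ) : ℂ) * Complex.I := by
    apply intervalIntegral.integral_congr_ae
    filter_upwards [are.ae_differentiableAt, aim.ae_differentiableAt] with x h1 h2 hx
    have d1 := (h1 (uIoc_subset_uIcc hx)).hasDerivAt.ofReal_comp
    have d2 := (h2 (uIoc_subset_uIcc hx)).hasDerivAt.ofReal_comp
    have := (d1.add (d2.mul_const Complex.I)).deriv
    rw [← this]
    congr 1
    ext t
    simp
  rw [hcongr, intervalIntegral.integral_add, intervalIntegral.integral_mul_const,
    intervalIntegral.integral_ofReal, intervalIntegral.integral_ofReal, h1, h2]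
  · apply Complex.ext <;> simp
  · exact IntervalIntegrable.ofReal' are.intervalIntegrable_deriv
  · exact (IntervalIntegrable.ofReal' aim.intervalIntegrable_deriv).mul_const _

theorem LipschitzOnWith.norm_deriv_le_of_mem_Ioo {g : ℝ → ℂ} {C : NNReal} {a b : ℝ}
    (hg : LipschitzOnWith C g (Icc a b)) : ∀ t ∈ Ioo a b, ‖deriv g t‖ ≤ C := fun _ ht =>
  norm_deriv_le_of_lipschitzOn (Icc_mem_nhds ht.1 ht.2) hg

theorem LipschitzOnWith.intervalIntegrable_deriv {g : ℝ → ℂ} {C : NNReal} {a b : ℝ} (hab : a ≤ b)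
    (hg : LipschitzOnWith C g (Icc a b)) : IntervalIntegrable (deriv g) volume a b := by
  rw [intervalIntegrable_iff_integrableOn_Ioo_of_le hab]
  refine Measure.integrableOn_of_bounded (M := C) (by simp)
    (measurable_deriv g).aestronglyMeasurable ?_
  filter_upwards [ae_restrict_mem measurableSet_Ioo] with t ht
    using hg.norm_deriv_le_of_mem_Ioo t ht

/-- Lipschitz functions on an interval are differentiable almost everywhere. -/
theorem LipschitzOnWith.ae_differentiableAt_of_mem_Ioo {g : ℝ → ℂ} {C : NNReal} {a b : ℝ}
    (hg : LipschitzOnWith C g (Icc a b)) :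
    ∀ᵐ t, t ∈ Ioo a b → DifferentiableAt ℝ g t := by
  filter_upwards [hg.ae_differentiableWithinAt_of_mem] with t ht h
  exact (ht (Ioo_subset_Icc_self h)).differentiableAt (Icc_mem_nhds h.1 h.2)

/-- Integration of a derivative along a Lipschitz path. -/
theorem integral_deriv_smul_comp_eq_sub {U : Set ℂ} (hU : IsOpen U) {f G : ℂ → ℂ}
    (hG : ∀ z ∈ U, HasDerivAt G (f z) z) {g : ℝ → ℂ} {C : NNReal} {a b : ℝ} (hab : a ≤ b)
    (hg : LipschitzOnWith C g (Icc a b)) (hgU : ∀ t ∈ Icc a b, g t ∈ U) :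
    ∫ t in a..b, deriv g t * f (g t) = G (g b) - G (g a) := by
  have hGd : DifferentiableOn ℂ G U := fun z hz => (hG z hz).differentiableAt.differentiableWithinAt
  have hGc : ContDiffOn ℂ 1 G U := hGd.contDiffOn hU
  -- `G` is holomorphic, hence `C¹` and locally Lipschitz; by compactness `G ∘ g` is Lipschitz on
  -- the whole interval.
  have hloc : ∀ t ∈ Icc a b, ∃ K : NNReal, ∃ s ∈ 𝓝[Icc a b] t, LipschitzOnWith K (G ∘ g) s := by
    intro t ht
    obtain ⟨K, V, hV, hK⟩ := ((hGc.contDiffAt (hU.mem_nhds (hgU t ht))).restrict_scalars ℝ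
      ).exists_lipschitzOnWith
    refine ⟨K * C, Icc a b ∩ g ⁻¹' V, inter_mem self_mem_nhdsWithin
      (hg.continuousOn t ht hV), ?_⟩
    exact hK.comp (hg.mono inter_subset_left) fun x hx => hx.2
  have hlip : ∃ K : NNReal, LipschitzOnWith K (G ∘ g) (Icc a b) := by
    apply LocallyLipschitzOn.exists_lipschitzOnWith_of_compact isCompact_Icc
    intro t ht
    exact hloc t ht
  obtain ⟨K, hK⟩ := hlip
  have := (show LipschitzOnWith K (G ∘ g) (uIcc a b) by rwa [uIcc_of_le hab]).integral_deriv_eq_sub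
  rw [Function.comp, Function.comp] at this
  rw [← this]
  apply intervalIntegral.integral_congr_ae
  have h0 : ∀ᵐ t : ℝ, t ≠ b := Measure.ae_ne volume b
  filter_upwards [hg.ae_differentiableAt_of_mem_Ioo, h0] with t ht hb htm
  rw [uIoc_of_le hab] at htm
  have htI : t ∈ Ioo a b := ⟨htm.1, lt_of_le_of_ne htm.2 hb⟩
  have hd := (ht htI).hasDerivAt
  have := ((hG (g t) (hgU t (Ioo_subset_Icc_self htI))).comp_of_eq t (h := g) hd rfl).deriv
  rw [this, mul_comm]

/-! ### Boundary values of primitives -/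

/-- A holomorphic function on a simply connected domain on one side of the real axis, which extends
holomorphically across the set `R` of boundary points, has a primitive that extends to `R`. -/
theorem IsSimplyConnected.exists_primitive_boundary {Ω : Set ℂ} (hΩ : IsSimplyConnected Ω)
    (hΩo : IsOpen Ω) {s : ℝ} (hs : s ≠ 0) (hside : ∀ z ∈ Ω, 0 < s * z.im) {f : ℂ → ℂ}
    (hf : DifferentiableOn ℂ f Ω) {R : Set ℝ}
    (hR : ∀ x ∈ R, ∃ ε > 0, DifferentiableOn ℂ f (Metric.ball (x : ℂ) ε) ∧
      ∀ z ∈ Metric.ball (x : ℂ) ε, 0 < s * z.im → z ∈ Ω) :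
    ∃ G : ℂ → ℂ, (∀ z ∈ Ω, HasDerivAt G (f z) z) ∧
      (∀ x ∈ R, HasDerivAt (fun t : ℝ => G t) (f x) x) ∧
      ∀ x ∈ R, ContinuousWithinAt G (Ω ∪ Complex.ofReal '' R) x := by
  obtain ⟨G, hG⟩ := hΩ.exists_primitive hΩo hf
  let side : Set ℂ := {w | 0 < s * w.im}
  have hside_open : IsOpen side := isOpen_lt continuous_const (by fun_prop)
  have hside_conv : Convex ℝ side := by
    intro x hx y hy a b ha hb hab
    simp only [side, mem_ofPred_eq, Complex.add_im, Complex.smul_im, smul_eq_mul] at *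
    rcases ha.eq_or_lt with rfl | ha
    · have : b = 1 := by linarith
      subst this; simpa using hy
    · nlinarith [mul_pos ha hx, mul_nonneg hb hy.le]
  have hclosure : ∀ z : ℂ, 0 ≤ s * z.im → (𝓝[side] z).NeBot := by
    intro z hz
    rw [← mem_closure_iff_nhdsWithin_neBot, Metric.mem_closure_iff]
    intro ε hε
    refine ⟨z + (ε / 2 * SignType.sign s : ℝ) * Complex.I, ?_, ?_⟩
    · have : 0 < s * (SignType.sign s : ℝ) := by
        rw [mul_comm, sign_mul_self]; exact abs_pos.2 hs
      simp only [side, mem_ofPred_eq, Complex.add_im, Complex.mul_I_im, Complex.ofReal_re]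
      nlinarith
    · rw [dist_eq_norm]
      have : |(SignType.sign s : ℝ)| ≤ 1 := by
        rcases lt_trichotomy s 0 with h | h | h <;> simp [h]
      simp only [sub_add_cancel_left, norm_neg, norm_mul, Complex.norm_I, mul_one,
        Complex.norm_real, Real.norm_eq_abs, abs_of_pos (half_pos hε)]
      nlinarith
  -- The limit of `G` from within the half-plane: `G` itself on `Ω`, its boundary value on `R`.
  -- Elsewhere the value is irrelevant.
  let H : ℂ → ℂ := fun z => limUnder (𝓝[side] z) G
  have hHΩ : ∀ z ∈ Ω, H z = G z := by
    intro z hz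
    have hzs : z ∈ side := hside z hz
    have : 𝓝[side] z = 𝓝 z := hside_open.nhdsWithin_eq hzs
    simp only [H, this]
    exact (hG z hz).continuousAt.tendsto.limUnder_eq
  have key : ∀ x ∈ R, ∃ ε > 0, ∃ g : ℂ → ℂ, (∀ z ∈ Metric.ball (x : ℂ) ε, HasDerivAt g (f z) z) ∧
      ∀ z ∈ Metric.ball (x : ℂ) ε, 0 ≤ s * z.im → H z = g z := by
    intro x hx
    obtain ⟨ε, hε, hfb, hbΩ⟩ := hR x hx
    obtain ⟨g, hg⟩ := hfb.isExactOn_ball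
    have hx0 : (𝓝[side] (x : ℂ)).NeBot := hclosure x (by simp)
    obtain ⟨z₀, hz₀b, hz₀s⟩ := (mem_closure_iff_nhdsWithin_neBot.2 hx0 : (x : ℂ) ∈ closure side)
      |> fun h => mem_closure_iff.1 h _ Metric.isOpen_ball (Metric.mem_ball_self hε)
    refine ⟨ε, hε, fun z => g z + (G z₀ - g z₀), fun z hz => (hg z hz).add_const _, ?_⟩
    -- The half-disc is convex, so `G` and the primitive `g` on the full disc differ there by one
    -- constant; thus `g` continues `G` across the axis.
    have hEq : ∀ z ∈ Metric.ball (x : ℂ) ε ∩ side, G z = g z + (G z₀ - g z₀) := by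
      intro z hz
      have := sub_eq_sub_of_hasDerivAt ((convex_ball (x : ℂ) ε).inter hside_conv)
        (fun z hz => hG z (hbΩ z hz.1 hz.2)) (fun z hz => hg z hz.1) hz ⟨hz₀b, hz₀s⟩
      linear_combination this
    intro z hz hzs
    have := hclosure z hzs
    apply Tendsto.limUnder_eq
    have h1 : Tendsto (fun z => g z + (G z₀ - g z₀)) (𝓝[side] z) (𝓝 (g z + (G z₀ - g z₀))) :=
      ((hg z hz).continuousAt.add continuousAt_const).tendsto.mono_left nhdsWithin_le_nhds
    refine h1.congr' ?_
    filter_upwards [self_mem_nhdsWithin, nhdsWithin_le_nhds (Metric.isOpen_ball.mem_nhds hz)]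
      with w hw1 hw2 using (hEq w ⟨hw2, hw1⟩).symm
  refine ⟨H, fun z hz => ?_, fun x hx => ?_, fun x hx => ?_⟩
  · refine (hG z hz).congr_of_eventuallyEq ?_
    filter_upwards [hΩo.mem_nhds hz] with w hw using hHΩ w hw
  · obtain ⟨ε, hε, g, hg, hHg⟩ := key x hx
    have h1 := (hg x (Metric.mem_ball_self hε)).comp_ofReal
    refine h1.congr_of_eventuallyEq ?_
    have : ∀ᶠ t : ℝ in 𝓝 x, (t : ℂ) ∈ Metric.ball (x : ℂ) ε :=
      Complex.continuous_ofReal.continuousAt.eventually_mem (Metric.ball_mem_nhds _ hε)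
    filter_upwards [this] with t ht using hHg t ht (by simp)
  · obtain ⟨ε, hε, g, hg, hHg⟩ := key x hx
    have h1 : ContinuousWithinAt g (Ω ∪ Complex.ofReal '' R) x :=
      (hg x (Metric.mem_ball_self hε)).continuousAt.continuousWithinAt
    refine h1.congr_of_eventuallyEq ?_ (hHg x (Metric.mem_ball_self hε) (by simp))
    filter_upwards [self_mem_nhdsWithin, nhdsWithin_le_nhds (Metric.ball_mem_nhds (x : ℂ) hε)]
      with w hw1 hw2
    refine hHg w hw2 ?_
    rcases hw1 with h | ⟨t, -, rfl⟩
    · exact (hside w h).le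
    · simp

/-- The increment of a primitive along a path starting at the boundary. -/
theorem norm_primitive_sub_le {Ω : Set ℂ} (hΩo : IsOpen Ω) {f G : ℂ → ℂ}
    (hG : ∀ z ∈ Ω, HasDerivAt G (f z) z) {R : Set ℝ}
    (hGc : ∀ x ∈ R, ContinuousWithinAt G (Ω ∪ Complex.ofReal '' R) x)
    {c : ℝ → ℂ} {C : NNReal} (hc : LipschitzOnWith C c (Icc 0 1)) {x : ℝ} (hx : x ∈ R)
    (hc0 : c 0 = x) (hcΩ : ∀ t ∈ Ioc (0 : ℝ) 1, c t ∈ Ω) {B : ℝ → ℝ}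
    (hB : IntervalIntegrable B volume 0 1) (hB0 : ∀ t, 0 ≤ B t)
    (hfB : ∀ t ∈ Ioc (0 : ℝ) 1, ‖deriv c t‖ * ‖f (c t)‖ ≤ B t) :
    ‖G (c 1) - G x‖ ≤ ∫ t in (0 : ℝ)..1, B t := by
  -- `G` need not be differentiable at the boundary point `c 0`, so the path is cut off at `ε` and
  -- `ε → 0` is taken by continuity of `G` up to `R`.
  have hε : ∀ ε ∈ Ioc (0 : ℝ) 1, ‖G (c 1) - G (c ε)‖ ≤ ∫ t in (0 : ℝ)..1, B t := by
    intro ε hε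
    have hsub : Icc ε 1 ⊆ Icc 0 1 := Icc_subset_Icc_left hε.1.le
    rw [← integral_deriv_smul_comp_eq_sub hΩo hG hε.2 (hc.mono hsub)
      (fun t ht => hcΩ t ⟨hε.1.trans_le ht.1, ht.2⟩)]
    have hBε : IntervalIntegrable B volume ε 1 := hB.mono_set (by
      rw [uIcc_of_le hε.2, uIcc_of_le zero_le_one]; exact hsub)
    calc _ ≤ ∫ t in ε..1, B t := by
          refine intervalIntegral.norm_integral_le_of_norm_le hε.2 ?_ hBε
          filter_upwards with t ht
          rw [norm_mul]
          exact hfB t ⟨hε.1.trans ht.1, ht.2⟩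
      _ ≤ ∫ t in (0 : ℝ)..1, B t := by
          refine intervalIntegral.integral_mono_interval hε.1.le hε.2 le_rfl ?_ hB
          filter_upwards with t using hB0 t
  have hlim : Tendsto (fun ε => ‖G (c 1) - G (c ε)‖) (𝓝[>] 0) (𝓝 ‖G (c 1) - G x‖) := by
    have hcc : Tendsto c (𝓝[>] 0) (𝓝[Ω ∪ Complex.ofReal '' R] (x : ℂ)) := by
      refine tendsto_nhdsWithin_iff.2 ⟨?_, ?_⟩
      · rw [← hc0]
        have := (hc.continuousOn 0 (by simp)).tendsto
        exact this.mono_left (nhdsWithin_le_of_mem (Icc_mem_nhdsGT zero_lt_one))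
      · filter_upwards [Ioc_mem_nhdsGT zero_lt_one] with t ht using Or.inl (hcΩ t ht)
    exact (((hGc x hx).tendsto.comp hcc).const_sub _).norm
  refine le_of_tendsto hlim ?_
  filter_upwards [Ioc_mem_nhdsGT (zero_lt_one' ℝ)] with ε h using hε ε h

/-- A function on an interval has a limit at an end point if its derivative is dominated by that of
a function with a limit. -/
theorem exists_tendsto_of_norm_deriv_le {F : Filter ℝ} [F.NeBot] {S : Set ℝ} (hS : S ∈ F)
    (hSc : S.OrdConnected) {φ : ℝ → ℝ} (hφ : StrictMono φ) {J : Set ℝ} (hJ : J.OrdConnected)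
    (hrange : range φ = J) {g : ℝ → ℂ} {g' : ℝ → ℂ} {κ κ' : ℝ → ℝ} {C : ℝ}
    (hg : ∀ s ∈ S, HasDerivAt g (g' (φ s)) (φ s)) (hκ : ∀ s ∈ S, HasDerivAt κ (κ' (φ s)) (φ s))
    (hle : ∀ s ∈ S, ‖g' (φ s)‖ ≤ C * κ' (φ s)) {ℓ : ℝ} (hlim : Tendsto (fun s => κ (φ s)) F (𝓝 ℓ)) :
    ∃ L, Tendsto (fun s => g (φ s)) F (𝓝 L) := by
  have hmem : ∀ s ∈ S, ∀ t ∈ S, ∀ x ∈ Icc (φ s) (φ t), ∃ u ∈ S, φ u = x := by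
    intro s hs t ht x hx
    have : x ∈ J := hJ.out (hrange ▸ mem_range_self s) (hrange ▸ mem_range_self t) hx
    rw [← hrange] at this
    obtain ⟨u, rfl⟩ := this
    exact ⟨u, hSc.out hs ht ⟨hφ.le_iff_le.1 hx.1, hφ.le_iff_le.1 hx.2⟩, rfl⟩
  -- The mean value inequality bounds increments of `g` by those of `κ`, so `g ∘ φ` inherits the
  -- Cauchy property from `κ ∘ φ`.
  have hdist : ∀ s ∈ S, ∀ t ∈ S, s ≤ t → ‖g (φ t) - g (φ s)‖ ≤ C * (κ (φ t) - κ (φ s)) := by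
    intro s hs t ht hst
    have hle' := hφ.monotone hst
    refine image_norm_le_of_norm_deriv_right_le_deriv_boundary'
      (f := fun x => g x - g (φ s)) (f' := g')
      (B := fun x => C * (κ x - κ (φ s))) (B' := fun x => C * κ' x) (a := φ s) (b := φ t)
      ?_ ?_ ?_ ?_ ?_ ?_ ⟨hle', le_rfl⟩
    · intro x hx
      obtain ⟨u, hu, rfl⟩ := hmem s hs t ht x hx
      exact ((hg u hu).continuousAt.sub continuousAt_const).continuousWithinAt
    · intro x hx
      obtain ⟨u, hu, rfl⟩ := hmem s hs t ht x ⟨hx.1, hx.2.le⟩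
      exact ((hg u hu).sub_const _).hasDerivWithinAt
    · simp
    · intro x hx
      obtain ⟨u, hu, rfl⟩ := hmem s hs t ht x hx
      exact (((hκ u hu).sub_const _).const_mul C).continuousAt.continuousWithinAt
    · intro x hx
      obtain ⟨u, hu, rfl⟩ := hmem s hs t ht x ⟨hx.1, hx.2.le⟩
      exact (((hκ u hu).sub_const _).const_mul C).hasDerivWithinAt
    · intro x hx
      obtain ⟨u, hu, rfl⟩ := hmem s hs t ht x ⟨hx.1, hx.2.le⟩
      exact hle u hu
  have hdist' : ∀ s ∈ S, ∀ t ∈ S, dist (g (φ s)) (g (φ t)) ≤ |C| * dist (κ (φ s)) (κ (φ t)) := by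
    intro s hs t ht
    rw [Real.dist_eq, ← abs_mul]
    rcases le_total s t with h | h
    · rw [dist_comm, dist_eq_norm]
      refine (hdist s hs t ht h).trans ?_
      rw [← neg_sub, mul_neg]
      exact neg_le_abs _
    · rw [dist_eq_norm]
      exact (hdist t ht s hs h).trans (le_abs_self _)
  have hc : Cauchy (map (fun s => κ (φ s)) F) := hlim.cauchy_map
  have : Cauchy (map (fun s => g (φ s)) F) := by
    rw [cauchy_map_iff] at hc ⊢
    refine ⟨inferInstance, ?_⟩
    rw [tendsto_uniformity_iff_dist_tendsto_zero] at hc ⊢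
    have h2 := hc.2.const_mul |C|
    rw [mul_zero] at h2
    refine squeeze_zero' (Eventually.of_forall fun _ => dist_nonneg) ?_ h2
    filter_upwards [prod_mem_prod hS hS] with p hp using hdist' _ hp.1 _ hp.2
  exact ⟨_, this.le_nhds_lim⟩

/-! ### Products of simple poles -/

/-- The rational function `∏ (p - z)⁻¹`, `p` running through a list. -/
def poleProd (L : List ℝ) (z : ℂ) : ℂ := (L.map fun p => ((p : ℂ) - z)⁻¹).prod

@[simp] theorem poleProd_nil (z : ℂ) : poleProd [] z = 1 := rfl

@[simp] theorem poleProd_cons (p : ℝ) (L : List ℝ) (z : ℂ) :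
    poleProd (p :: L) z = ((p : ℂ) - z)⁻¹ * poleProd L z := by simp [poleProd]

theorem differentiableAt_poleProd {L : List ℝ} {z : ℂ} (h : ∀ p ∈ L, z ≠ p) :
    DifferentiableAt ℂ (poleProd L) z := by
  induction L with
  | nil => exact differentiableAt_const (c := (1 : ℂ))
  | cons p L ih =>
    have : poleProd (p :: L) = fun z => ((p : ℂ) - z)⁻¹ * poleProd L z := by
      ext z; simp
    rw [this]
    refine DifferentiableAt.mul (DifferentiableAt.inv (by fun_prop) ?_)
      (ih fun q hq => h q (List.mem_cons_of_mem _ hq))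
    exact sub_ne_zero.2 (h p List.mem_cons_self).symm

theorem norm_poleProd_le {L : List ℝ} {z : ℂ} {d : ℝ} (hd : 0 < d)
    (h : ∀ p ∈ L, d ≤ ‖z - p‖) : ‖poleProd L z‖ ≤ d⁻¹ ^ L.length := by
  induction L with
  | nil => simp
  | cons p L ih =>
    rw [poleProd_cons, norm_mul, norm_inv, List.length_cons, pow_succ, mul_comm]
    refine mul_le_mul (ih fun q hq => h q (List.mem_cons_of_mem _ hq)) ?_ (by positivity)
      (by positivity)
    rw [norm_sub_rev]
    gcongr
    exact h p List.mem_cons_self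

/-- At an infinite end `‖p - z‖ ≥ ‖z‖ - |p| ≥ (1 + ‖z‖) / 2` once `‖z‖ ≥ 2|p| + 1`; at a finite end,
which is not the pole, continuity suffices. One pole thus absorbs the weight in the cross-cut
condition. -/
theorem eventually_norm_inv_sub_le {e : EReal} {p : ℝ} (hp : e ≠ (p : EReal)) :
    ∃ C, ∀ᶠ z in endFilter e, ‖((p : ℂ) - z)⁻¹‖ * (1 + ‖z‖) ≤ C := by
  by_cases he : e = ⊥ ∨ e = ⊤
  · rw [endFilter, if_pos he]
    refine ⟨2, ?_⟩
    have := (tendsto_norm_cobounded_atTop (E := ℂ)).eventually_ge_atTop (2 * |p| + 1)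
    filter_upwards [this] with z hz
    have h1 : ‖z‖ - |p| ≤ ‖(p : ℂ) - z‖ := by
      have := norm_sub_norm_le z (p : ℂ)
      rwa [Complex.norm_real, Real.norm_eq_abs, norm_sub_rev] at this
    have hpos : 0 < ‖(p : ℂ) - z‖ := by linarith [abs_nonneg p]
    rw [norm_inv, inv_mul_le_iff₀ hpos]
    linarith
  · rw [endFilter, if_neg he]
    push Not at he
    lift e to ℝ using ⟨he.2, he.1⟩
    have hne : (p : ℂ) - (e : ℂ) ≠ 0 := by
      rw [sub_ne_zero]
      intro h
      exact hp (by rw [Complex.ofReal_injective h])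
    have : ContinuousAt (fun z : ℂ => ‖((p : ℂ) - z)⁻¹‖ * (1 + ‖z‖)) e :=
      ((ContinuousAt.inv₀ (by fun_prop) hne).norm).mul (by fun_prop)
    exact ⟨_, (this.eventually_lt_const (lt_add_one _)).mono fun z hz => hz.le⟩

theorem eventually_norm_poleProd_le {e : EReal} {L : List ℝ} (hL : ∀ p ∈ L, e ≠ (p : EReal)) :
    ∃ C, ∀ᶠ z in endFilter e, ‖poleProd L z‖ ≤ C := by
  induction L with
  | nil => exact ⟨1, by simp⟩
  | cons p L ih =>
    obtain ⟨C, hC⟩ := ih fun q hq => hL q (List.mem_cons_of_mem _ hq)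
    obtain ⟨C', hC'⟩ := eventually_norm_inv_sub_le (hL p List.mem_cons_self)
    refine ⟨C' * C, ?_⟩
    filter_upwards [hC, hC'] with z h1 h2
    rw [poleProd_cons, norm_mul]
    have h3 : ‖((p : ℂ) - z)⁻¹‖ ≤ C' := le_trans
      (le_mul_of_one_le_right (norm_nonneg _) (by linarith [norm_nonneg z])) h2
    exact mul_le_mul h3 h1 (norm_nonneg _) ((norm_nonneg _).trans h3)

theorem eventually_norm_poleProd_mul_le {e : EReal} {L : List ℝ} (hne : L ≠ [])
    (hL : ∀ p ∈ L, e ≠ (p : EReal)) :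
    ∃ C, ∀ᶠ z in endFilter e, ‖poleProd L z‖ * (1 + ‖z‖) ≤ C := by
  obtain ⟨p, L, rfl⟩ := List.exists_cons_of_ne_nil hne
  obtain ⟨C, hC⟩ := eventually_norm_poleProd_le fun q hq => hL q (List.mem_cons_of_mem _ hq)
  obtain ⟨C', hC'⟩ := eventually_norm_inv_sub_le (hL p List.mem_cons_self)
  refine ⟨C' * C, ?_⟩
  filter_upwards [hC, hC'] with z h1 h2
  rw [poleProd_cons, norm_mul, mul_right_comm]
  exact mul_le_mul h2 h1 (norm_nonneg _) (le_trans (by positivity) h2)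

/-! ### The monotone quadratic forms of the coupling function -/

section Coupling

variable {H₀ H₁ : Type*} [NormedAddCommGroup H₀] [InnerProductSpace ℂ H₀] [CompleteSpace H₀]
  [NormedAddCommGroup H₁] [InnerProductSpace ℂ H₁] [CompleteSpace H₁]

instance ProjectionMeasure.isFiniteMeasure_scalarMeasure (E : ProjectionMeasure H₀) (x : H₀) :
    IsFiniteMeasure (E.scalarMeasure x) :=
  ⟨by rw [E.scalarMeasure_apply x MeasurableSet.univ]; exact ENNReal.ofReal_lt_top⟩

/-- The distribution function `t ↦ ⟨x, E((-∞, t)) x⟩`. -/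
def ProjectionMeasure.distribution (E : ProjectionMeasure H₀) (x : H₀) (t : ℝ) : ℝ :=
  (E.scalarMeasure x (Iio t)).toReal

theorem ProjectionMeasure.inner_proj_Iio (E : ProjectionMeasure H₀) (x : H₀) (t : ℝ) :
    ⟪x, E.proj (Iio t) x⟫_ℂ = (E.distribution x t : ℂ) := by
  have hp := E.isStarProjection (Iio t) measurableSet_Iio
  have h2 : (E.proj (Iio t)).adjoint = E.proj (Iio t) := hp.isSelfAdjoint
  rw [distribution, E.scalarMeasure_apply x measurableSet_Iio,
    ENNReal.toReal_ofReal (E.re_inner_nonneg x measurableSet_Iio)]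
  apply Complex.ext
  · simp
  · rw [Complex.ofReal_im, ← Complex.conj_eq_iff_im, inner_conj_symm,
      ← ContinuousLinearMap.adjoint_inner_right, h2]

theorem ProjectionMeasure.monotone_distribution (E : ProjectionMeasure H₀) (x : H₀) :
    Monotone (E.distribution x) := fun _ _ h =>
  ENNReal.toReal_mono (measure_ne_top _ _) (measure_mono (Iio_subset_Iio h))

theorem ProjectionMeasure.distribution_le (E : ProjectionMeasure H₀) (x : H₀) (t : ℝ) :
    E.distribution x t ≤ (E.scalarMeasure x univ).toReal :=
  ENNReal.toReal_mono (measure_ne_top _ _) (measure_mono (subset_univ _))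

theorem inner_couplingFunction (E : ProjectionMeasure H₀) (B : H₀ →L[ℂ] H₁) (u : H₁) (t : ℝ) :
    ⟪u, couplingFunction E B t u⟫_ℂ = (E.distribution (B.adjoint u) t : ℂ) := by
  rw [← E.inner_proj_Iio, ContinuousLinearMap.adjoint_inner_left]
  rfl

variable {E : ProjectionMeasure H₀} {B : H₀ →L[ℂ] H₁} {a b : EReal} {D : Set ℂ}
  {K : ℂ → H₁ →L[ℂ] H₁}

/-- The quadratic form of `K_B` is an increasing distribution function, so its derivative is real,
nonnegative and equal to its own modulus. A bounded increasing function then dominates the quadratic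
form of `K` up to the ends of the interval. -/
theorem IsContinuedDerivative.hasDerivAt_distribution
    (hK : IsContinuedDerivative a b D (couplingFunction E B) K) (u : H₁) {t : ℝ}
    (ht : t ∈ realInterval a b) :
    HasDerivAt (E.distribution (B.adjoint u)) (⟪u, K t u⟫_ℂ).re t ∧
      ‖⟪u, K t u⟫_ℂ‖ = (⟪u, K t u⟫_ℂ).re := by
  have h1 : HasDerivAt (fun t => ⟪u, couplingFunction E B t u⟫_ℂ) ⟪u, K t u⟫_ℂ t := by
    let Φ : (H₁ →L[ℂ] H₁) →L[ℝ] ℂ :=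
      ((innerSL ℂ u).comp (ContinuousLinearMap.apply ℂ H₁ u)).restrictScalars ℝ
    exact Φ.hasFDerivAt.comp_hasDerivAt t (hK.hasDerivAt t ht)
  have h2 : HasDerivAt (E.distribution (B.adjoint u)) (⟪u, K t u⟫_ℂ).re t := by
    have := Complex.reCLM.hasFDerivAt.comp_hasDerivAt t h1
    refine this.congr_of_eventuallyEq (Eventually.of_forall fun t => ?_)
    simp [inner_couplingFunction]
  refine ⟨h2, ?_⟩
  have h3 : ⟪u, K t u⟫_ℂ = (((⟪u, K t u⟫_ℂ).re : ℝ) : ℂ) := by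
    have := h2.ofReal_comp
    refine h1.unique (this.congr_of_eventuallyEq (Eventually.of_forall fun t => ?_))
    simp [inner_couplingFunction]
  have h4 : 0 ≤ (⟪u, K t u⟫_ℂ).re := by
    rw [← h2.deriv]; exact (E.monotone_distribution _).deriv_nonneg
  conv_lhs => rw [h3]
  rw [Complex.norm_real, Real.norm_of_nonneg h4]

end Coupling

/-! ### Independence of the contour -/

section Contour

/-- The sign `s` lets both half-planes be treated at once: `D^l` is the part of the domain of `K`
where `s * z.im` is positive. -/
theorem IsContinuedDerivative.exists_side {H : Type*} [NormedAddCommGroup H]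
    [InnerProductSpace ℂ H] {a b : EReal} {D : Set ℂ} {KB : ℝ → H →L[ℂ] H} {K : ℂ → H →L[ℂ] H}
    (hK : IsContinuedDerivative a b D KB K) (l : ℤˣ) :
    ∃ s : ℝ, s ≠ 0 ∧ (∀ z ∈ sideDomain D l, 0 < s * z.im) ∧ IsOpen (sideDomain D l) ∧
      IsSimplyConnected (sideDomain D l) ∧
      sideDomain D l ⊆ D ∪ (Complex.ofReal '' realInterval a b) ∪ mirror D ∧
      ∀ z ∈ D ∪ (Complex.ofReal '' realInterval a b) ∪ mirror D, 0 < s * z.im →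
        z ∈ sideDomain D l := by
  have hD := hK.subset_lower
  have hM : ∀ z ∈ mirror D, 0 < z.im := fun z hz => by simpa using hD hz
  rcases Int.units_eq_one_or l with rfl | rfl
  · have e : sideDomain D 1 = mirror D := if_pos rfl
    rw [e]
    refine ⟨1, one_ne_zero, by simpa using hM, hK.isOpen.preimage Complex.continuous_conj,
      (Complex.conjLIE.toHomeomorph.isSimplyConnected_preimage).2 hK.isSimplyConnected,
      subset_union_right, ?_⟩
    rintro z ((hz | ⟨t, -, rfl⟩) | hz) h
    · have : z.im < 0 := hD hz
      linarith
    · simp at h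
    · exact hz
  · have e : sideDomain D (-1) = D := if_neg (by decide)
    rw [e]
    refine ⟨-1, by norm_num, fun z hz => ?_, hK.isOpen, hK.isSimplyConnected,
      subset_union_left.trans subset_union_left, ?_⟩
    · have : z.im < 0 := hD hz
      linarith
    · rintro z ((hz | ⟨t, -, rfl⟩) | hz) h
      · exact hz
      · simp at h
      · have := hM z hz
        linarith

theorem ordConnected_realInterval (a b : EReal) : (realInterval a b).OrdConnected :=
  ⟨fun _ hx _ hy _ hz => ⟨hx.1.trans_le (EReal.coe_le_coe_iff.2 hz.1),
    (EReal.coe_le_coe_iff.2 hz.2).trans_lt hy.2⟩⟩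

/-- Two increasing parametrizations of one interval differ by an order automorphism of `ℝ`, which
preserves both ends. This is needed because every deformation comes with its own parametrization. -/
theorem tendsto_comp_of_range_eq {φ ψ : ℝ → ℝ} (hφ : StrictMono φ) (hψ : StrictMono ψ)
    (h : range φ = range ψ) {g : ℝ → ℂ} {F : Filter ℝ} (hF : F = atTop ∨ F = atBot) {L : ℂ}
    (hg : Tendsto (fun s => g (φ s)) F (𝓝 L)) : Tendsto (fun s => g (ψ s)) F (𝓝 L) := by
  have hex : ∀ s, ∃ t, φ t = ψ s := fun s => by
    have : ψ s ∈ range φ := h ▸ mem_range_self s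
    exact this
  choose τ hτ using hex
  have hmono : StrictMono τ := fun s t hst => by
    rw [← hφ.lt_iff_lt, hτ, hτ]; exact hψ hst
  have hsurj : Function.Surjective τ := fun t => by
    have : φ t ∈ range ψ := h ▸ mem_range_self t
    obtain ⟨s, hs⟩ := this
    exact ⟨s, hφ.injective (by rw [hτ, hs])⟩
  have ht : Tendsto τ F F := by
    rcases hF with rfl | rfl
    · exact (hmono.orderIsoOfSurjective τ hsurj).tendsto_atTop
    · exact (hmono.orderIsoOfSurjective τ hsurj).tendsto_atBot
  simpa [Function.comp_def, hτ] using hg.comp ht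

variable {H : Type*} [NormedAddCommGroup H] [InnerProductSpace ℂ H]

theorem norm_poleProd_mul_inner_le (L : List ℝ) (T : H →L[ℂ] H) (u : H) (z : ℂ) :
    ‖poleProd L z * ⟪u, T u⟫_ℂ‖ ≤ ‖poleProd L z‖ * (‖T‖ * ‖u‖ ^ 2) := by
  rw [norm_mul]
  gcongr
  refine (norm_inner_le_norm _ _).trans ?_
  calc ‖u‖ * ‖T u‖ ≤ ‖u‖ * (‖T‖ * ‖u‖) := by gcongr; exact T.le_opNorm u
    _ = _ := by ring

/-- The cross-cuts of a deformation do not contribute in the limit. -/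
theorem tendsto_primitive_sub {Ω W : Set ℂ} (hΩo : IsOpen Ω) (hΩW : Ω ⊆ W) {K : ℂ → H →L[ℂ] H}
    (hKW : ContinuousOn K W) {L : List ℝ} {u : H} {G : ℂ → ℂ}
    (hG : ∀ z ∈ Ω, HasDerivAt G (poleProd L z * ⟪u, K z u⟫_ℂ) z) {R : Set ℝ}
    (hRW : ∀ x ∈ R, (x : ℂ) ∈ W)
    (hGc : ∀ x ∈ R, ContinuousWithinAt G (Ω ∪ Complex.ofReal '' R) x)
    {h : ℝ → ℝ → ℂ} {φ : ℝ → ℝ} (hφ : ∀ s, h 0 s = φ s)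
    (hmem : ∀ t ∈ Ioc (0 : ℝ) 1, ∀ s, h t s ∈ Ω) {F : Filter ℝ} {e : EReal}
    (hend : Tendsto (fun p : ℝ × ℝ => h p.1 p.2) (𝓟 (Icc 0 1) ×ˢ F) (endFilter e))
    (hR : ∀ᶠ s in F, φ s ∈ R) (hL0 : L ≠ []) (hL : ∀ p ∈ L, e ≠ (p : EReal)) {s : ℕ → ℝ}
    (hs : Tendsto s atTop F) (hcc : CrosscutsVanish K h s) :
    Tendsto (fun n => G (h 1 (s n)) - G (φ (s n))) atTop (𝓝 0) := by
  obtain ⟨C, hC⟩ := eventually_norm_poleProd_mul_le hL0 hL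
  have hC' : ∀ᶠ σ in F, ∀ t ∈ Icc (0 : ℝ) 1,
      ‖poleProd L (h t σ)‖ * (1 + ‖h t σ‖) ≤ max C 0 := by
    have := hend.eventually hC
    rw [eventually_prod_iff] at this
    obtain ⟨p, hp, q, hq, hpq⟩ := this
    filter_upwards [hq] with σ hσ t ht
    exact (hpq (hp ht) hσ).trans (le_max_left _ _)
  have hlim := hcc.2.const_mul (max C 0 * ‖u‖ ^ 2)
  rw [mul_zero] at hlim
  refine squeeze_zero_norm' ?_ hlim
  filter_upwards [hs.eventually hC', hs.eventually hR] with n hn hnR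
  obtain ⟨Cn, hCn⟩ := hcc.1 n
  rw [← intervalIntegral.integral_const_mul]
  refine norm_primitive_sub_le hΩo hG hGc hCn hnR (hφ _) (fun t ht => hmem t ht _) ?_ ?_ ?_
  · apply IntervalIntegrable.const_mul
    have hmemW : ∀ t ∈ Icc (0 : ℝ) 1, h t (s n) ∈ W := by
      intro t ht
      rcases ht.1.eq_or_lt with rfl | h0
      · rw [hφ]; exact hRW _ hnR
      · exact hΩW (hmem t ⟨h0, ht.2⟩ _)
    have hcont : ContinuousOn (fun t => h t (s n)) (Icc 0 1) := hCn.continuousOn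
    refine IntervalIntegrable.continuousOn_mul (hCn.intervalIntegrable_deriv zero_le_one).norm ?_
    rw [uIcc_of_le zero_le_one]
    refine ContinuousOn.div (hKW.comp hcont hmemW).norm (by fun_prop) fun t _ => ?_
    positivity
  · intro t
    positivity
  · intro t ht
    have h1 := hn t ⟨ht.1.le, ht.2⟩
    have hpos : 0 < 1 + ‖h t (s n)‖ := by positivity
    -- Multiplying and dividing by `1 + ‖μ‖` gives one factor to the pole product, which stays
    -- bounded, and one to the cross-cut condition.
    calc _ ≤ ‖deriv (fun τ => h τ (s n)) t‖ *
          (‖poleProd L (h t (s n))‖ * (‖K (h t (s n))‖ * ‖u‖ ^ 2)) := by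
          gcongr; exact norm_poleProd_mul_inner_le _ _ _ _
      _ = (‖poleProd L (h t (s n))‖ * (1 + ‖h t (s n)‖)) * (‖u‖ ^ 2 *
          (‖K (h t (s n))‖ / (1 + ‖h t (s n)‖) * ‖deriv (fun τ => h τ (s n)) t‖)) := by
          field_simp
      _ ≤ max C 0 * (‖u‖ ^ 2 *
          (‖K (h t (s n))‖ / (1 + ‖h t (s n)‖) * ‖deriv (fun τ => h τ (s n)) t‖)) := by
          gcongr
      _ = _ := by ring

theorem LocallyLipschitz.exists_lipschitzOnWith_Icc {γ : ℝ → ℂ}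
    (hγ : LocallyLipschitz γ) (a b : ℝ) :
    ∃ C, LipschitzOnWith C γ (Icc a b) :=
  hγ.locallyLipschitzOn.exists_lipschitzOnWith_of_compact isCompact_Icc

theorem integrable_contour {γ : ℝ → ℂ} {K : ℂ → H →L[ℂ] H} {E : Type*} [NormedAddCommGroup E]
    (hint : Integrable fun s => ‖K (γ s)‖ * ‖deriv γ s‖) {f : ℝ → E} {C : ℝ}
    (hf : AEStronglyMeasurable f) (hle : ∀ s, ‖f s‖ ≤ C * (‖K (γ s)‖ * ‖deriv γ s‖)) :
    Integrable f :=
  (hint.const_mul C).mono' hf (Eventually.of_forall hle)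

end Contour

section Independence

variable {H₀ H₁ : Type*} [NormedAddCommGroup H₀] [InnerProductSpace ℂ H₀] [CompleteSpace H₀]
  [NormedAddCommGroup H₁] [InnerProductSpace ℂ H₁] [CompleteSpace H₁]
  {E : ProjectionMeasure H₀} {B : H₀ →L[ℂ] H₁} {a b : EReal} {D : Set ℂ}
  {K : ℂ → H₁ →L[ℂ] H₁}

theorem IsBoundedContour.continuous_comp
    (hK : IsContinuedDerivative a b D (couplingFunction E B) K) {l : ℤˣ} {γ : ℝ → ℂ}
    (hγ : IsBoundedContour a b (sideDomain D l) K γ) : Continuous fun s => K (γ s) := by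
  obtain ⟨-, -, -, -, -, hW, -⟩ := hK.exists_side l
  exact hK.differentiableOn.continuousOn.comp_continuous hγ.locallyLipschitz.continuous
    fun s => hW (hγ.mem s)

theorem continuous_poleProd_comp {γ : ℝ → ℂ} (hγ : Continuous γ) {L : List ℝ}
    (hL : ∀ p ∈ L, ∀ s, γ s ≠ p) : Continuous fun s => poleProd L (γ s) :=
  continuous_iff_continuousAt.2 fun s =>
    (differentiableAt_poleProd fun p hp => hL p hp s).continuousAt.comp hγ.continuousAt

/-- Each integral is the increment of one primitive `G` between the two ends of the contour, and the
cross-cuts identify its limits there with those along the interval. A nonempty `L` supplies the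
decay that the cross-cuts need; the poles are interior to the interval, away from its ends. -/
theorem integral_contour_eq (hK : IsContinuedDerivative a b D (couplingFunction E B) K) {l : ℤˣ}
    {γ₁ γ₂ : ℝ → ℂ} (hγ₁ : IsBoundedContour a b (sideDomain D l) K γ₁)
    (hγ₂ : IsBoundedContour a b (sideDomain D l) K γ₂) {L : List ℝ} (hL0 : L ≠ [])
    (hL : ∀ p ∈ L, p ∈ realInterval a b) {δ : ℝ} (hδ : 0 < δ)
    (h₁ : ∀ p ∈ L, ∀ s, δ ≤ ‖γ₁ s - p‖) (h₂ : ∀ p ∈ L, ∀ s, δ ≤ ‖γ₂ s - p‖) (u : H₁) :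
    ∫ s, deriv γ₁ s * (poleProd L (γ₁ s) * ⟪u, K (γ₁ s) u⟫_ℂ) =
      ∫ s, deriv γ₂ s * (poleProd L (γ₂ s) * ⟪u, K (γ₂ s) u⟫_ℂ) := by
  obtain ⟨σ, hσ, hside, hΩo, hΩ, hΩW, hWΩ⟩ := hK.exists_side l
  set Ω := sideDomain D l
  set W := D ∪ (Complex.ofReal '' realInterval a b) ∪ mirror D with hWdef
  set f : ℂ → ℂ := fun z => poleProd L z * ⟪u, K z u⟫_ℂ with hf
  have hfd : ∀ z ∈ W, (∀ p ∈ L, z ≠ p) → DifferentiableAt ℂ f z := by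
    intro z hz hp
    refine (differentiableAt_poleProd hp).mul ?_
    let Φ : (H₁ →L[ℂ] H₁) →L[ℂ] ℂ := (innerSL ℂ u).comp (ContinuousLinearMap.apply ℂ H₁ u)
    exact Φ.differentiableAt.comp z
      ((hK.differentiableOn z hz).differentiableAt (hK.isOpen_union.mem_nhds hz))
  -- The poles are left out: `G` has boundary values only where the integrand is holomorphic. Near
  -- the ends of the interval no pole remains.
  let R : Set ℝ := {x | x ∈ realInterval a b ∧ x ∉ L}
  have hJW : ∀ x ∈ realInterval a b, (x : ℂ) ∈ W := fun x hx => Or.inl (Or.inr ⟨x, hx, rfl⟩)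
  have hΩL : ∀ z ∈ Ω, ∀ p ∈ L, z ≠ p := by
    rintro z hz p - rfl
    simpa using hside _ hz
  have hR : ∀ x ∈ R, ∃ ε > 0, DifferentiableOn ℂ f (Metric.ball (x : ℂ) ε) ∧
      ∀ z ∈ Metric.ball (x : ℂ) ε, 0 < σ * z.im → z ∈ Ω := by
    intro x hx
    have hopen : IsOpen (W ∩ (Complex.ofReal '' {p | p ∈ L})ᶜ) :=
      hK.isOpen_union.inter ((L.finite_toSet.image _).isClosed.isOpen_compl)
    have hxm : (x : ℂ) ∈ W ∩ (Complex.ofReal '' {p | p ∈ L})ᶜ := by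
      refine ⟨hJW x hx.1, ?_⟩
      rintro ⟨p, hp, hpx⟩
      exact hx.2 (Complex.ofReal_injective hpx ▸ hp)
    obtain ⟨ε, hε, hb⟩ := Metric.isOpen_iff.1 hopen _ hxm
    refine ⟨ε, hε, fun z hz => (hfd z (hb hz).1 ?_).differentiableWithinAt,
      fun z hz hzs => hWΩ z (hb hz).1 hzs⟩
    rintro p hp rfl
    exact (hb hz).2 ⟨p, hp, rfl⟩
  obtain ⟨G, hG, hGR, hGc⟩ := hΩ.exists_primitive_boundary hΩo hσ hside
    (fun z hz => (hfd z (hΩW hz) (hΩL z hz)).differentiableWithinAt) hR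
  -- limits of the primitive at the end points of the interval
  have hLa : ∀ p ∈ L, a ≠ (p : EReal) := fun p hp => (hL p hp).1.ne
  have hLb : ∀ p ∈ L, b ≠ (p : EReal) := fun p hp => (hL p hp).2.ne'
  have hφR : ∀ φ : ℝ → ℝ, StrictMono φ → range φ = realInterval a b →
      (∀ᶠ s in atTop, φ s ∈ R) ∧ ∀ᶠ s in atBot, φ s ∈ R := by
    intro φ hφ hr
    have hfin : (φ ⁻¹' {p | p ∈ L}).Finite := L.finite_toSet.preimage hφ.injective.injOn
    have hmem : ∀ s, φ s ∈ realInterval a b := fun s => hr ▸ mem_range_self s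
    constructor
    · obtain ⟨M, hM⟩ := hfin.bddAbove
      filter_upwards [eventually_gt_atTop M] with s hs
      exact ⟨hmem s, fun h => hs.not_ge (hM h)⟩
    · obtain ⟨M, hM⟩ := hfin.bddBelow
      filter_upwards [eventually_lt_atBot M] with s hs
      exact ⟨hmem s, fun h => hs.not_ge (hM h)⟩
  have hκ := fun t (ht : t ∈ realInterval a b) => hK.hasDerivAt_distribution u ht
  have hmono := E.monotone_distribution (B.adjoint u)
  have hlimits : ∀ γ, IsBoundedContour a b Ω K γ → ∀ h, IsDeformation a b Ω K γ h →
      ∀ φ : ℝ → ℝ, StrictMono φ → range φ = realInterval a b → (∀ s, h 0 s = φ s) →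
      (∃ M, Tendsto (fun s => G (φ s)) atTop (𝓝 M)) ∧
      ∃ M, Tendsto (fun s => G (φ s)) atBot (𝓝 M) := by
    intro γ hγ h hh φ hφ hr h0
    have hmem : ∀ s, φ s ∈ realInterval a b := fun s => hr ▸ mem_range_self s
    have hend : ∀ {F : Filter ℝ} {e : EReal}, (∀ p ∈ L, e ≠ (p : EReal)) →
        Tendsto (fun p : ℝ × ℝ => h p.1 p.2) (𝓟 (Icc 0 1) ×ˢ F) (endFilter e) →
        ∃ C, ∀ᶠ s in F, ‖poleProd L (φ s)‖ ≤ C := by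
      intro F e he hF
      obtain ⟨C, hC⟩ := eventually_norm_poleProd_le he
      have := hF.eventually hC
      rw [eventually_prod_iff] at this
      obtain ⟨p, hp, q, hq, hpq⟩ := this
      refine ⟨C, ?_⟩
      filter_upwards [hq] with s hs
      have := hpq (hp (show (0 : ℝ) ∈ Icc 0 1 by simp)) hs
      rwa [h0] at this
    constructor
    · obtain ⟨C, hC⟩ := hend hLb hh.right_end
      obtain ⟨s₀, hs₀⟩ := eventually_atTop.1 (hC.and (hφR φ hφ hr).1)
      -- Near the end the pole product is bounded by `C`, so the integrand is dominated by `C` times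
      -- the derivative of the bounded increasing distribution function.
      refine exists_tendsto_of_norm_deriv_le (F := atTop) (S := Ici s₀) (Ici_mem_atTop _)
        ordConnected_Ici hφ (ordConnected_realInterval a b) hr (g := fun t : ℝ => G t)
        (g' := fun t => f t) (κ := E.distribution (B.adjoint u))
        (κ' := fun t => (⟪u, K t u⟫_ℂ).re) (C := C) (fun s hs => hGR _ (hs₀ s hs).2)
        (fun s hs => (hκ _ (hmem s)).1) (fun s hs => ?_)
        (ℓ := ⨆ s, E.distribution (B.adjoint u) (φ s)) ?_
      · rw [hf, norm_mul, (hκ _ (hmem s)).2]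
        exact mul_le_mul_of_nonneg_right (hs₀ s hs).1 ((hκ _ (hmem s)).2 ▸ norm_nonneg _)
      · exact tendsto_atTop_ciSup (hmono.comp hφ.monotone)
          ⟨_, by rintro _ ⟨s, rfl⟩; exact E.distribution_le _ _⟩
    · obtain ⟨C, hC⟩ := hend hLa hh.left_end
      obtain ⟨s₀, hs₀⟩ := eventually_atBot.1 (hC.and (hφR φ hφ hr).2)
      refine exists_tendsto_of_norm_deriv_le (F := atBot) (S := Iic s₀) (Iic_mem_atBot _)
        ordConnected_Iic hφ (ordConnected_realInterval a b) hr (g := fun t : ℝ => G t)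
        (g' := fun t => f t) (κ := E.distribution (B.adjoint u))
        (κ' := fun t => (⟪u, K t u⟫_ℂ).re) (C := C) (fun s hs => hGR _ (hs₀ s hs).2)
        (fun s hs => (hκ _ (hmem s)).1) (fun s hs => ?_)
        (ℓ := ⨅ s, E.distribution (B.adjoint u) (φ s)) ?_
      · rw [hf, norm_mul, (hκ _ (hmem s)).2]
        exact mul_le_mul_of_nonneg_right (hs₀ s hs).1 ((hκ _ (hmem s)).2 ▸ norm_nonneg _)
      · exact tendsto_atBot_ciInf (hmono.comp hφ.monotone)
          ⟨0, by rintro _ ⟨s, rfl⟩; exact ENNReal.toReal_nonneg⟩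
  -- the integral over a contour is the difference of the two limits
  have hvalue : ∀ γ, IsBoundedContour a b Ω K γ → (∀ p ∈ L, ∀ s, δ ≤ ‖γ s - p‖) →
      ∀ h, IsDeformation a b Ω K γ h →
      ∀ φ : ℝ → ℝ, StrictMono φ → range φ = realInterval a b → (∀ s, h 0 s = φ s) →
      ∀ M N, Tendsto (fun s => G (φ s)) atTop (𝓝 M) → Tendsto (fun s => G (φ s)) atBot (𝓝 N) →
      ∫ s, deriv γ s * f (γ s) = M - N := by
    intro γ hγ hd h hh φ hφ hr h0 M N hM hN
    obtain ⟨s, hs, hcs⟩ := hh.right_crosscuts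
    obtain ⟨t, ht, hct⟩ := hh.left_crosscuts
    have hKW := hK.differentiableOn.continuousOn
    have hRW : ∀ x ∈ R, (x : ℂ) ∈ W := fun x hx => hJW x hx.1
    have e1 := tendsto_primitive_sub hΩo hΩW hKW hG hRW hGc h0 hh.mem hh.right_end
      (hφR φ hφ hr).1 hL0 hLb hs hcs
    have e2 := tendsto_primitive_sub hΩo hΩW hKW hG hRW hGc h0 hh.mem hh.left_end
      (hφR φ hφ hr).2 hL0 hLa ht hct
    -- The cross-cuts give the limits on the contour only along the sequences `s n` and `t n`;
    -- integrability over the contour makes that enough.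
    have e3 : Tendsto (fun n => G (γ (s n)) - G (γ (t n))) atTop (𝓝 (M - N)) := by
      have := (e1.add (hM.comp hs)).sub (e2.add (hN.comp ht))
      simpa [hh.finish] using this
    have hγL : ∀ p ∈ L, ∀ s, γ s ≠ p := by
      intro p hp s hs
      have := hd p hp s
      simp only [hs, sub_self, norm_zero] at this
      linarith
    have hint : Integrable fun s => deriv γ s * f (γ s) := by
      refine integrable_contour (C := δ⁻¹ ^ L.length * ‖u‖ ^ 2) hγ.bounded ?_ fun s => ?_
      · refine (measurable_deriv γ).aestronglyMeasurable.mul (Continuous.aestronglyMeasurable ?_)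
        refine (continuous_poleProd_comp hγ.locallyLipschitz.continuous hγL).mul ?_
        exact continuous_const.inner ((hγ.continuous_comp hK).clm_apply continuous_const)
      · rw [norm_mul]
        calc _ ≤ ‖deriv γ s‖ * (‖poleProd L (γ s)‖ * (‖K (γ s)‖ * ‖u‖ ^ 2)) := by
              gcongr; exact norm_poleProd_mul_inner_le _ _ _ _
          _ ≤ ‖deriv γ s‖ * (δ⁻¹ ^ L.length * (‖K (γ s)‖ * ‖u‖ ^ 2)) := by
              gcongr; exact norm_poleProd_le hδ fun p hp => hd p hp s
          _ = _ := by ring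
    have e4 := intervalIntegral_tendsto_integral hint ht hs
    refine tendsto_nhds_unique e4 (e3.congr' ?_)
    filter_upwards [ht.eventually_le_atBot 0, hs.eventually_ge_atTop 0] with n h1 h2
    obtain ⟨C, hC⟩ := hγ.locallyLipschitz.exists_lipschitzOnWith_Icc (t n) (s n)
    exact (integral_deriv_smul_comp_eq_sub hΩo hG (h1.trans h2) hC fun τ _ => hγ.mem τ).symm
  obtain ⟨k₁, hk₁⟩ := hγ₁.deformation
  obtain ⟨k₂, hk₂⟩ := hγ₂.deformation
  obtain ⟨φ₁, hφ₁, hr₁, h0₁⟩ := hk₁.start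
  obtain ⟨φ₂, hφ₂, hr₂, h0₂⟩ := hk₂.start
  obtain ⟨⟨M, hM⟩, N, hN⟩ := hlimits γ₁ hγ₁ k₁ hk₁ φ₁ hφ₁ hr₁ h0₁
  rw [hvalue γ₁ hγ₁ h₁ k₁ hk₁ φ₁ hφ₁ hr₁ h0₁ M N hM hN,
    hvalue γ₂ hγ₂ h₂ k₂ hk₂ φ₂ hφ₂ hr₂ h0₂ M N
      (tendsto_comp_of_range_eq (g := fun t : ℝ => G t) hφ₁ hφ₂ (hr₁.trans hr₂.symm)
        (Or.inl rfl) hM)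
      (tendsto_comp_of_range_eq (g := fun t : ℝ => G t) hφ₁ hφ₂ (hr₁.trans hr₂.symm)
        (Or.inr rfl) hN)]

end Independence

/-! ### Diagonal operators -/

namespace HilbertBasis

variable {ι H : Type*} [NormedAddCommGroup H] [InnerProductSpace ℂ H]

theorem ext_clm (b : HilbertBasis ι ℂ H) {F : Type*} [NormedAddCommGroup F] [NormedSpace ℂ F]
    {S T : H →L[ℂ] F} (h : ∀ i, S (b i) = T (b i)) : S = T := by
  refine ContinuousLinearMap.ext_on (s := range b) ?_ (by rintro _ ⟨i, rfl⟩; exact h i)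
  exact Submodule.dense_iff_topologicalClosure_eq_top.2 b.dense_span

theorem hasSum_norm_sq_repr (b : HilbertBasis ι ℂ H) (v : H) :
    HasSum (fun i => ‖b.repr v i‖ ^ 2) (‖v‖ ^ 2) := by
  have h := b.hasSum_inner_mul_inner v v
  have h2 := h.mapL Complex.reCLM
  have e : Complex.reCLM ⟪v, v⟫_ℂ = ‖v‖ ^ 2 := by
    rw [Complex.reCLM_apply, ← inner_self_eq_norm_sq (𝕜 := ℂ)]; rfl
  rw [e] at h2
  convert h2 using 1
  ext i
  rw [b.repr_apply_apply, ← inner_conj_symm v, Complex.reCLM_apply,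
    ← Complex.normSq_eq_conj_mul_self,
    Complex.ofReal_re, Complex.normSq_eq_norm_sq]

theorem norm_le_of_norm_repr_le (b : HilbertBasis ι ℂ H) {v w : H} {C : ℝ} (hC : 0 ≤ C)
    (h : ∀ i, ‖b.repr w i‖ ≤ C * ‖b.repr v i‖) : ‖w‖ ≤ C * ‖v‖ := by
  rw [← pow_le_pow_iff_left₀ (norm_nonneg _) (by positivity) two_ne_zero, mul_pow]
  refine hasSum_le (fun i => ?_) (b.hasSum_norm_sq_repr w) ((b.hasSum_norm_sq_repr v).mul_left _)
  rw [← mul_pow]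
  gcongr
  exact h i

theorem exists_diag (b : HilbertBasis ι ℂ H) {m : ι → ℂ} {C : ℝ} (hm : ∀ i, ‖m i‖ ≤ C) :
    ∃ T : H →L[ℂ] H, ∀ v i, b.repr (T v) i = m i * b.repr v i := by
  have hmem : ∀ f : lp (fun _ : ι => ℂ) 2, Memℓp (fun i => m i * f i) 2 := fun f => by
    refine Memℓp.mono' (g := fun i => ((((max C 0 : ℝ) : ℂ) • f : lp (fun _ : ι => ℂ) 2) i))
      (lp.memℓp _) fun i => ?_
    simp only [norm_mul, lp.coeFn_smul, Pi.smul_apply, smul_eq_mul, Complex.norm_real,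
      Real.norm_of_nonneg (le_max_right C 0)]
    gcongr
    exact (hm i).trans (le_max_left _ _)
  let M : lp (fun _ : ι => ℂ) 2 →ₗ[ℂ] lp (fun _ : ι => ℂ) 2 :=
    { toFun := fun f => ⟨fun i => m i * f i, hmem f⟩
      map_add' := fun f g => by ext i; exact mul_add _ _ _
      map_smul' := fun c f => by ext i; exact mul_left_comm _ _ _ }
  let T : H →ₗ[ℂ] H := b.repr.symm.toLinearMap ∘ₗ M ∘ₗ b.repr.toLinearMap
  have hT : ∀ v i, b.repr (T v) i = m i * b.repr v i := fun v i => by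
    change (b.repr (b.repr.symm (M (b.repr v)))) i = _
    rw [LinearIsometryEquiv.apply_symm_apply]
    rfl
  refine ⟨T.mkContinuous (max C 0) fun v => ?_, hT⟩
  refine b.norm_le_of_norm_repr_le (le_max_right _ _) fun i => ?_
  rw [hT, norm_mul]
  gcongr
  exact (hm i).trans (le_max_left _ _)

open Classical in
/-- The bounded operator with eigenvectors `b i` and eigenvalues `m i`, for bounded `m`. -/
def diag (b : HilbertBasis ι ℂ H) (m : ι → ℂ) : H →L[ℂ] H :=
  if h : ∃ T : H →L[ℂ] H, ∀ v i, b.repr (T v) i = m i * b.repr v i then h.choose else 0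

theorem repr_diag (b : HilbertBasis ι ℂ H) {m : ι → ℂ} {C : ℝ} (hm : ∀ i, ‖m i‖ ≤ C) (v : H)
    (i : ι) : b.repr (b.diag m v) i = m i * b.repr v i := by
  have h := b.exists_diag hm
  rw [diag, dif_pos h]
  exact h.choose_spec v i

theorem diag_apply_basis (b : HilbertBasis ι ℂ H) {m : ι → ℂ} {C : ℝ} (hm : ∀ i, ‖m i‖ ≤ C)
    (i : ι) : b.diag m (b i) = m i • b i := by
  classical
  apply b.repr.injective
  ext j
  rw [b.repr_diag hm, map_smul, lp.coeFn_smul, Pi.smul_apply, b.repr_self, smul_eq_mul]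
  by_cases h : j = i
  · rw [h]
  · simp [lp.single_apply, h]

theorem norm_diag_le (b : HilbertBasis ι ℂ H) {m : ι → ℂ} {C : ℝ} (hC : 0 ≤ C)
    (hm : ∀ i, ‖m i‖ ≤ C) : ‖b.diag m‖ ≤ C := by
  refine ContinuousLinearMap.opNorm_le_bound _ hC fun v => b.norm_le_of_norm_repr_le hC fun i => ?_
  rw [b.repr_diag hm, norm_mul]
  gcongr
  exact hm i

theorem inner_diag_diag_eq_zero (b : HilbertBasis ι ℂ H) {m n : ι → ℂ} {C C' : ℝ}
    (hm : ∀ i, ‖m i‖ ≤ C) (hn : ∀ i, ‖n i‖ ≤ C') (h : ∀ i, m i = 0 ∨ n i = 0) (v w : H) :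
    ⟪b.diag m v, b.diag n w⟫_ℂ = 0 := by
  rw [← b.repr.inner_map_map, lp.inner_eq_tsum]
  convert tsum_zero with i
  rw [b.repr_diag hm, b.repr_diag hn]
  rcases h i with h | h <;> simp [h]

/-- The orthogonal projection onto the closed span of the basis vectors with index in `S`. -/
def specProj (b : HilbertBasis ι ℂ H) (S : Set ι) : H →L[ℂ] H := b.diag (S.indicator 1)

theorem norm_indicator_le (S : Set ι) (i : ι) : ‖S.indicator (1 : ι → ℂ) i‖ ≤ 1 := by
  by_cases h : i ∈ S <;> simp [h]

theorem specProj_basis_of_mem (b : HilbertBasis ι ℂ H) {S : Set ι} {i : ι} (h : i ∈ S) :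
    b.specProj S (b i) = b i := by
  rw [specProj, b.diag_apply_basis (norm_indicator_le S)]; simp [h]

theorem specProj_basis_of_notMem (b : HilbertBasis ι ℂ H) {S : Set ι} {i : ι} (h : i ∉ S) :
    b.specProj S (b i) = 0 := by
  rw [specProj, b.diag_apply_basis (norm_indicator_le S)]; simp [h]

theorem norm_specProj_le (b : HilbertBasis ι ℂ H) (S : Set ι) : ‖b.specProj S‖ ≤ 1 :=
  b.norm_diag_le zero_le_one (norm_indicator_le S)

theorem norm_one_sub_specProj_le (b : HilbertBasis ι ℂ H) (S : Set ι) : ‖1 - b.specProj S‖ ≤ 1 := by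
  have : 1 - b.specProj S = b.specProj Sᶜ := by
    refine b.ext_clm fun i => ?_
    by_cases h : i ∈ S
    · simp [b.specProj_basis_of_mem h, b.specProj_basis_of_notMem (notMem_compl_iff.2 h)]
    · simp [b.specProj_basis_of_notMem h, b.specProj_basis_of_mem (mem_compl h)]
  rw [this]
  exact b.norm_specProj_le _

theorem inner_specProj_specProj (b : HilbertBasis ι ℂ H) {S T : Set ι} (h : Disjoint S T)
    (v w : H) : ⟪b.specProj S v, b.specProj T w⟫_ℂ = 0 := by
  refine b.inner_diag_diag_eq_zero (norm_indicator_le S) (norm_indicator_le T) (fun i => ?_) v w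
  by_cases hi : i ∈ S
  · exact Or.inr (indicator_of_notMem (disjoint_left.1 h hi) _)
  · exact Or.inl (indicator_of_notMem hi _)

theorem sum_specProj (b : HilbertBasis ι ℂ H) {κ : Type*} (I : Finset κ) {S : κ → Set ι}
    (hd : (I : Set κ).PairwiseDisjoint S) :
    ∑ k ∈ I, b.specProj (S k) = b.specProj (⋃ k ∈ I, S k) := by
  refine b.ext_clm fun i => ?_
  rw [_root_.sum_apply]
  by_cases h : i ∈ ⋃ k ∈ I, S k
  · rw [b.specProj_basis_of_mem h]
    simp only [mem_iUnion] at h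
    obtain ⟨k, hk, hi⟩ := h
    rw [Finset.sum_eq_single_of_mem k hk, b.specProj_basis_of_mem hi]
    intro k' hk' hne
    exact b.specProj_basis_of_notMem (disjoint_left.1 (hd hk hk' hne.symm) hi)
  · rw [b.specProj_basis_of_notMem h]
    refine Finset.sum_eq_zero fun k hk => b.specProj_basis_of_notMem fun hi => h ?_
    simp only [mem_iUnion]
    exact ⟨k, hk, hi⟩

theorem norm_sq_sum_of_orthogonal {κ : Type*} (I : Finset κ) {f : κ → H}
    (h : ∀ i ∈ I, ∀ j ∈ I, i ≠ j → ⟪f i, f j⟫_ℂ = 0) :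
    ‖∑ i ∈ I, f i‖ ^ 2 = ∑ i ∈ I, ‖f i‖ ^ 2 := by
  classical
  induction I using Finset.induction_on with
  | empty => simp
  | insert a I ha ih =>
    rw [Finset.sum_insert ha, Finset.sum_insert ha, ← ih fun i hi j hj =>
      h i (Finset.mem_insert_of_mem hi) j (Finset.mem_insert_of_mem hj), pow_two, pow_two, pow_two]
    apply norm_add_sq_eq_norm_sq_add_norm_sq_of_inner_eq_zero (𝕜 := ℂ)
    rw [inner_sum]
    refine Finset.sum_eq_zero fun j hj => h a (Finset.mem_insert_self _ _) j
      (Finset.mem_insert_of_mem hj) ?_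
    rintro rfl
    exact ha hj

/-- A sum of spectral projections over pairwise disjoint sets that exhaust the index set. -/
theorem hasSum_specProj (b : HilbertBasis ι ℂ H) {κ : Type*} {S : κ → Set ι}
    (hd : Pairwise (Function.onFun Disjoint S)) (hU : ∀ i, ∃ k, i ∈ S k) (v : H) :
    HasSum (fun k => b.specProj (S k) v) v := by
  -- A disjoint cover is the family of fibres of a map `τ`; the basis expansion of `v`, being
  -- unconditional, may be summed fibre by fibre.
  choose τ hτ using hU
  have hSτ : ∀ k i, i ∈ S k ↔ τ i = k := fun k i =>
    ⟨fun h => by_contra fun hne => disjoint_left.1 (hd hne) (hτ i) h, fun h => h ▸ hτ i⟩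
  have hfib : ∀ k, HasSum (fun i : {i // τ i = k} => b.repr v i • b i) (b.specProj (S k) v) := by
    intro k
    have h2 := b.hasSum_repr (b.specProj (S k) v)
    refine (hasSum_subtype_iff_indicator (f := fun i => b.repr v i • b i)
      (s := {i | τ i = k})).2 ?_
    convert h2 using 1
    ext i
    rw [specProj, b.repr_diag (norm_indicator_le _)]
    by_cases h : τ i = k
    · rw [indicator_of_mem ((hSτ k i).2 h), indicator_of_mem (show i ∈ {i | τ i = k} from h)]
      simp
    · rw [indicator_of_notMem (fun h' => h ((hSτ k i).1 h')),
        indicator_of_notMem (show i ∉ {i | τ i = k} from h)]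
      simp
  have h1 : HasSum (fun p : Σ k, {i // τ i = k} => b.repr v p.2.1 • b p.2.1) v :=
    (Equiv.sigmaFiberEquiv τ).hasSum_iff.2 (b.hasSum_repr v)
  exact h1.sigma hfib

end HilbertBasis

/-! ### Self-adjoint operators with compact resolvent -/

section Spectral

universe u

variable {H : Type u} [NormedAddCommGroup H] [InnerProductSpace ℂ H]

/-- Since `x` is real, `A - x` is symmetric, and symmetry passes to the inverse. -/
theorem IsResolvent.isSymmetric [CompleteSpace H] {A : H →ₗ.[ℂ] H} (hA : IsSelfAdjoint A) {x : ℝ}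
    {R : H →L[ℂ] H} (hR : IsResolvent A x R) : (R : H →ₗ[ℂ] H).IsSymmetric := by
  have hsymm : ∀ u v : A.domain, ⟪A u, (v : H)⟫_ℂ = ⟪(u : H), A v⟫_ℂ := by
    have h := A.adjoint_isFormalAdjoint hA.dense_domain
    rw [LinearPMap.isSelfAdjoint_def.1 hA] at h
    exact fun u v => h u v
  intro u v
  obtain ⟨hu, eu⟩ := hR.1 u
  obtain ⟨hv, ev⟩ := hR.1 v
  have h := hsymm ⟨R u, hu⟩ ⟨R v, hv⟩
  rw [sub_eq_iff_eq_add] at eu ev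
  rw [eu, ev, inner_add_left, inner_add_right, inner_smul_left, inner_smul_right] at h
  simpa using h.symm

/-- A self-adjoint operator with compact resolvent is diagonal in an orthonormal basis. -/
theorem IsSelfAdjoint.exists_eigenbasis [CompleteSpace H] {A : H →ₗ.[ℂ] H}
    (hA : IsSelfAdjoint A) {x : ℝ}
    {R : H →L[ℂ] H} (hR : IsResolvent A x R) (hc : IsCompactOperator R) :
    ∃ (ι : Type u) (b : HilbertBasis ι ℂ H) (Λ : ι → ℝ), (∀ i, Λ i ≠ x) ∧
      ∀ i, R (b i) = ((Λ i : ℂ) - x)⁻¹ • b i := by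
  have hs := hR.isSymmetric hA
  have hbot := ContinuousLinearMap.orthogonalComplement_iSup_eigenspaces_eq_bot hc hs
  let V : ℂ → Submodule ℂ H := fun μ => Module.End.eigenspace (R : Module.End ℂ H) μ
  have hclosed : ∀ μ, IsClosed (V μ : Set H) := fun μ => by
    have : (V μ : Set H) = {v | R v = μ • v} := by
      ext v; exact Module.End.mem_eigenspace_iff
    rw [this]
    exact isClosed_eq R.continuous (continuous_const_smul μ)
  have hcs : ∀ μ, CompleteSpace (V μ) := fun μ => (hclosed μ).completeSpace_coe
  -- The eigenspaces of the compact symmetric `R` are orthogonal with dense span; orthonormal bases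
  -- of all of them together form a basis of `H`.
  choose w β hβ using fun μ => exists_hilbertBasis ℂ (V μ)
  have hV := hs.orthogonalFamily_eigenspaces
  have hon := hV.orthonormal_sigma_orthonormal (fun μ => (β μ).orthonormal)
  have hsp : ⊤ ≤ (Submodule.span ℂ (range fun a : Σ μ, w μ => ((β a.1 a.2 : V a.1) : H))
      ).topologicalClosure := by
    have h1 : (⨆ μ, V μ).topologicalClosure = ⊤ :=
      Submodule.topologicalClosure_eq_top_iff.2 hbot
    rw [← h1]
    refine Submodule.topologicalClosure_minimal _ (iSup_le fun μ => ?_)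
      (Submodule.isClosed_topologicalClosure _)
    intro v hv
    have hd := (β μ).hasSum_repr ⟨v, hv⟩
    have hd' := hd.mapL (V μ).subtypeL
    refine mem_closure_of_tendsto hd' (Eventually.of_forall fun s => ?_)
    refine Submodule.sum_mem _ fun i _ => ?_
    simp only [map_smul]
    exact Submodule.smul_mem _ _ (Submodule.subset_span ⟨⟨μ, i⟩, rfl⟩)
  let b : HilbertBasis (Σ μ, w μ) ℂ H := HilbertBasis.mk hon hsp
  have hb : ∀ a, b a = ((β a.1 a.2 : V a.1) : H) := fun a =>
    congrFun (HilbertBasis.coe_mk hon hsp) a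
  have hRb : ∀ a, R (b a) = a.1 • b a := fun a => by
    rw [hb]; exact Module.End.mem_eigenspace_iff.1 (β a.1 a.2).2
  have hb0 : ∀ a, b a ≠ 0 := fun a h => by
    have := b.orthonormal.1 a
    rw [h, norm_zero] at this
    exact zero_ne_one this
  have hinj : ∀ v, R v = 0 → v = 0 := fun v hv => by
    obtain ⟨h, e⟩ := hR.1 v
    have : (⟨R v, h⟩ : A.domain) = 0 := Subtype.ext hv
    rw [this, A.map_zero, hv] at e
    simpa using e.symm
  have hne : ∀ a : Σ μ, w μ, a.1 ≠ 0 := fun a h => hb0 a (hinj _ (by rw [hRb, h, zero_smul]))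
  have hreal : ∀ a : Σ μ, w μ, ((a.1.re : ℝ) : ℂ) = a.1 := fun a => by
    have hev : Module.End.HasEigenvalue (R : Module.End ℂ H) a.1 :=
      Module.End.hasEigenvalue_of_hasEigenvector
        ⟨Module.End.mem_eigenspace_iff.2 (hRb a), hb0 a⟩
    exact Complex.conj_eq_iff_re.1 (hs.conj_eigenvalue_eq_self hev)
  have hre : ∀ a : Σ μ, w μ, a.1.re ≠ 0 := fun a h =>
    hne a (by rw [← hreal, h, Complex.ofReal_zero])
  -- An eigenvalue `μ` of `R` is real, and nonzero because `R` is injective; it comes from the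
  -- eigenvalue `x + μ⁻¹` of `A`.
  refine ⟨_, b, fun a : Σ μ, w μ => x + a.1.re⁻¹, fun a h => ?_, fun a => ?_⟩
  · exact inv_ne_zero (hre a) (by simpa using h)
  · rw [hRb]
    congr 1
    simp only
    push_cast
    rw [add_sub_cancel_left, inv_inv, hreal]

variable {ι : Type*}

theorem IsResolvent.mem_domain_of_eigen {A : H →ₗ.[ℂ] H} {x : ℝ} {R : H →L[ℂ] H}
    (hR : IsResolvent A x R) {v : H} {μ : ℝ} (hμ : μ ≠ x) (hv : R v = ((μ : ℂ) - x)⁻¹ • v) :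
    ∃ h : v ∈ A.domain, A ⟨v, h⟩ = (μ : ℂ) • v := by
  have hne : (μ : ℂ) - x ≠ 0 := sub_ne_zero.2 fun h => hμ (Complex.ofReal_injective h)
  have hv' : R (((μ : ℂ) - x) • v) = v := by rw [map_smul, hv, smul_inv_smul₀ hne]
  obtain ⟨h, e⟩ := hR.1 (((μ : ℂ) - x) • v)
  simp only [hv'] at h e
  refine ⟨h, ?_⟩
  rw [sub_eq_iff_eq_add] at e
  rw [e, sub_smul, sub_add_cancel]

theorem mem_unbSpectrum_of_eigen {A : H →ₗ.[ℂ] H} {v : H} (h : v ∈ A.domain) {μ : ℂ}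
    (hv : A ⟨v, h⟩ = μ • v) (h0 : v ≠ 0) : μ ∈ unbSpectrum A := by
  rintro ⟨R, hR⟩
  have := hR.2 ⟨v, h⟩
  rw [hv, sub_self, map_zero] at this
  exact h0 this.symm

theorem norm_inv_sub_le {Λ : ι → ℝ} {z : ℂ} {δ : ℝ} (hδ : 0 < δ) (h : ∀ i, δ ≤ ‖(Λ i : ℂ) - z‖)
    (i : ι) : ‖((Λ i : ℂ) - z)⁻¹‖ ≤ δ⁻¹ := by
  rw [norm_inv]
  exact inv_anti₀ hδ (h i)

/-- The resolvent of a diagonal operator. -/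
theorem IsResolvent.diag {A : H →ₗ.[ℂ] H} {x : ℝ} {R : H →L[ℂ] H} (hR : IsResolvent A x R)
    {b : HilbertBasis ι ℂ H} {Λ : ι → ℝ} (hΛ : ∀ i, Λ i ≠ x)
    (hb : ∀ i, R (b i) = ((Λ i : ℂ) - x)⁻¹ • b i) {z : ℂ} {δ : ℝ} (hδ : 0 < δ)
    (h : ∀ i, δ ≤ ‖(Λ i : ℂ) - z‖) :
    IsResolvent A z (b.diag fun i => ((Λ i : ℂ) - z)⁻¹) := by
  have hbd := norm_inv_sub_le hδ h
  have hz : ∀ i, (Λ i : ℂ) - z ≠ 0 := fun i h0 => by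
    have := h i
    rw [h0, norm_zero] at this
    linarith
  have hx : ∀ i, (Λ i : ℂ) - x ≠ 0 := fun i =>
    sub_ne_zero.2 fun h => hΛ i (Complex.ofReal_injective h)
  set S := b.diag fun i => ((Λ i : ℂ) - z)⁻¹ with hS
  have hSb : ∀ i, S (b i) = ((Λ i : ℂ) - z)⁻¹ • b i := b.diag_apply_basis hbd
  -- Formally `W = (A - x)(A - z)⁻¹` and `U = (A - z)(A - x)⁻¹`. These identities are checked on the
  -- basis in bounded form and then carried to `A` through `R`.
  let W : H →L[ℂ] H := 1 + (z - x) • S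
  let U : H →L[ℂ] H := 1 + ((x : ℂ) - z) • R
  have hWb : ∀ i, W (b i) = (((Λ i : ℂ) - x) * ((Λ i : ℂ) - z)⁻¹) • b i := fun i => by
    simp only [W, _root_.add_apply, one_apply_eq_self,
      _root_.smul_apply, hSb, smul_smul]
    conv_lhs => lhs; rw [← one_smul ℂ (b i)]
    rw [← add_smul]
    congr 1
    field_simp [hz i]
    ring
  have hUb : ∀ i, U (b i) = (((Λ i : ℂ) - z) * ((Λ i : ℂ) - x)⁻¹) • b i := fun i => by
    simp only [U, _root_.add_apply, one_apply_eq_self,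
      _root_.smul_apply, hb, smul_smul]
    conv_lhs => lhs; rw [← one_smul ℂ (b i)]
    rw [← add_smul]
    congr 1
    field_simp [hx i]
    ring
  have e1 : S = R * W := b.ext_clm fun i => by
    rw [mul_apply_eq_comp, hWb, hSb, map_smul, hb, smul_smul]
    congr 1
    field_simp [hx i, hz i]
  have e2 : S * U = R := b.ext_clm fun i => by
    rw [mul_apply_eq_comp, hUb, map_smul, hSb, hb, smul_smul]
    congr 1
    field_simp [hx i, hz i]
  have e3 : U * W = 1 := b.ext_clm fun i => by
    rw [mul_apply_eq_comp, hWb, map_smul, hUb, smul_smul,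
      one_apply_eq_self]
    conv_rhs => rw [← one_smul ℂ (b i)]
    congr 1
    field_simp [hx i, hz i]
  have key : ∀ w : H, ∃ hw : R w ∈ A.domain, A ⟨R w, hw⟩ - z • R w = U w := fun w => by
    obtain ⟨hw, e⟩ := hR.1 w
    refine ⟨hw, ?_⟩
    rw [sub_eq_iff_eq_add] at e
    simp only [e, U, _root_.add_apply, one_apply_eq_self, _root_.smul_apply]
    rw [sub_smul]
    abel
  refine ⟨fun y => ?_, fun v => ?_⟩
  · have hy : S y = R (W y) := by rw [e1]; rfl
    simp only [hy]
    obtain ⟨hw, e⟩ := key (W y)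
    refine ⟨hw, e.trans ?_⟩
    rw [← mul_apply_eq_comp, e3, one_apply_eq_self]
  · have hv := hR.2 v
    obtain ⟨hw, e⟩ := key (A v - (x : ℂ) • (v : H))
    have : (⟨R (A v - (x : ℂ) • (v : H)), hw⟩ : A.domain) = v := Subtype.ext hv
    rw [this, hv] at e
    rw [e, ← mul_apply_eq_comp, e2, hv]

end Spectral

/-! ### Resolvent identities and bounded perturbations -/

section Resolvent

/-- A bounded solution of the resolvent identity is differentiable. -/
theorem hasDerivAt_of_resolvent_identity {𝔸 : Type*} [NormedRing 𝔸] [NormedAlgebra ℂ 𝔸]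
    {f : ℂ → 𝔸} {z : ℂ} {C : ℝ}
    (h : ∀ᶠ w in 𝓝 z, ‖f w‖ ≤ C ∧ f w - f z = (w - z) • (f w * f z)) :
    HasDerivAt f (f z * f z) z := by
  have hc : Tendsto f (𝓝 z) (𝓝 (f z)) := by
    rw [tendsto_iff_norm_sub_tendsto_zero]
    have h0 : Tendsto (fun w : ℂ => ‖w - z‖ * (C * ‖f z‖)) (𝓝 z) (𝓝 0) := by
      have : Continuous fun w : ℂ => ‖w - z‖ * (C * ‖f z‖) := by fun_prop
      simpa using this.tendsto z
    refine squeeze_zero' (Eventually.of_forall fun _ => norm_nonneg _) ?_ h0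
    filter_upwards [h] with w hw
    rw [hw.2, norm_smul]
    gcongr
    exact (norm_mul_le _ _).trans (by gcongr; exact hw.1)
  rw [hasDerivAt_iff_tendsto_slope]
  have h1 : Tendsto (fun w => f w * f z) (𝓝[≠] z) (𝓝 (f z * f z)) :=
    (hc.mul_const _).mono_left nhdsWithin_le_nhds
  refine h1.congr' ?_
  filter_upwards [self_mem_nhdsWithin, nhdsWithin_le_nhds h] with w hw hw'
  rw [slope_def_module, hw'.2, smul_smul, inv_mul_cancel₀ (sub_ne_zero.2 hw), one_smul]

variable {H : Type*} [NormedAddCommGroup H] [InnerProductSpace ℂ H]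

theorem IsResolvent.sub_eq {T : H →ₗ.[ℂ] H} {z w : ℂ} {R S : H →L[ℂ] H} (hR : IsResolvent T z R)
    (hS : IsResolvent T w S) : R - S = (z - w) • (R * S) := by
  ext y
  obtain ⟨hy, e⟩ := hS.1 y
  have h := hR.2 ⟨S y, hy⟩
  rw [sub_eq_iff_eq_add] at e
  rw [e, show y + w • S y - z • S y = y - (z - w) • S y by rw [sub_smul]; abel, map_sub,
    map_smul] at h
  have h' : R y - (z - w) • R (S y) = S y := h
  rw [_root_.sub_apply, _root_.smul_apply, mul_apply_eq_comp, sub_eq_iff_eq_add,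
    ← sub_eq_iff_eq_add', h']

theorem IsResolvent.sub_eq_of_addBounded {T : H →ₗ.[ℂ] H} {z : ℂ} {X Y R S : H →L[ℂ] H}
    (hR : IsResolvent (addBounded T X) z R) (hS : IsResolvent (addBounded T Y) z S) :
    R - S = R * (Y - X) * S := by
  ext y
  obtain ⟨hy, e⟩ := hS.1 y
  have h := hR.2 ⟨S y, hy⟩
  have e' : Y (S y) + T ⟨S y, hy⟩ - z • S y = y := e
  have h' : R (X (S y) + T ⟨S y, hy⟩ - z • S y) = S y := h
  have e2 : X (S y) + T ⟨S y, hy⟩ - z • S y = y - (Y - X) (S y) := by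
    calc X (S y) + T ⟨S y, hy⟩ - z • S y
        = (Y (S y) + T ⟨S y, hy⟩ - z • S y) - (Y (S y) - X (S y)) := by abel
      _ = y - (Y - X) (S y) := by rw [e', _root_.sub_apply]
  rw [e2, map_sub] at h'
  rw [_root_.sub_apply, mul_apply_eq_comp, mul_apply_eq_comp, sub_eq_iff_eq_add,
    ← sub_eq_iff_eq_add', h']

theorem IsResolvent.addBounded_zero {T : H →ₗ.[ℂ] H} {z : ℂ} {R : H →L[ℂ] H}
    (hR : IsResolvent T z R) : IsResolvent (addBounded T 0) z R := by
  have : addBounded T 0 = T := by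
    rw [addBounded]
    exact zero_vadd _ T
  rwa [this]

/-- `T + X - z = (1 + X R)(T - z)`, and the first factor is invertible by the Neumann series. -/
theorem IsResolvent.exists_addBounded [CompleteSpace H] {T : H →ₗ.[ℂ] H} {z : ℂ} {R : H →L[ℂ] H}
    (hR : IsResolvent T z R) {X : H →L[ℂ] H} (h : ‖X * R‖ < 1) :
    ∃ S, IsResolvent (addBounded T X) z S := by
  let u : (H →L[ℂ] H)ˣ := Units.oneSub (-(X * R)) (by rwa [norm_neg])
  have hu : (u : H →L[ℂ] H) = 1 + X * R := by
    simp only [u, Units.val_oneSub, sub_neg_eq_add]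
  refine ⟨R * (↑u⁻¹ : H →L[ℂ] H), fun y => ?_, fun x => ?_⟩
  · obtain ⟨hw, e⟩ := hR.1 ((↑u⁻¹ : H →L[ℂ] H) y)
    refine ⟨hw, ?_⟩
    change X (R ((↑u⁻¹ : H →L[ℂ] H) y)) + T ⟨_, hw⟩ - z • R ((↑u⁻¹ : H →L[ℂ] H) y) = y
    rw [add_sub_assoc, e]
    have : (u : H →L[ℂ] H) ((↑u⁻¹ : H →L[ℂ] H) y) = y := by
      rw [← mul_apply_eq_comp, Units.mul_inv, one_apply_eq_self]
    rw [hu] at this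
    rw [add_comm]
    exact this
  · have e := hR.2 x
    change R ((↑u⁻¹ : H →L[ℂ] H) (X x + T x - z • (x : H))) = x
    have : X x + T x - z • (x : H) = (u : H →L[ℂ] H) (T x - z • (x : H)) := by
      rw [hu, _root_.add_apply, one_apply_eq_self, mul_apply_eq_comp, e]
      abel
    rw [this, ← mul_apply_eq_comp (↑u⁻¹ : H →L[ℂ] H), Units.inv_mul, one_apply_eq_self, e]

end Resolvent

/-! ### Perturbations of diagonal operators -/

section Diagonal

variable {H : Type*} [NormedAddCommGroup H] [InnerProductSpace ℂ H] {ι : Type*}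

/-- The operator `(Λ - z)⁻¹`. -/
def diagResolvent (b : HilbertBasis ι ℂ H) (Λ : ι → ℝ) (z : ℂ) : H →L[ℂ] H :=
  b.diag fun i => ((Λ i : ℂ) - z)⁻¹

/-- `A` is the diagonal operator with the eigenvalues `Λ` in the basis `b`. -/
def IsDiagonalIn (A : H →ₗ.[ℂ] H) (b : HilbertBasis ι ℂ H) (Λ : ι → ℝ) : Prop :=
  ∀ z : ℂ, ∀ δ > 0, (∀ i, δ ≤ ‖(Λ i : ℂ) - z‖) → IsResolvent A z (diagResolvent b Λ z)

theorem diagResolvent_basis {b : HilbertBasis ι ℂ H} {Λ : ι → ℝ} {z : ℂ} {δ : ℝ} (hδ : 0 < δ)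
    (h : ∀ i, δ ≤ ‖(Λ i : ℂ) - z‖) (i : ι) :
    diagResolvent b Λ z (b i) = ((Λ i : ℂ) - z)⁻¹ • b i :=
  b.diag_apply_basis (norm_inv_sub_le hδ h) i

theorem norm_diagResolvent_le {b : HilbertBasis ι ℂ H} {Λ : ι → ℝ} {z : ℂ} {δ : ℝ} (hδ : 0 < δ)
    (h : ∀ i, δ ≤ ‖(Λ i : ℂ) - z‖) : ‖diagResolvent b Λ z‖ ≤ δ⁻¹ :=
  b.norm_diag_le (by positivity) (norm_inv_sub_le hδ h)

theorem eventually_le_norm_sub {Λ : ι → ℝ} {z : ℂ} {δ δ' : ℝ} (hδ : δ' < δ)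
    (h : ∀ i, δ ≤ ‖(Λ i : ℂ) - z‖) : ∀ᶠ w in 𝓝 z, ∀ i, δ' ≤ ‖(Λ i : ℂ) - w‖ := by
  filter_upwards [Metric.ball_mem_nhds z (sub_pos.2 hδ)] with w hw i
  rw [Metric.mem_ball, dist_eq_norm] at hw
  have h1 := h i
  have h2 : ‖(Λ i : ℂ) - z‖ ≤ ‖(Λ i : ℂ) - w‖ + ‖w - z‖ := norm_sub_le_norm_sub_add_norm_sub _ _ _
  linarith

theorem IsDiagonalIn.hasDerivAt_diagResolvent {A : H →ₗ.[ℂ] H}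
    {b : HilbertBasis ι ℂ H} {Λ : ι → ℝ} {z : ℂ} {δ : ℝ} (hA : IsDiagonalIn A b Λ) (hδ : 0 < δ)
    (h : ∀ i, δ ≤ ‖(Λ i : ℂ) - z‖) :
    HasDerivAt (diagResolvent b Λ) (diagResolvent b Λ z * diagResolvent b Λ z) z := by
  obtain ⟨δ', h1, h2⟩ := exists_between hδ
  refine hasDerivAt_of_resolvent_identity (C := δ'⁻¹) ?_
  filter_upwards [eventually_le_norm_sub h2 h] with w hw
  exact ⟨norm_diagResolvent_le h1 hw, (hA w δ' h1 hw).sub_eq (hA z δ hδ h)⟩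

variable [CompleteSpace H] {A : H →ₗ.[ℂ] H} {b : HilbertBasis ι ℂ H} {Λ : ι → ℝ}
  {X : H →L[ℂ] H} {z : ℂ} {δ : ℝ}

theorem IsDiagonalIn.isResolvent (hA : IsDiagonalIn A b Λ) (hX : ‖X‖ < δ)
    (h : ∀ i, δ ≤ ‖(Λ i : ℂ) - z‖) :
    IsResolvent (addBounded A X) z (unbResolvent (addBounded A X) z) := by
  have hδ : 0 < δ := (norm_nonneg X).trans_lt hX
  obtain ⟨S, hS⟩ := (hA z δ hδ h).exists_addBounded (X := X) (by
    calc _ ≤ ‖X‖ * ‖diagResolvent b Λ z‖ := norm_mul_le _ _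
      _ ≤ ‖X‖ * δ⁻¹ := by gcongr; exact norm_diagResolvent_le hδ h
      _ < 1 := by rwa [← div_eq_mul_inv, div_lt_one hδ])
  rwa [unbResolvent_eq hS]

theorem IsDiagonalIn.mem_unbResolventSet (hA : IsDiagonalIn A b Λ) (hX : ‖X‖ < δ)
    (h : ∀ i, δ ≤ ‖(Λ i : ℂ) - z‖) : z ∈ unbResolventSet (addBounded A X) :=
  ⟨_, hA.isResolvent hX h⟩

theorem IsDiagonalIn.resolvent_sub (hA : IsDiagonalIn A b Λ) (hX : ‖X‖ < δ)
    (h : ∀ i, δ ≤ ‖(Λ i : ℂ) - z‖) :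
    unbResolvent (addBounded A X) z - diagResolvent b Λ z =
      -(unbResolvent (addBounded A X) z * X * diagResolvent b Λ z) := by
  have hδ : 0 < δ := (norm_nonneg X).trans_lt hX
  rw [(hA.isResolvent hX h).sub_eq_of_addBounded (hA z δ hδ h).addBounded_zero]
  simp

theorem IsDiagonalIn.resolvent_sub' (hA : IsDiagonalIn A b Λ) (hX : ‖X‖ < δ)
    (h : ∀ i, δ ≤ ‖(Λ i : ℂ) - z‖) :
    unbResolvent (addBounded A X) z - diagResolvent b Λ z =
      -(diagResolvent b Λ z * X * unbResolvent (addBounded A X) z) := by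
  have hδ : 0 < δ := (norm_nonneg X).trans_lt hX
  rw [← neg_sub, (hA z δ hδ h).addBounded_zero.sub_eq_of_addBounded (hA.isResolvent hX h)]
  simp

/-- The perturbed resolvent satisfies `S = R - S X R` with `‖R‖ ≤ δ⁻¹`, hence `δ ‖S‖ ≤ 1 + ‖S‖ ‖X‖`.
-/
theorem IsDiagonalIn.norm_resolvent_le (hA : IsDiagonalIn A b Λ) (hX : ‖X‖ < δ)
    (h : ∀ i, δ ≤ ‖(Λ i : ℂ) - z‖) : ‖unbResolvent (addBounded A X) z‖ ≤ (δ - ‖X‖)⁻¹ := by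
  have hδ : 0 < δ := (norm_nonneg X).trans_lt hX
  set S := unbResolvent (addBounded A X) z
  have h0 := norm_diagResolvent_le (b := b) hδ h
  have h1 : S = diagResolvent b Λ z - S * X * diagResolvent b Λ z := by
    rw [sub_eq_add_neg, ← hA.resolvent_sub hX h]; abel
  have h2 : ‖S‖ ≤ δ⁻¹ + ‖S‖ * ‖X‖ * δ⁻¹ := by
    calc ‖S‖ = ‖diagResolvent b Λ z - S * X * diagResolvent b Λ z‖ := by rw [← h1]
      _ ≤ ‖diagResolvent b Λ z‖ + ‖S * X * diagResolvent b Λ z‖ := norm_sub_le _ _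
      _ ≤ ‖diagResolvent b Λ z‖ + ‖S‖ * ‖X‖ * ‖diagResolvent b Λ z‖ := by
          gcongr
          exact (norm_mul_le _ _).trans (by gcongr; exact norm_mul_le _ _)
      _ ≤ _ := by gcongr
  have h3 : 0 < δ - ‖X‖ := sub_pos.2 hX
  rw [← one_div, le_div_iff₀ h3]
  have h4 : δ * ‖S‖ ≤ 1 + ‖S‖ * ‖X‖ := by
    calc δ * ‖S‖ ≤ δ * (δ⁻¹ + ‖S‖ * ‖X‖ * δ⁻¹) := by gcongr
      _ = _ := by field_simp
  linarith

theorem IsDiagonalIn.hasDerivAt_resolvent (hA : IsDiagonalIn A b Λ) (hX : ‖X‖ < δ)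
    (h : ∀ i, δ ≤ ‖(Λ i : ℂ) - z‖) :
    HasDerivAt (unbResolvent (addBounded A X))
      (unbResolvent (addBounded A X) z * unbResolvent (addBounded A X) z) z := by
  obtain ⟨δ', h1, h2⟩ := exists_between hX
  refine hasDerivAt_of_resolvent_identity (C := (δ' - ‖X‖)⁻¹) ?_
  filter_upwards [eventually_le_norm_sub h2 h] with w hw
  exact ⟨hA.norm_resolvent_le h1 hw, (hA.isResolvent h1 hw).sub_eq (hA.isResolvent hX h)⟩

end Diagonal

/-! ### Contour independence of the basic solution -/

section ContourIntegral

variable {H : Type*} [NormedAddCommGroup H] [InnerProductSpace ℂ H]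

/-- The operator integral `∫_Γ K(μ) G(μ) dμ`. -/
def contourIntegral (K : ℂ → H →L[ℂ] H) (γ : ℝ → ℂ) (G : ℂ → H →L[ℂ] H) : H →L[ℂ] H :=
  ∫ s, deriv γ s • (K (γ s) * G (γ s))

variable {K : ℂ → H →L[ℂ] H} {γ : ℝ → ℂ} {G : ℂ → H →L[ℂ] H} {M : ℝ}

theorem norm_contour_integrand_le (hM : ∀ s, ‖G (γ s)‖ ≤ M) (s : ℝ) :
    ‖deriv γ s • (K (γ s) * G (γ s))‖ ≤ M * (‖K (γ s)‖ * ‖deriv γ s‖) := by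
  rw [norm_smul]
  calc _ ≤ ‖deriv γ s‖ * (‖K (γ s)‖ * ‖G (γ s)‖) := by gcongr; exact norm_mul_le _ _
    _ ≤ ‖deriv γ s‖ * (‖K (γ s)‖ * M) := by gcongr; exact hM s
    _ = _ := by ring

theorem integrable_contour_integrand (hint : Integrable fun s => ‖K (γ s)‖ * ‖deriv γ s‖)
    (hK : Continuous fun s => K (γ s)) (hG : Continuous fun s => G (γ s))
    (hM : ∀ s, ‖G (γ s)‖ ≤ M) : Integrable fun s => deriv γ s • (K (γ s) * G (γ s)) :=
  integrable_contour hint ((measurable_deriv γ).aestronglyMeasurable.smul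
    (hK.mul hG).aestronglyMeasurable) (norm_contour_integrand_le hM)

theorem norm_contourIntegral_le (hint : Integrable fun s => ‖K (γ s)‖ * ‖deriv γ s‖)
    (hM : ∀ s, ‖G (γ s)‖ ≤ M) : ‖contourIntegral K γ G‖ ≤ M * variation K γ := by
  rw [variation, ← integral_const_mul]
  exact norm_integral_le_of_norm_le (hint.const_mul M)
    (Eventually.of_forall (norm_contour_integrand_le hM))

theorem contourIntegral_apply [CompleteSpace H] (hint : Integrable fun s => ‖K (γ s)‖ * ‖deriv γ s‖)
    (hK : Continuous fun s => K (γ s)) (hG : Continuous fun s => G (γ s))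
    (hM : ∀ s, ‖G (γ s)‖ ≤ M) (v : H) :
    contourIntegral K γ G v = ∫ s, deriv γ s • K (γ s) (G (γ s) v) :=
  ContinuousLinearMap.integral_apply (integrable_contour_integrand hint hK hG hM) v

/-- The equality of the integrals over two contours. -/
def SameIntegral (K : ℂ → H →L[ℂ] H) (γ₁ γ₂ : ℝ → ℂ) (G : ℂ → H →L[ℂ] H) : Prop :=
  contourIntegral K γ₁ G = contourIntegral K γ₂ G

theorem SameIntegral.apply {γ₁ γ₂ : ℝ → ℂ} (h : SameIntegral K γ₁ γ₂ G) (v : H) :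
    contourIntegral K γ₁ G v = contourIntegral K γ₂ G v := by
  rw [SameIntegral] at h
  rw [h]

end ContourIntegral

/-! ### Neumann series of the operator integral and its independence of the contour -/

section Neumann

variable {H₀ H : Type*} [NormedAddCommGroup H₀] [InnerProductSpace ℂ H₀] [CompleteSpace H₀]
  [NormedAddCommGroup H] [InnerProductSpace ℂ H] [CompleteSpace H]
  {E : ProjectionMeasure H₀} {B : H₀ →L[ℂ] H} {a₀ b₀ : EReal} {D : Set ℂ}
  {K : ℂ → H →L[ℂ] H} {l : ℤˣ} {γ₁ γ₂ : ℝ → ℂ} {ι : Type*} {A : H →ₗ.[ℂ] H}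
  {b : HilbertBasis ι ℂ H} {Λ : ι → ℝ} {d : ℝ}

/-- The terms `(-R(μ) Y)ⁿ` of the Neumann series. -/
def neumannTerm (b : HilbertBasis ι ℂ H) (Λ : ι → ℝ) (Y : H →L[ℂ] H) (n : ℕ) (μ : ℂ) : H →L[ℂ] H :=
  (-(diagResolvent b Λ μ * Y)) ^ n

theorem norm_neumannTerm_le (hd : 0 < d) {μ : ℂ} (h : ∀ i, d ≤ ‖(Λ i : ℂ) - μ‖) (Y : H →L[ℂ] H)
    (n : ℕ) : ‖neumannTerm b Λ Y n μ‖ ≤ (‖Y‖ / d) ^ n := by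
  have h1 : ‖-(diagResolvent b Λ μ * Y)‖ ≤ ‖Y‖ / d := by
    rw [norm_neg, div_eq_inv_mul]
    refine (norm_mul_le _ _).trans ?_
    gcongr
    exact norm_diagResolvent_le hd h
  rcases subsingleton_or_nontrivial H with hs | hs
  · have : neumannTerm b Λ Y n μ = 0 := Subsingleton.elim _ _
    rw [this, norm_zero]; positivity
  · exact (norm_pow_le _ _).trans (by gcongr)

theorem continuous_diagResolvent_comp (hA : IsDiagonalIn A b Λ) (hd : 0 < d) {γ : ℝ → ℂ}
    (hγ : Continuous γ) (h : ∀ s i, d ≤ ‖(Λ i : ℂ) - γ s‖) :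
    Continuous fun s => diagResolvent b Λ (γ s) :=
  continuous_iff_continuousAt.2 fun s =>
    (hA.hasDerivAt_diagResolvent hd (h s)).continuousAt.comp hγ.continuousAt

theorem continuous_neumannTerm_comp (hA : IsDiagonalIn A b Λ) (hd : 0 < d) {γ : ℝ → ℂ}
    (hγ : Continuous γ) (h : ∀ s i, d ≤ ‖(Λ i : ℂ) - γ s‖) (Y : H →L[ℂ] H) (n : ℕ) :
    Continuous fun s => neumannTerm b Λ Y n (γ s) :=
  ((continuous_diagResolvent_comp hA hd hγ h).mul continuous_const).neg.pow n

/-- The vectors `v` and `w` may differ: this moves a factor from the integrand to the vector and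
back. -/
theorem contourIntegral_congr_apply {γ : ℝ → ℂ} {G G' : ℂ → H →L[ℂ] H} {M M' : ℝ}
    (hint : Integrable fun s => ‖K (γ s)‖ * ‖deriv γ s‖) (hK : Continuous fun s => K (γ s))
    (hG : Continuous fun s => G (γ s)) (hM : ∀ s, ‖G (γ s)‖ ≤ M)
    (hG' : Continuous fun s => G' (γ s)) (hM' : ∀ s, ‖G' (γ s)‖ ≤ M') {v w : H}
    (h : ∀ s, G (γ s) v = G' (γ s) w) : contourIntegral K γ G v = contourIntegral K γ G' w := by
  rw [contourIntegral_apply hint hK hG hM, contourIntegral_apply hint hK hG' hM']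
  simp only [h]

/-- A bounded operator on a complex Hilbert space is determined by its quadratic form, and the forms
of both sides agree by `integral_contour_eq`. This is the base of the induction over Neumann terms.
-/
theorem sameIntegral_poleProd (hK : IsContinuedDerivative a₀ b₀ D (couplingFunction E B) K)
    (hγ₁ : IsBoundedContour a₀ b₀ (sideDomain D l) K γ₁)
    (hγ₂ : IsBoundedContour a₀ b₀ (sideDomain D l) K γ₂) (hd : 0 < d)
    (h₁ : ∀ s i, d ≤ ‖(Λ i : ℂ) - γ₁ s‖) (h₂ : ∀ s i, d ≤ ‖(Λ i : ℂ) - γ₂ s‖)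
    (hΛ : ∀ i, Λ i ∈ realInterval a₀ b₀) {L : List ι} (hL : L ≠ []) :
    SameIntegral K γ₁ γ₂ fun μ => poleProd (L.map Λ) μ • 1 := by
  have hb : ∀ γ : ℝ → ℂ, (∀ s i, d ≤ ‖(Λ i : ℂ) - γ s‖) → ∀ p ∈ L.map Λ, ∀ s, d ≤ ‖γ s - p‖ := by
    intro γ h p hp s
    obtain ⟨i, -, rfl⟩ := List.mem_map.1 hp
    rw [norm_sub_rev]; exact h s i
  have hquad : ∀ γ : ℝ → ℂ, IsBoundedContour a₀ b₀ (sideDomain D l) K γ →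
      (∀ s i, d ≤ ‖(Λ i : ℂ) - γ s‖) → ∀ u : H,
      ⟪u, contourIntegral K γ (fun μ => poleProd (L.map Λ) μ • 1) u⟫_ℂ =
        ∫ s, deriv γ s * (poleProd (L.map Λ) (γ s) * ⟪u, K (γ s) u⟫_ℂ) := by
    intro γ hγ h u
    have hcont : Continuous fun s => poleProd (L.map Λ) (γ s) • (1 : H →L[ℂ] H) :=
      (continuous_poleProd_comp hγ.locallyLipschitz.continuous fun p hp s e => by
        have := hb γ h p hp s
        rw [e, sub_self, norm_zero] at this
        linarith).smul continuous_const
    have hM : ∀ s, ‖poleProd (L.map Λ) (γ s) • (1 : H →L[ℂ] H)‖ ≤ d⁻¹ ^ (L.map Λ).length * 1 := by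
      intro s
      rw [norm_smul]
      gcongr
      · exact norm_poleProd_le hd fun p hp => hb γ h p hp s
      · exact ContinuousLinearMap.norm_id_le
    have hi := integrable_contour_integrand (G := fun μ => poleProd (L.map Λ) μ • 1)
      hγ.bounded (hγ.continuous_comp hK) hcont hM
    rw [contourIntegral, ContinuousLinearMap.integral_apply hi]
    have := (innerSL ℂ u).integral_comp_comm (hi.apply_continuousLinearMap u)
    rw [innerSL_apply_apply] at this
    rw [← this]
    congr 1
    ext s
    simp
  have key : ∀ u : H, ⟪contourIntegral K γ₁ (fun μ => poleProd (L.map Λ) μ • 1) u, u⟫_ℂ =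
      ⟪contourIntegral K γ₂ (fun μ => poleProd (L.map Λ) μ • 1) u, u⟫_ℂ := by
    intro u
    rw [← inner_conj_symm, hquad γ₁ hγ₁ h₁ u, ← inner_conj_symm _ u, hquad γ₂ hγ₂ h₂ u,
      integral_contour_eq hK hγ₁ hγ₂ (by simpa using hL) _ hd (hb γ₁ h₁) (hb γ₂ h₂) u]
    intro p hp
    obtain ⟨i, -, rfl⟩ := List.mem_map.1 hp
    exact hΛ i
  exact ContinuousLinearMap.coe_injective ((ext_inner_map _ _).1 key)

/-- On a basis vector the rightmost resolvent is a scalar pole, which joins the list `L`; hence the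
general `L` in the induction. The first family needs a nonempty list for decay at an infinite end;
in the second the resolvent itself supplies a pole, so the case used later, `L = []`, is included.
-/
theorem sameIntegral_neumannTerm (hK : IsContinuedDerivative a₀ b₀ D (couplingFunction E B) K)
    (hA : IsDiagonalIn A b Λ)
    (hγ₁ : IsBoundedContour a₀ b₀ (sideDomain D l) K γ₁)
    (hγ₂ : IsBoundedContour a₀ b₀ (sideDomain D l) K γ₂) (hd : 0 < d)
    (h₁ : ∀ s i, d ≤ ‖(Λ i : ℂ) - γ₁ s‖) (h₂ : ∀ s i, d ≤ ‖(Λ i : ℂ) - γ₂ s‖)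
    (hΛ : ∀ i, Λ i ∈ realInterval a₀ b₀) (Y : H →L[ℂ] H) (n : ℕ) :
    (∀ L : List ι, L ≠ [] →
      SameIntegral K γ₁ γ₂ fun μ => poleProd (L.map Λ) μ • neumannTerm b Λ Y n μ) ∧
    ∀ L : List ι, SameIntegral K γ₁ γ₂ fun μ =>
      poleProd (L.map Λ) μ • (neumannTerm b Λ Y n μ * diagResolvent b Λ μ) := by
  -- regularity of the integrands
  have hb : ∀ γ : ℝ → ℂ, (∀ s i, d ≤ ‖(Λ i : ℂ) - γ s‖) → ∀ L : List ι,
      ∀ p ∈ L.map Λ, ∀ s, d ≤ ‖γ s - p‖ := by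
    intro γ h L p hp s
    obtain ⟨i, -, rfl⟩ := List.mem_map.1 hp
    rw [norm_sub_rev]; exact h s i
  have hpc : ∀ γ : ℝ → ℂ, Continuous γ → (∀ s i, d ≤ ‖(Λ i : ℂ) - γ s‖) → ∀ L : List ι,
      Continuous fun s => poleProd (L.map Λ) (γ s) := fun γ hγ h L =>
    continuous_poleProd_comp hγ fun p hp s e => by
      have := hb γ h L p hp s
      rw [e, sub_self, norm_zero] at this
      linarith
  have hpM : ∀ γ : ℝ → ℂ, (∀ s i, d ≤ ‖(Λ i : ℂ) - γ s‖) → ∀ L : List ι, ∀ s,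
      ‖poleProd (L.map Λ) (γ s)‖ ≤ d⁻¹ ^ (L.map Λ).length := fun γ h L s =>
    norm_poleProd_le hd fun p hp => hb γ h L p hp s
  have reg1 : ∀ γ : ℝ → ℂ, Continuous γ → (∀ s i, d ≤ ‖(Λ i : ℂ) - γ s‖) → ∀ (L : List ι) (n : ℕ),
      Continuous (fun s => poleProd (L.map Λ) (γ s) • neumannTerm b Λ Y n (γ s)) ∧
      ∀ s, ‖poleProd (L.map Λ) (γ s) • neumannTerm b Λ Y n (γ s)‖ ≤
        d⁻¹ ^ (L.map Λ).length * (‖Y‖ / d) ^ n := fun γ hγ h L n =>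
    ⟨(hpc γ hγ h L).smul (continuous_neumannTerm_comp hA hd hγ h Y n), fun s => by
      rw [norm_smul]
      gcongr
      · exact hpM γ h L s
      · exact norm_neumannTerm_le hd (h s) Y n⟩
  have reg2 : ∀ γ : ℝ → ℂ, Continuous γ → (∀ s i, d ≤ ‖(Λ i : ℂ) - γ s‖) → ∀ (L : List ι) (n : ℕ),
      Continuous (fun s => poleProd (L.map Λ) (γ s) •
        (neumannTerm b Λ Y n (γ s) * diagResolvent b Λ (γ s))) ∧
      ∀ s, ‖poleProd (L.map Λ) (γ s) • (neumannTerm b Λ Y n (γ s) * diagResolvent b Λ (γ s))‖ ≤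
        d⁻¹ ^ (L.map Λ).length * ((‖Y‖ / d) ^ n * d⁻¹) := fun γ hγ h L n =>
    ⟨(hpc γ hγ h L).smul ((continuous_neumannTerm_comp hA hd hγ h Y n).mul
      (continuous_diagResolvent_comp hA hd hγ h)), fun s => by
      rw [norm_smul]
      gcongr
      · exact hpM γ h L s
      · refine (norm_mul_le _ _).trans ?_
        gcongr
        · exact norm_neumannTerm_le hd (h s) Y n
        · exact norm_diagResolvent_le hd (h s)⟩
  have c₁ := hγ₁.locallyLipschitz.continuous
  have c₂ := hγ₂.locallyLipschitz.continuous
  have k₁ := hγ₁.continuous_comp hK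
  have k₂ := hγ₂.continuous_comp hK
  -- from the first assertion to the second
  have step : ∀ n, (∀ L : List ι, L ≠ [] →
      SameIntegral K γ₁ γ₂ fun μ => poleProd (L.map Λ) μ • neumannTerm b Λ Y n μ) →
      ∀ L : List ι, SameIntegral K γ₁ γ₂ fun μ =>
        poleProd (L.map Λ) μ • (neumannTerm b Λ Y n μ * diagResolvent b Λ μ) := by
    intro n hn L
    refine b.ext_clm fun k => ?_
    have hpt : ∀ γ : ℝ → ℂ, (∀ s i, d ≤ ‖(Λ i : ℂ) - γ s‖) → ∀ s,
        (poleProd (L.map Λ) (γ s) •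
          (neumannTerm b Λ Y n (γ s) * diagResolvent b Λ (γ s))) (b k) =
        (poleProd ((k :: L).map Λ) (γ s) • neumannTerm b Λ Y n (γ s)) (b k) := by
      intro γ h s
      rw [_root_.smul_apply, mul_apply_eq_comp, diagResolvent_basis hd (h s), map_smul, smul_smul,
        _root_.smul_apply, List.map_cons, poleProd_cons, mul_comm]
    rw [contourIntegral_congr_apply
        (G := fun μ => poleProd (L.map Λ) μ • (neumannTerm b Λ Y n μ * diagResolvent b Λ μ))
        hγ₁.bounded k₁ (reg2 γ₁ c₁ h₁ L n).1 (reg2 γ₁ c₁ h₁ L n).2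
        (G' := fun μ => poleProd ((k :: L).map Λ) μ • neumannTerm b Λ Y n μ)
        (reg1 γ₁ c₁ h₁ (k :: L) n).1 (reg1 γ₁ c₁ h₁ (k :: L) n).2 (hpt γ₁ h₁),
      contourIntegral_congr_apply
        (G := fun μ => poleProd (L.map Λ) μ • (neumannTerm b Λ Y n μ * diagResolvent b Λ μ))
        hγ₂.bounded k₂ (reg2 γ₂ c₂ h₂ L n).1 (reg2 γ₂ c₂ h₂ L n).2
        (G' := fun μ => poleProd ((k :: L).map Λ) μ • neumannTerm b Λ Y n μ)
        (reg1 γ₂ c₂ h₂ (k :: L) n).1 (reg1 γ₂ c₂ h₂ (k :: L) n).2 (hpt γ₂ h₂)]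
    exact (hn (k :: L) (List.cons_ne_nil _ _)).apply (b k)
  have main : ∀ n, ∀ L : List ι, L ≠ [] →
      SameIntegral K γ₁ γ₂ fun μ => poleProd (L.map Λ) μ • neumannTerm b Λ Y n μ := by
    intro n
    induction n with
    | zero =>
      intro L hL
      simpa only [neumannTerm, pow_zero] using
        sameIntegral_poleProd hK hγ₁ hγ₂ hd h₁ h₂ hΛ hL
    | succ n ih =>
      intro L _
      have hn := step n ih L
      refine ContinuousLinearMap.ext fun v => ?_
      have hpt : ∀ γ : ℝ → ℂ, ∀ s,
          (poleProd (L.map Λ) (γ s) • neumannTerm b Λ Y (n + 1) (γ s)) v =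
          (poleProd (L.map Λ) (γ s) •
            (neumannTerm b Λ Y n (γ s) * diagResolvent b Λ (γ s))) (-(Y v)) := by
        intro γ s
        rw [neumannTerm, pow_succ]
        simp only [neumannTerm, _root_.smul_apply, mul_apply_eq_comp, _root_.neg_apply, map_neg,
          smul_neg]
      rw [contourIntegral_congr_apply
          (G := fun μ => poleProd (L.map Λ) μ • neumannTerm b Λ Y (n + 1) μ)
          hγ₁.bounded k₁ (reg1 γ₁ c₁ h₁ L (n + 1)).1
          (reg1 γ₁ c₁ h₁ L (n + 1)).2 (G' := fun μ => poleProd (L.map Λ) μ •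
            (neumannTerm b Λ Y n μ * diagResolvent b Λ μ))
          (reg2 γ₁ c₁ h₁ L n).1 (reg2 γ₁ c₁ h₁ L n).2 (hpt γ₁),
        contourIntegral_congr_apply
          (G := fun μ => poleProd (L.map Λ) μ • neumannTerm b Λ Y (n + 1) μ)
          hγ₂.bounded k₂ (reg1 γ₂ c₂ h₂ L (n + 1)).1
          (reg1 γ₂ c₂ h₂ L (n + 1)).2 (G' := fun μ => poleProd (L.map Λ) μ •
            (neumannTerm b Λ Y n μ * diagResolvent b Λ μ))
          (reg2 γ₂ c₂ h₂ L n).1 (reg2 γ₂ c₂ h₂ L n).2 (hpt γ₂)]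
      exact hn.apply (-(Y v))
  exact ⟨main n, step n (main n)⟩

theorem IsDiagonalIn.continuous_resolvent_comp (hA : IsDiagonalIn A b Λ) {Y : H →L[ℂ] H}
    (hY : ‖Y‖ < d) {γ : ℝ → ℂ} (hγ : Continuous γ) (h : ∀ s i, d ≤ ‖(Λ i : ℂ) - γ s‖) :
    Continuous fun s => unbResolvent (addBounded A Y) (γ s) :=
  continuous_iff_continuousAt.2 fun s =>
    (hA.hasDerivAt_resolvent hY (h s)).continuousAt.comp hγ.continuousAt

/-- The Neumann series with remainder. -/
theorem IsDiagonalIn.resolvent_eq_sum (hA : IsDiagonalIn A b Λ) {Y : H →L[ℂ] H} (hY : ‖Y‖ < d)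
    {μ : ℂ} (h : ∀ i, d ≤ ‖(Λ i : ℂ) - μ‖) (n : ℕ) :
    unbResolvent (addBounded A Y) μ =
      ∑ j ∈ Finset.range n, neumannTerm b Λ Y j μ * diagResolvent b Λ μ +
        neumannTerm b Λ Y n μ * unbResolvent (addBounded A Y) μ := by
  induction n with
  | zero => simp [neumannTerm]
  | succ n ih =>
    have h1 : unbResolvent (addBounded A Y) μ = diagResolvent b Λ μ -
        diagResolvent b Λ μ * Y * unbResolvent (addBounded A Y) μ := by
      rw [sub_eq_add_neg, ← hA.resolvent_sub' hY h]; abel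
    have h2 : neumannTerm b Λ Y n μ * unbResolvent (addBounded A Y) μ =
        neumannTerm b Λ Y n μ * diagResolvent b Λ μ +
          neumannTerm b Λ Y (n + 1) μ * unbResolvent (addBounded A Y) μ := by
      conv_lhs => rw [h1]
      rw [mul_sub, neumannTerm, neumannTerm, pow_succ]
      noncomm_ring
    rw [Finset.sum_range_succ, add_assoc, ← h2]
    exact ih

/-- The remainder of the Neumann series is `(-R Y)ⁿ (A + Y - μ)⁻¹`, whose first factor decays
geometrically, uniformly on the contour. -/
theorem norm_transferV_sub_sum_le (hK : IsContinuedDerivative a₀ b₀ D (couplingFunction E B) K)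
    (hA : IsDiagonalIn A b Λ) {γ : ℝ → ℂ} (hγ : IsBoundedContour a₀ b₀ (sideDomain D l) K γ)
    (h : ∀ s i, d ≤ ‖(Λ i : ℂ) - γ s‖) {Y : H →L[ℂ] H} (hY : ‖Y‖ < d) (n : ℕ) :
    ‖transferV K γ (addBounded A Y) - ∑ j ∈ Finset.range n,
        contourIntegral K γ (fun μ => neumannTerm b Λ Y j μ * diagResolvent b Λ μ)‖ ≤
      (‖Y‖ / d) ^ n * (d - ‖Y‖)⁻¹ * variation K γ := by
  have hd : 0 < d := (norm_nonneg Y).trans_lt hY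
  have cγ := hγ.locallyLipschitz.continuous
  have kγ := hγ.continuous_comp hK
  have hi1 : ∀ j, Integrable fun s =>
      deriv γ s • (K (γ s) * (neumannTerm b Λ Y j (γ s) * diagResolvent b Λ (γ s))) := by
    intro j
    refine integrable_contour_integrand (M := (‖Y‖ / d) ^ j * d⁻¹)
      (G := fun μ => neumannTerm b Λ Y j μ * diagResolvent b Λ μ) hγ.bounded kγ
      ((continuous_neumannTerm_comp hA hd cγ h Y j).mul
        (continuous_diagResolvent_comp hA hd cγ h)) fun s => ?_
    refine (norm_mul_le _ _).trans ?_
    gcongr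
    · exact norm_neumannTerm_le hd (h s) Y j
    · exact norm_diagResolvent_le hd (h s)
  have hM2 : ∀ s, ‖neumannTerm b Λ Y n (γ s) * unbResolvent (addBounded A Y) (γ s)‖ ≤
      (‖Y‖ / d) ^ n * (d - ‖Y‖)⁻¹ := by
    intro s
    refine (norm_mul_le _ _).trans ?_
    gcongr
    · exact norm_neumannTerm_le hd (h s) Y n
    · exact hA.norm_resolvent_le hY (h s)
  have hi2 := integrable_contour_integrand
    (G := fun μ => neumannTerm b Λ Y n μ * unbResolvent (addBounded A Y) μ) hγ.bounded kγ
    ((continuous_neumannTerm_comp hA hd cγ h Y n).mul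
      (hA.continuous_resolvent_comp hY cγ h)) hM2
  have e : transferV K γ (addBounded A Y) = ∑ j ∈ Finset.range n,
      contourIntegral K γ (fun μ => neumannTerm b Λ Y j μ * diagResolvent b Λ μ) +
      contourIntegral K γ fun μ => neumannTerm b Λ Y n μ * unbResolvent (addBounded A Y) μ := by
    have e1 : ∑ j ∈ Finset.range n,
        contourIntegral K γ (fun μ => neumannTerm b Λ Y j μ * diagResolvent b Λ μ) =
        ∫ s, ∑ j ∈ Finset.range n,
          deriv γ s • (K (γ s) * (neumannTerm b Λ Y j (γ s) * diagResolvent b Λ (γ s))) :=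
      (integral_finsetSum _ fun j _ => hi1 j).symm
    rw [e1, contourIntegral, ← integral_add (integrable_finsetSum _ fun j _ => hi1 j) hi2]
    refine integral_congr_ae (Eventually.of_forall fun s => ?_)
    change deriv γ s • (K (γ s) * unbResolvent (addBounded A Y) (γ s)) = _
    conv_lhs => rw [hA.resolvent_eq_sum hY (h s) n]
    rw [mul_add, Finset.mul_sum, smul_add, Finset.smul_sum]
  rw [e, add_sub_cancel_left]
  exact norm_contourIntegral_le hγ.bounded hM2

/-- The operator `V₁(A + Y, Γ)` is the same for all contours at a distance from the spectrum of `A`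
larger than the norm of `Y`. -/
theorem transferV_eq (hK : IsContinuedDerivative a₀ b₀ D (couplingFunction E B) K)
    (hA : IsDiagonalIn A b Λ)
    (hγ₁ : IsBoundedContour a₀ b₀ (sideDomain D l) K γ₁)
    (hγ₂ : IsBoundedContour a₀ b₀ (sideDomain D l) K γ₂)
    (h₁ : ∀ s i, d ≤ ‖(Λ i : ℂ) - γ₁ s‖) (h₂ : ∀ s i, d ≤ ‖(Λ i : ℂ) - γ₂ s‖)
    (hΛ : ∀ i, Λ i ∈ realInterval a₀ b₀) {Y : H →L[ℂ] H} (hY : ‖Y‖ < d) :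
    transferV K γ₁ (addBounded A Y) = transferV K γ₂ (addBounded A Y) := by
  have hd : 0 < d := (norm_nonneg Y).trans_lt hY
  have hlt : ‖Y‖ / d < 1 := (div_lt_one hd).2 hY
  have hsame : ∀ j,
      contourIntegral K γ₁ (fun μ => neumannTerm b Λ Y j μ * diagResolvent b Λ μ) =
      contourIntegral K γ₂ (fun μ => neumannTerm b Λ Y j μ * diagResolvent b Λ μ) := by
    intro j
    have := (sameIntegral_neumannTerm hK hA hγ₁ hγ₂ hd h₁ h₂ hΛ Y j).2 []
    simpa only [SameIntegral, List.map_nil, poleProd_nil, one_smul] using this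
  have hle : ∀ n, ‖transferV K γ₁ (addBounded A Y) - transferV K γ₂ (addBounded A Y)‖ ≤
      (‖Y‖ / d) ^ n * ((d - ‖Y‖)⁻¹ * (variation K γ₁ + variation K γ₂)) := by
    intro n
    have e1 := norm_transferV_sub_sum_le hK hA hγ₁ h₁ hY n
    have e2 := norm_transferV_sub_sum_le hK hA hγ₂ h₂ hY n
    rw [Finset.sum_congr rfl fun j _ => hsame j] at e1
    rw [norm_sub_rev] at e2
    refine (norm_sub_le_norm_sub_add_norm_sub _ _ _).trans ((add_le_add e1 e2).trans_eq ?_)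
    ring
  have hlim := (tendsto_pow_atTop_nhds_zero_of_lt_one (by positivity) hlt).mul_const
    ((d - ‖Y‖)⁻¹ * (variation K γ₁ + variation K γ₂))
  rw [zero_mul] at hlim
  exact sub_eq_zero.1 (norm_le_zero_iff.1 (ge_of_tendsto' hlim hle))

/-- By the second resolvent identity the integrand of the difference contains the factor `Z - Y`;
this becomes the contraction estimate of the Picard iteration. -/
theorem transferV_sub_le (hK : IsContinuedDerivative a₀ b₀ D (couplingFunction E B) K)
    (hA : IsDiagonalIn A b Λ) {γ : ℝ → ℂ} (hγ : IsBoundedContour a₀ b₀ (sideDomain D l) K γ)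
    (h : ∀ s i, d ≤ ‖(Λ i : ℂ) - γ s‖) {Y Z : H →L[ℂ] H} (hY : ‖Y‖ < d) (hZ : ‖Z‖ < d) :
    ‖transferV K γ (addBounded A Y) - transferV K γ (addBounded A Z)‖ ≤
      (d - ‖Y‖)⁻¹ * ‖Y - Z‖ * (d - ‖Z‖)⁻¹ * variation K γ := by
  have hcont : ∀ W : H →L[ℂ] H, ‖W‖ < d →
      Continuous fun s => unbResolvent (addBounded A W) (γ s) := fun W hW =>
    continuous_iff_continuousAt.2 fun s =>
      (hA.hasDerivAt_resolvent hW (h s)).continuousAt.comp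
        hγ.locallyLipschitz.continuous.continuousAt
  have hint : ∀ W : H →L[ℂ] H, ‖W‖ < d →
      Integrable fun s => deriv γ s • (K (γ s) * unbResolvent (addBounded A W) (γ s)) :=
    fun W hW => integrable_contour_integrand hγ.bounded (hγ.continuous_comp hK) (hcont W hW)
      fun s => hA.norm_resolvent_le hW (h s)
  have e : transferV K γ (addBounded A Y) - transferV K γ (addBounded A Z) =
      contourIntegral K γ fun μ =>
        unbResolvent (addBounded A Y) μ - unbResolvent (addBounded A Z) μ := by
    refine (integral_sub (hint Y hY) (hint Z hZ)).symm.trans ?_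
    refine integral_congr_ae (Eventually.of_forall fun s => ?_)
    simp only
    rw [← smul_sub, mul_sub]
  rw [e]
  refine norm_contourIntegral_le hγ.bounded fun s => ?_
  rw [(hA.isResolvent hY (h s)).sub_eq_of_addBounded (hA.isResolvent hZ (h s)), norm_sub_rev Y Z]
  refine (norm_mul_le _ _).trans ?_
  gcongr
  · refine (norm_mul_le _ _).trans ?_
    gcongr
    exact hA.norm_resolvent_le hY (h s)
  · exact hA.norm_resolvent_le hZ (h s)

theorem norm_transferV_le (hA : IsDiagonalIn A b Λ) {γ : ℝ → ℂ}
    (hγ : IsBoundedContour a₀ b₀ (sideDomain D l) K γ)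
    (h : ∀ s i, d ≤ ‖(Λ i : ℂ) - γ s‖) {Y : H →L[ℂ] H} (hY : ‖Y‖ < d) :
    ‖transferV K γ (addBounded A Y)‖ ≤ (d - ‖Y‖)⁻¹ * variation K γ :=
  norm_contourIntegral_le hγ.bounded fun s => hA.norm_resolvent_le hY (h s)

end Neumann

/-! ### Norm bounds for the basic solution -/

section BasicSolution

variable {H : Type*} [NormedAddCommGroup H] [InnerProductSpace ℂ H] {A : H →ₗ.[ℂ] H}
  {K : ℂ → H →L[ℂ] H} {γ : ℝ → ℂ}

theorem variation_nonneg (K : ℂ → H →L[ℂ] H) (γ : ℝ → ℂ) : 0 ≤ variation K γ :=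
  integral_nonneg fun _ => by positivity

theorem contourDist_nonneg (A : H →ₗ.[ℂ] H) (γ : ℝ → ℂ) : 0 ≤ contourDist A γ :=
  Real.iInf_nonneg fun _ => Metric.infDist_nonneg

theorem contourDist_le {μ : ℂ} (hμ : μ ∈ unbSpectrum A) (s : ℝ) : contourDist A γ ≤ ‖μ - γ s‖ := by
  refine (ciInf_le ⟨0, by rintro _ ⟨s, rfl⟩; exact Metric.infDist_nonneg⟩ s).trans ?_
  rw [norm_sub_rev, ← dist_eq_norm]
  exact Metric.infDist_le_dist_of_mem hμ

theorem IsSmallContour.contourDist_pos (h : IsSmallContour A K γ) : 0 < contourDist A γ := by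
  have h1 := variation_nonneg K γ
  have h2 : variation K γ < contourDist A γ ^ 2 / 4 := h
  refine (contourDist_nonneg A γ).lt_of_ne fun h0 => ?_
  rw [← h0] at h2
  linarith

/-- `r_min` is the smaller root of `ρ (d₀ - ρ) = 𝓥₀`; smallness makes the discriminant positive. -/
theorem IsSmallContour.rMin_facts (h : IsSmallContour A K γ) :
    0 ≤ rMin A K γ ∧ rMin A K γ < contourDist A γ / 2 ∧
      rMin A K γ * (contourDist A γ - rMin A K γ) = variation K γ := by
  have h0 := h.contourDist_pos
  have h1 := variation_nonneg K γ
  have h2 : variation K γ < contourDist A γ ^ 2 / 4 := h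
  have h3 : 0 < contourDist A γ ^ 2 / 4 - variation K γ := by linarith
  have h4 := Real.sqrt_pos.2 h3
  have h5 := Real.sq_sqrt h3.le
  refine ⟨?_, ?_, ?_⟩
  · rw [rMin, sub_nonneg]
    exact Real.sqrt_le_iff.2 ⟨by positivity, by nlinarith⟩
  · rw [rMin]; linarith
  · rw [rMin]; nlinarith

variable {H₀ : Type*} [NormedAddCommGroup H₀] [InnerProductSpace ℂ H₀] [CompleteSpace H₀]
  [CompleteSpace H] {E : ProjectionMeasure H₀} {B : H₀ →L[ℂ] H} {a₀ b₀ : EReal} {D : Set ℂ}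
  {l : ℤˣ} {ι : Type*} {b : HilbertBasis ι ℂ H} {Λ : ι → ℝ} {X : H →L[ℂ] H}

/-- The equation gives `‖X‖ (d₀ - ‖X‖) ≤ 𝓥₀`, so `‖X‖` lies below the smaller root `r_min` or above
the larger root `d₀ - r_min`. The second case is excluded by `‖X‖ < r_max ≤ d₀ - r_min`, as `r_min ≤
√𝓥₀`. -/
theorem IsBasicSolution.norm_le_rMin (hA : IsDiagonalIn A b Λ) (hΛ : ∀ i, (Λ i : ℂ) ∈ unbSpectrum A)
    (hγ : IsBoundedContour a₀ b₀ (sideDomain D l) K γ)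
    (hs : IsSmallContour A K γ) (hX : IsBasicSolution A K γ X) : ‖X‖ ≤ rMin A K γ := by
  obtain ⟨h0, h1, h2⟩ := hs.rMin_facts
  have hV := variation_nonneg K γ
  have hXr : ‖X‖ < contourDist A γ - √(variation K γ) := hX.1
  have hXd : ‖X‖ < contourDist A γ := by linarith [Real.sqrt_nonneg (variation K γ)]
  have h3 := norm_transferV_le hA hγ (fun s i => contourDist_le (hΛ i) s) hXd
  rw [← hX.2, inv_mul_eq_div, le_div_iff₀ (sub_pos.2 hXd)] at h3
  have h4 : rMin A K γ ≤ √(variation K γ) := Real.le_sqrt_of_sq_le (by nlinarith)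
  by_contra! hlt
  nlinarith

/-- The norm of the basic solution is at most `r_min` of any small contour on the same side. -/
theorem IsBasicSolution.norm_le_rMin_of_small
    (hK : IsContinuedDerivative a₀ b₀ D (couplingFunction E B) K)
    (hA : IsDiagonalIn A b Λ) (hΛ : ∀ i, (Λ i : ℂ) ∈ unbSpectrum A)
    (hΛJ : ∀ i, Λ i ∈ realInterval a₀ b₀)
    (hγ : IsBoundedContour a₀ b₀ (sideDomain D l) K γ)
    (hs : IsSmallContour A K γ) (hX : IsBasicSolution A K γ X) {γ' : ℝ → ℂ}
    (hγ' : IsBoundedContour a₀ b₀ (sideDomain D l) K γ') (hs' : IsSmallContour A K γ') :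
    ‖X‖ ≤ rMin A K γ' := by
  obtain ⟨h0, h1, h2⟩ := hs.rMin_facts
  obtain ⟨h0', h1', h2'⟩ := hs'.rMin_facts
  have hXr := hX.norm_le_rMin hA hΛ hγ hs
  have hdist := fun (s : ℝ) (i : ι) => contourDist_le (γ := γ) (hΛ i) s
  have hdist' := fun (s : ℝ) (i : ι) => contourDist_le (γ := γ') (hΛ i) s
  set d := contourDist A γ
  set d' := contourDist A γ'
  set r := rMin A K γ
  set r' := rMin A K γ'
  -- The Picard iteration for the original contour, started at `0`. It converges to `X` with ratio
  -- `r / (d - r) < 1`.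
  let Φ : (H →L[ℂ] H) → H →L[ℂ] H := fun Y => transferV K γ (addBounded A Y)
  have hball : ∀ (γ'' : ℝ → ℂ) (ρ δ : ℝ), IsBoundedContour a₀ b₀ (sideDomain D l) K γ'' →
      (∀ s i, δ ≤ ‖(Λ i : ℂ) - γ'' s‖) → 0 ≤ ρ → ρ < δ / 2 → ρ * (δ - ρ) = variation K γ'' →
      ∀ Y : H →L[ℂ] H, ‖Y‖ ≤ ρ → ‖transferV K γ'' (addBounded A Y)‖ ≤ ρ := by
    intro γ'' ρ δ hb hδ hρ0 hρ hV Y hY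
    have hYδ : ‖Y‖ < δ := by linarith
    refine (norm_transferV_le hA hb hδ hYδ).trans ?_
    rw [inv_mul_eq_div, div_le_iff₀ (by linarith), ← hV]
    gcongr
  have hY : ∀ n, ‖Φ^[n] 0‖ ≤ r ∧ ‖Φ^[n] 0‖ ≤ r' := by
    intro n
    induction n with
    | zero => simpa using ⟨h0, h0'⟩
    | succ n ih =>
      rw [Function.iterate_succ_apply']
      refine ⟨hball γ r d hγ hdist h0 h1 h2 _ ih.1, ?_⟩
      -- The iterate is smaller than both distances, so the integral may be taken over `γ'` as well,
      -- and the ball of radius `r'` is kept too.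
      have hmin : ‖Φ^[n] 0‖ < min d d' := lt_min (by linarith) (by linarith)
      have e : Φ (Φ^[n] 0) = transferV K γ' (addBounded A (Φ^[n] 0)) :=
        transferV_eq hK hA hγ hγ' (fun s i => (min_le_left _ _).trans (hdist s i))
          (fun s i => (min_le_right _ _).trans (hdist' s i)) hΛJ hmin
      rw [e]
      exact hball γ' r' d' hγ' hdist' h0' h1' h2' _ ih.2
  have hpos : 0 < d - r := by linarith
  have hcontr : ∀ n, ‖Φ^[n] 0 - X‖ ≤ (r / (d - r)) ^ n * ‖X‖ := by
    intro n
    induction n with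
    | zero => simp
    | succ n ih =>
      rw [Function.iterate_succ_apply']
      have hYn := (hY n).1
      have hYd : ‖Φ^[n] 0‖ < d := by linarith
      have hXd : ‖X‖ < d := by linarith
      have := transferV_sub_le hK hA hγ hdist hYd hXd
      rw [← hX.2] at this
      refine this.trans ?_
      rw [← h2]
      calc _ ≤ (d - r)⁻¹ * ((r / (d - r)) ^ n * ‖X‖) * (d - r)⁻¹ * (r * (d - r)) := by
            gcongr
        _ = _ := by rw [pow_succ]; field_simp
  have hq : r / (d - r) < 1 := (div_lt_one hpos).2 (by linarith)
  have hlim : Tendsto (fun n => Φ^[n] 0) atTop (𝓝 X) := by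
    rw [tendsto_iff_norm_sub_tendsto_zero]
    have := (tendsto_pow_atTop_nhds_zero_of_lt_one (by positivity) hq).mul_const ‖X‖
    rw [zero_mul] at this
    exact squeeze_zero (fun _ => norm_nonneg _) hcontr this
  exact le_of_tendsto' hlim.norm fun n => (hY n).2

theorem IsBasicSolution.norm_le_rZero
    (hK : IsContinuedDerivative a₀ b₀ D (couplingFunction E B) K)
    (hA : IsDiagonalIn A b Λ) (hΛ : ∀ i, (Λ i : ℂ) ∈ unbSpectrum A)
    (hΛJ : ∀ i, Λ i ∈ realInterval a₀ b₀)
    (hγ : IsBoundedContour a₀ b₀ (sideDomain D l) K γ)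
    (hs : IsSmallContour A K γ) (hX : IsBasicSolution A K γ X) :
    ‖X‖ ≤ rZero a₀ b₀ (sideDomain D l) A K := by
  refine le_csInf ⟨_, γ, hγ, hs, rfl⟩ ?_
  rintro _ ⟨γ', hγ', hs', rfl⟩
  exact hX.norm_le_rMin_of_small hK hA hΛ hΛJ hγ hs hγ' hs'

end BasicSolution

/-! ### The theorem of Cauchy in a disc with two holes -/

section Cauchy

variable {E : Type*} [NormedAddCommGroup E] [NormedSpace ℂ E]

/-- The integral of Cauchy type `∮ f(w) (w - z)⁻¹ dw`. -/
def cauchyTransform (c : ℂ) (R : ℝ) (f : ℂ → E) (z : ℂ) : E := ∮ w in C(c, R), (w - z)⁻¹ • f w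

theorem circleMap_sub_ne_zero {c z : ℂ} {R : ℝ} (hR : 0 ≤ R) (hz : ‖z - c‖ ≠ R) (θ : ℝ) :
    circleMap c R θ - z ≠ 0 := by
  rw [sub_ne_zero]
  rintro rfl
  exact hz (by rw [← dist_eq_norm]; exact circleMap_mem_sphere c hR θ)

theorem continuous_comp_circleMap {F : Type*} [TopologicalSpace F] {c : ℂ} {R : ℝ} (hR : 0 ≤ R)
    {f : ℂ → F}
    (hf : ∀ z, ‖z - c‖ = R → ContinuousAt f z) : Continuous fun θ => f (circleMap c R θ) :=
  continuous_iff_continuousAt.2 fun θ =>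
    (hf _ (by rw [← dist_eq_norm]; exact circleMap_mem_sphere c hR θ)).comp
      (f := circleMap c R) (continuous_circleMap c R).continuousAt

/-- Differentiation under the integral sign. With `δ` half the distance from `z` to the circle, the
kernel is controlled by `δ` on the whole ball of radius `δ` around `z`. -/
theorem differentiableAt_cauchyTransform {c z : ℂ} {R : ℝ} (hR : 0 ≤ R) {f : ℂ → E}
    (hf : ∀ z, ‖z - c‖ = R → ContinuousAt f z) (hz : ‖z - c‖ ≠ R) :
    DifferentiableAt ℂ (cauchyTransform c R f) z := by
  have hfc := continuous_comp_circleMap hR hf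
  have hdc : Continuous (deriv (circleMap c R)) := by
    rw [show deriv (circleMap c R) = fun θ => circleMap 0 R θ * Complex.I from
      funext fun θ => deriv_circleMap c R θ]
    exact (continuous_circleMap 0 R).mul continuous_const
  set δ := |‖z - c‖ - R| / 2 with hδ
  have hδ0 : 0 < δ := by have := abs_pos.2 (sub_ne_zero.2 hz); positivity
  have hfar : ∀ w ∈ Metric.ball z δ, ∀ θ, δ ≤ ‖circleMap c R θ - w‖ := by
    intro w hw θ
    have h1 : ‖circleMap c R θ - c‖ = R := by
      rw [← dist_eq_norm]; exact circleMap_mem_sphere c hR θ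
    have h2 : |‖z - c‖ - R| ≤ ‖z - circleMap c R θ‖ := by
      calc _ = |‖z - c‖ - ‖circleMap c R θ - c‖| := by rw [h1]
        _ ≤ _ := abs_norm_sub_norm_le _ _
        _ = _ := by congr 1; ring
    have h3 : ‖z - circleMap c R θ‖ ≤ ‖z - w‖ + ‖w - circleMap c R θ‖ :=
      norm_sub_le_norm_sub_add_norm_sub _ _ _
    rw [Metric.mem_ball, dist_comm, dist_eq_norm] at hw
    rw [norm_sub_rev]
    have h4 : |‖z - c‖ - R| = 2 * δ := by rw [hδ]; ring
    linarith
  have hne : ∀ w ∈ Metric.ball z δ, ∀ θ, circleMap c R θ - w ≠ 0 := fun w hw θ e => by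
    have := hfar w hw θ
    rw [e, norm_zero] at this
    linarith
  have hcont : ∀ w ∈ Metric.ball z δ, Continuous fun θ =>
      deriv (circleMap c R) θ • (circleMap c R θ - w)⁻¹ • f (circleMap c R θ) := fun w hw =>
    hdc.smul ((((continuous_circleMap c R).sub continuous_const).inv₀ (hne w hw)).smul hfc)
  have hcont' : Continuous fun θ =>
      deriv (circleMap c R) θ • ((circleMap c R θ - z) ^ 2)⁻¹ • f (circleMap c R θ) :=
    hdc.smul (((((continuous_circleMap c R).sub continuous_const).pow 2).inv₀
      (fun θ => pow_ne_zero 2 (hne z (Metric.mem_ball_self hδ0) θ))).smul hfc)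
  refine (intervalIntegral.hasDerivAt_integral_of_dominated_loc_of_deriv_le (𝕜 := ℂ)
    (F := fun w θ => deriv (circleMap c R) θ • (circleMap c R θ - w)⁻¹ • f (circleMap c R θ))
    (F' := fun w θ => deriv (circleMap c R) θ • ((circleMap c R θ - w) ^ 2)⁻¹ •
      f (circleMap c R θ)) (bound := fun θ => ‖deriv (circleMap c R) θ‖ * ((δ ^ 2)⁻¹ *
      ‖f (circleMap c R θ)‖)) (a := 0) (b := 2 * Real.pi) (μ := volume)
    (Metric.ball_mem_nhds z hδ0) ?_ ?_ ?_ ?_ ?_ ?_).2.differentiableAt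
  · filter_upwards [Metric.ball_mem_nhds z hδ0] with w hw
    exact (hcont w hw).aestronglyMeasurable
  · exact (hcont z (Metric.mem_ball_self hδ0)).intervalIntegrable _ _
  · exact hcont'.aestronglyMeasurable
  · refine Eventually.of_forall fun θ _ w hw => ?_
    rw [norm_smul, norm_smul, norm_inv, norm_pow]
    gcongr
    exact hfar w hw θ
  · exact Continuous.intervalIntegrable
      (hdc.norm.mul (continuous_const.mul hfc.norm)) _ _
  · refine Eventually.of_forall fun θ _ w hw => ?_
    have h1 : HasDerivAt (fun w => (circleMap c R θ - w)⁻¹) (((circleMap c R θ - w) ^ 2)⁻¹) w := by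
      have := ((hasDerivAt_id w).const_sub (circleMap c R θ)).fun_inv (hne w hw θ)
      simpa using this
    exact (h1.smul_const _).const_smul _

variable [CompleteSpace E]

/-- After Fubini the inner integral is `∮ (w - z)⁻¹ dz = -2πi`, because every `w` on the small
circle lies inside the large one. -/
theorem circleIntegral_cauchyTransform {c w₀ : ℂ} {ρ s : ℝ} (hs : 0 ≤ s)
    {f : ℂ → E} (hf : ∀ z, ‖z - w₀‖ = s → ContinuousAt f z)
    (hin : ∀ w, ‖w - w₀‖ = s → ‖w - c‖ < ρ) :
    (∮ z in C(c, ρ), cauchyTransform w₀ s f z) =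
      -((2 * Real.pi * Complex.I : ℂ) • ∮ w in C(w₀, s), f w) := by
  have hρ : 0 ≤ ρ := (norm_nonneg _).trans (hin (w₀ + s) (by simp [hs])).le
  have hw : ∀ θ, ‖circleMap w₀ s θ - w₀‖ = s := fun θ => by
    rw [← dist_eq_norm]; exact circleMap_mem_sphere w₀ hs θ
  have hdc : ∀ (c : ℂ) (R : ℝ), Continuous (deriv (circleMap c R)) := fun c R => by
    rw [show deriv (circleMap c R) = fun θ => circleMap 0 R θ * Complex.I from
      funext fun θ => deriv_circleMap c R θ]
    exact (continuous_circleMap 0 R).mul continuous_const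
  have hfc := continuous_comp_circleMap hs hf
  have hcont : Continuous fun p : ℝ × ℝ => deriv (circleMap c ρ) p.1 •
      deriv (circleMap w₀ s) p.2 • (circleMap w₀ s p.2 - circleMap c ρ p.1)⁻¹ •
        f (circleMap w₀ s p.2) := by
    refine ((hdc c ρ).comp continuous_fst).smul (((hdc w₀ s).comp continuous_snd).smul
      (((((continuous_circleMap w₀ s).comp continuous_snd).sub
        ((continuous_circleMap c ρ).comp continuous_fst)).inv₀ fun p => ?_).smul
        (hfc.comp continuous_snd)))
    change circleMap w₀ s p.2 - circleMap c ρ p.1 ≠ 0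
    rw [← neg_ne_zero, neg_sub]
    exact circleMap_sub_ne_zero hρ (hin _ (hw p.2)).ne p.1
  have hswap : (∮ z in C(c, ρ), cauchyTransform w₀ s f z) =
      ∮ w in C(w₀, s), (∮ z in C(c, ρ), (w - z)⁻¹) • f w := by
    simp only [cauchyTransform, circleIntegral]
    calc _ = ∫ θ in (0)..2 * Real.pi, ∫ φ in (0)..2 * Real.pi, deriv (circleMap c ρ) θ •
        deriv (circleMap w₀ s) φ • (circleMap w₀ s φ - circleMap c ρ θ)⁻¹ •
        f (circleMap w₀ s φ) := by simp only [intervalIntegral.integral_smul]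
      _ = ∫ φ in (0)..2 * Real.pi, ∫ θ in (0)..2 * Real.pi, deriv (circleMap c ρ) θ •
        deriv (circleMap w₀ s) φ • (circleMap w₀ s φ - circleMap c ρ θ)⁻¹ •
        f (circleMap w₀ s φ) := intervalIntegral_intervalIntegral_swap
          ((hcont.continuousOn.integrableOn_compact
            (isCompact_uIcc.prod isCompact_uIcc)).mono_set
              (prod_mono uIoc_subset_uIcc uIoc_subset_uIcc))
      _ = _ := by
        congr 1
        ext φ
        rw [← intervalIntegral.integral_smul_const, ← intervalIntegral.integral_smul]
        congr 1
        ext θ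
        rw [smul_assoc, smul_comm]
  have hval : ∀ w, ‖w - w₀‖ = s → (∮ z in C(c, ρ), (w - z)⁻¹) = -(2 * Real.pi * Complex.I) := by
    intro w h
    rw [← circleIntegral.integral_sub_inv_of_mem_ball
      (show w ∈ Metric.ball c ρ by rw [Metric.mem_ball, dist_eq_norm]; exact hin w h)]
    simp only [circleIntegral]
    rw [← intervalIntegral.integral_neg]
    congr 1
    ext θ
    rw [← smul_neg, ← inv_neg, neg_sub]
  rw [hswap, ← neg_smul, ← circleIntegral.integral_smul]
  refine circleIntegral.integral_congr hs fun w h => ?_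
  rw [hval w (by rw [← dist_eq_norm]; exact h)]

/-- The integral formula of Cauchy in an annulus. -/
theorem cauchyTransform_sub_cauchyTransform {w₀ z : ℂ} {s r : ℝ} (hs : 0 < s) {f : ℂ → E}
    (hf : ∀ z, s ≤ ‖z - w₀‖ → ‖z - w₀‖ ≤ r → DifferentiableAt ℂ f z) (h1 : s < ‖z - w₀‖)
    (h2 : ‖z - w₀‖ < r) : cauchyTransform w₀ r f z - cauchyTransform w₀ s f z =
      (2 * Real.pi * Complex.I : ℂ) • f z := by
  have hsr : s < r := h1.trans h2
  have hcirc : ∀ R, 0 ≤ R → s ≤ R → R ≤ r → ‖z - w₀‖ ≠ R → (∮ w in C(w₀, R), dslope f z w) =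
      cauchyTransform w₀ R f z - (∮ w in C(w₀, R), (w - z)⁻¹) • f z := by
    intro R hR h3 h4 hz
    have hnorm : ∀ w ∈ Metric.sphere w₀ R, ‖w - w₀‖ = R := fun w hw => by
      rw [← dist_eq_norm]; exact hw
    have hne : ∀ w ∈ Metric.sphere w₀ R, w - z ≠ 0 := fun w hw e => by
      rw [sub_eq_zero] at e
      exact hz (e ▸ hnorm w hw)
    have hinv : ContinuousOn (fun w => (w - z)⁻¹) (Metric.sphere w₀ R) :=
      (continuousOn_id.sub continuousOn_const).inv₀ hne
    have hfc : ContinuousOn f (Metric.sphere w₀ R) := fun w hw =>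
      (hf w (by rw [hnorm w hw]; exact h3)
        (by rw [hnorm w hw]; exact h4)).continuousAt.continuousWithinAt
    have hsub := circleIntegral.integral_sub (f := fun w => (w - z)⁻¹ • f w)
      (g := fun w => (w - z)⁻¹ • f z) ((hinv.smul hfc).circleIntegrable hR)
      ((hinv.smul continuousOn_const).circleIntegrable hR)
    rw [cauchyTransform, ← circleIntegral.integral_smul_const, ← hsub]
    refine circleIntegral.integral_congr hR fun w hw => ?_
    rw [dslope_of_ne _ (sub_ne_zero.1 (hne w hw)), slope_def_module, smul_sub]
  -- The divided difference is holomorphic off `z` and continuous at `z`, so Cauchy's theorem holds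
  -- with one exceptional point.
  have hann : (∮ w in C(w₀, r), dslope f z w) = ∮ w in C(w₀, s), dslope f z w := by
    have hzn : Metric.closedBall w₀ r \ Metric.ball w₀ s ∈ 𝓝 z := by
      have : ∀ᶠ w in 𝓝 z, s < ‖w - w₀‖ ∧ ‖w - w₀‖ < r := by
        have hc : ContinuousAt (fun w => ‖w - w₀‖) z := by fun_prop
        exact (hc.eventually (lt_mem_nhds h1)).and (hc.eventually (gt_mem_nhds h2))
      filter_upwards [this] with w hw
      rw [Set.mem_sdiff, Metric.mem_closedBall, Metric.mem_ball, dist_eq_norm]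
      exact ⟨hw.2.le, not_lt.2 hw.1.le⟩
    refine Complex.circleIntegral_eq_of_differentiable_on_annulus_off_countable hs hsr.le
      (countable_singleton z) ?_ ?_
    · refine (continuousOn_dslope hzn).2 ⟨fun w hw => ?_, hf z h1.le h2.le⟩
      rw [Set.mem_sdiff, Metric.mem_closedBall, Metric.mem_ball, dist_eq_norm, not_lt] at hw
      exact (hf w hw.2 hw.1).continuousAt.continuousWithinAt
    · rintro w ⟨hw, hwz⟩
      rw [Set.mem_sdiff, Metric.mem_closedBall, Metric.mem_ball, dist_eq_norm, not_le] at hw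
      exact (differentiableAt_dslope_of_ne hwz).2 (hf w hw.2.le hw.1.le)
  rw [hcirc r (hs.trans hsr).le hsr.le le_rfl h2.ne, hcirc s hs.le le_rfl hsr.le h1.ne',
    circleIntegral.integral_sub_inv_of_mem_ball (by rwa [Metric.mem_ball, dist_eq_norm])] at hann
  have hzero : (∮ w in C(w₀, s), (w - z)⁻¹) = 0 := by
    have hd : ∀ w ∈ Metric.closedBall w₀ s, DifferentiableAt ℂ (fun w => (w - z)⁻¹) w := by
      intro w hw
      refine (differentiableAt_id.sub_const z).inv (sub_ne_zero.2 ?_)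
      rintro rfl
      rw [Metric.mem_closedBall, dist_eq_norm] at hw
      exact not_lt.2 hw h1
    exact Complex.circleIntegral_eq_zero_of_differentiable_on_off_countable hs.le countable_empty
      (fun w hw => (hd w hw).continuousAt.continuousWithinAt)
      fun w hw => hd w (Metric.ball_subset_closedBall hw.1)
  rw [hzero, zero_smul, sub_zero] at hann
  rw [← hann]
  abel

/-- The theorem of Cauchy for an annulus from which a small disc is removed. -/
theorem circleIntegral_eq_add_of_differentiable_off_disc {f : ℂ → E} {c w₀ : ℂ} {ρ₁ ρ₂ s r : ℝ}
    (h1 : 0 < ρ₁) (h12 : ρ₁ ≤ ρ₂) (hs : 0 < s) (hsr : s < r)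
    (hin : ∀ z, ‖z - w₀‖ ≤ r → ρ₁ < ‖z - c‖ ∧ ‖z - c‖ < ρ₂)
    (hf : ∀ z, ρ₁ ≤ ‖z - c‖ → ‖z - c‖ ≤ ρ₂ → s ≤ ‖z - w₀‖ → DifferentiableAt ℂ f z) :
    (∮ z in C(c, ρ₂), f z) = (∮ z in C(c, ρ₁), f z) + ∮ z in C(w₀, r), f z := by
  have hπ : (2 * Real.pi * Complex.I : ℂ) ≠ 0 := by simp [Real.pi_ne_zero]
  set κ : ℂ := (2 * Real.pi * Complex.I : ℂ)⁻¹
  have hfa : ∀ z, s ≤ ‖z - w₀‖ → ‖z - w₀‖ ≤ r → DifferentiableAt ℂ f z := fun z h3 h4 =>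
    hf z (hin z h4).1.le (hin z h4).2.le h3
  have hfs : ∀ z, ‖z - w₀‖ = s → ContinuousAt f z := fun z h3 =>
    (hfa z h3.ge (h3.le.trans hsr.le)).continuousAt
  have hfr : ∀ z, ‖z - w₀‖ = r → ContinuousAt f z := fun z h3 =>
    (hfa z (hsr.le.trans h3.ge) h3.le).continuousAt
  -- Laurent splitting: adding the Cauchy transform over the inner circle removes from `f` its part
  -- singular in the hole. The sum is holomorphic across the hole, where it is the Cauchy transform
  -- over the outer circle, so the plain annulus theorem applies to `F`.
  let F : ℂ → E := fun z => if ‖z - w₀‖ < r then κ • cauchyTransform w₀ r f z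
    else f z + κ • cauchyTransform w₀ s f z
  have hFout : ∀ z, s < ‖z - w₀‖ → F z = f z + κ • cauchyTransform w₀ s f z := by
    intro z hz
    simp only [F]
    split_ifs with h
    · have := cauchyTransform_sub_cauchyTransform hs hfa hz h
      rw [sub_eq_iff_eq_add] at this
      rw [this, smul_add, smul_smul, inv_mul_cancel₀ hπ, one_smul]
    · rfl
  have hnc : ∀ z, ContinuousAt (fun w => ‖w - w₀‖) z := fun z => by fun_prop
  have hFd : ∀ z, ρ₁ ≤ ‖z - c‖ → ‖z - c‖ ≤ ρ₂ → DifferentiableAt ℂ F z := by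
    intro z h3 h4
    rcases lt_or_ge s ‖z - w₀‖ with hz | hz
    · have hd : DifferentiableAt ℂ (fun z => f z + κ • cauchyTransform w₀ s f z) z :=
        (hf z h3 h4 hz.le).add ((differentiableAt_cauchyTransform hs.le hfs hz.ne').const_smul κ)
      refine hd.congr_of_eventuallyEq ?_
      filter_upwards [(hnc z).eventually (lt_mem_nhds hz)] with w hw
      exact hFout w hw
    · have hzr := hz.trans_lt hsr
      have hd : DifferentiableAt ℂ (fun z => κ • cauchyTransform w₀ r f z) z :=
        (differentiableAt_cauchyTransform (hs.trans hsr).le hfr hzr.ne).const_smul κ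
      refine hd.congr_of_eventuallyEq ?_
      filter_upwards [(hnc z).eventually (gt_mem_nhds hzr)] with w hw
      simp only [F, if_pos hw]
  have hann : (∮ z in C(c, ρ₂), F z) = ∮ z in C(c, ρ₁), F z := by
    have hm : ∀ z ∈ Metric.closedBall c ρ₂ \ Metric.ball c ρ₁, DifferentiableAt ℂ F z := by
      intro z hz
      rw [Set.mem_sdiff, Metric.mem_closedBall, Metric.mem_ball, dist_eq_norm, not_lt] at hz
      exact hFd z hz.2 hz.1
    exact Complex.circleIntegral_eq_of_differentiable_on_annulus_off_countable h1 h12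
      countable_empty (fun z hz => (hm z hz).continuousAt.continuousWithinAt) fun z hz =>
      hm z (sdiff_subset_sdiff Metric.ball_subset_closedBall Metric.ball_subset_closedBall hz.1)
  have hsplit : ∀ ρ, 0 ≤ ρ → (∀ z, ‖z - c‖ = ρ → r < ‖z - w₀‖) → ρ₁ ≤ ρ → ρ ≤ ρ₂ →
      (∮ z in C(c, ρ), F z) =
        (∮ z in C(c, ρ), f z) + κ • ∮ z in C(c, ρ), cauchyTransform w₀ s f z := by
    intro ρ h0 hout h3 h4
    have hn : ∀ z ∈ Metric.sphere c ρ, ‖z - c‖ = ρ := fun z hz => by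
      rw [← dist_eq_norm]; exact hz
    have hc : ContinuousOn (cauchyTransform w₀ s f) (Metric.sphere c ρ) := fun z hz =>
      (differentiableAt_cauchyTransform hs.le hfs
        (hsr.trans (hout z (hn z hz))).ne').continuousAt.continuousWithinAt
    rw [← circleIntegral.integral_smul, ← circleIntegral.integral_add]
    · refine circleIntegral.integral_congr h0 fun z hz => ?_
      exact hFout z (hsr.trans (hout z (hn z hz)))
    · refine ContinuousOn.circleIntegrable h0 fun z hz => ?_
      exact (hf z (h3.trans (hn z hz).ge) ((hn z hz).le.trans h4)
        (hsr.trans (hout z (hn z hz))).le).continuousAt.continuousWithinAt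
    · exact (hc.const_smul κ).circleIntegrable h0
  have hz1 : (∮ z in C(c, ρ₁), cauchyTransform w₀ s f z) = 0 := by
    have hd : ∀ z ∈ Metric.closedBall c ρ₁, DifferentiableAt ℂ (cauchyTransform w₀ s f) z := by
      intro z hz
      rw [Metric.mem_closedBall, dist_eq_norm] at hz
      refine differentiableAt_cauchyTransform hs.le hfs fun h => ?_
      exact not_lt.2 hz (hin z (h.le.trans hsr.le)).1
    exact Complex.circleIntegral_eq_zero_of_differentiable_on_off_countable h1.le countable_empty
      (fun w hw => (hd w hw).continuousAt.continuousWithinAt)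
      fun w hw => hd w (Metric.ball_subset_closedBall hw.1)
  have hz2 := circleIntegral_cauchyTransform (c := c) (ρ := ρ₂) hs.le hfs
    fun w hw => (hin w (hw.le.trans hsr.le)).2
  have hrs : (∮ z in C(w₀, r), f z) = ∮ z in C(w₀, s), f z := by
    have hm : ∀ z ∈ Metric.closedBall w₀ r \ Metric.ball w₀ s, DifferentiableAt ℂ f z := by
      intro z hz
      rw [Set.mem_sdiff, Metric.mem_closedBall, Metric.mem_ball, dist_eq_norm, not_lt] at hz
      exact hfa z hz.2 hz.1
    exact Complex.circleIntegral_eq_of_differentiable_on_annulus_off_countable hs hsr.le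
      countable_empty (fun z hz => (hm z hz).continuousAt.continuousWithinAt) fun z hz =>
      hm z (sdiff_subset_sdiff Metric.ball_subset_closedBall Metric.ball_subset_closedBall hz.1)
  rw [hsplit ρ₂ (h1.le.trans h12) (fun z hz => by
      by_contra! h; exact (hin z h).2.ne hz) h12 le_rfl,
    hsplit ρ₁ h1.le (fun z hz => by
      by_contra! h; exact (hin z h).1.ne' hz) le_rfl h12, hz1, hz2, smul_zero, add_zero,
    smul_neg, smul_smul, inv_mul_cancel₀ hπ, one_smul, ← hrs] at hann
  rw [← hann]
  abel

end Cauchy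

/-! ### Riesz projections of perturbed diagonal operators -/

section Riesz

variable {H : Type*} [NormedAddCommGroup H] [InnerProductSpace ℂ H]

theorem norm_sub_of_mem_sphere {c z : ℂ} {ρ : ℝ} (h : z ∈ Metric.sphere c ρ) : ‖z - c‖ = ρ := by
  rw [← dist_eq_norm]; exact h

theorem circleIntegral_clm_apply {F : Type*} [NormedAddCommGroup F] [NormedSpace ℂ F]
    [CompleteSpace F] {f : ℂ → H →L[ℂ] F} {c : ℂ} {ρ : ℝ}
    (hf : CircleIntegrable f c ρ) (v : H) : (∮ z in C(c, ρ), f z) v = ∮ z in C(c, ρ), f z v := by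
  rw [circleIntegral, ContinuousLinearMap.intervalIntegral_apply hf.out]
  rfl

variable {ι : Type*} {A : H →ₗ.[ℂ] H} {b : HilbertBasis ι ℂ H} {Λ : ι → ℝ} {c : ℂ} {ρ δ : ℝ}

theorem IsDiagonalIn.continuousOn_diagResolvent (hA : IsDiagonalIn A b Λ) (hδ : 0 < δ) {s : Set ℂ}
    (h : ∀ z ∈ s, ∀ i, δ ≤ ‖(Λ i : ℂ) - z‖) : ContinuousOn (diagResolvent b Λ) s := fun z hz =>
  (hA.hasDerivAt_diagResolvent hδ (h z hz)).continuousAt.continuousWithinAt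

variable [CompleteSpace H]

/-- On a basis vector this is the residue of `(Λ k - z)⁻¹`: `-1` for an eigenvalue inside the
circle, and none outside. -/
theorem IsDiagonalIn.circleIntegral_diagResolvent (hA : IsDiagonalIn A b Λ) (hρ : 0 ≤ ρ)
    (hδ : 0 < δ) (h : ∀ z ∈ Metric.sphere c ρ, ∀ i, δ ≤ ‖(Λ i : ℂ) - z‖) :
    (∮ z in C(c, ρ), diagResolvent b Λ z) =
      -((2 * Real.pi * Complex.I : ℂ) • b.specProj {i | ‖(Λ i : ℂ) - c‖ < ρ}) := by
  refine b.ext_clm fun k => ?_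
  rw [circleIntegral_clm_apply ((hA.continuousOn_diagResolvent hδ h).circleIntegrable hρ)]
  have e1 : (∮ z in C(c, ρ), diagResolvent b Λ z (b k)) =
      (∮ z in C(c, ρ), ((Λ k : ℂ) - z)⁻¹) • b k := by
    rw [← circleIntegral.integral_smul_const]
    exact circleIntegral.integral_congr hρ fun z hz => diagResolvent_basis hδ (h z hz) k
  rw [e1, _root_.neg_apply, _root_.smul_apply]
  by_cases hk : ‖(Λ k : ℂ) - c‖ < ρ
  · rw [b.specProj_basis_of_mem (show k ∈ {i | ‖(Λ i : ℂ) - c‖ < ρ} from hk), ← neg_smul]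
    congr 1
    rw [← circleIntegral.integral_sub_inv_of_mem_ball
      (show (Λ k : ℂ) ∈ Metric.ball c ρ by rw [Metric.mem_ball, dist_eq_norm]; exact hk)]
    simp only [circleIntegral]
    rw [← intervalIntegral.integral_neg]
    congr 1
    ext θ
    rw [← smul_neg, ← inv_neg, neg_sub]
  · rw [b.specProj_basis_of_notMem (show k ∉ {i | ‖(Λ i : ℂ) - c‖ < ρ} from hk), smul_zero,
      neg_zero]
    have hd : ∀ z ∈ Metric.closedBall c ρ, DifferentiableAt ℂ (fun z => ((Λ k : ℂ) - z)⁻¹) z := by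
      intro z hz
      refine (differentiableAt_id.const_sub _).inv fun e => ?_
      have e : (Λ k : ℂ) = z := sub_eq_zero.1 e
      rw [Metric.mem_closedBall, dist_eq_norm, ← e] at hz
      have := h (Λ k) (by
        rw [mem_sphere_iff_norm]; exact le_antisymm hz (not_lt.1 hk)) k
      rw [sub_self, norm_zero] at this
      linarith
    rw [Complex.circleIntegral_eq_zero_of_differentiable_on_off_countable hρ countable_empty
      (fun w hw => (hd w hw).continuousAt.continuousWithinAt)
      fun w hw => hd w (Metric.ball_subset_closedBall hw.1), zero_smul]

variable {X : H →L[ℂ] H}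

theorem IsDiagonalIn.continuousOn_resolvent (hA : IsDiagonalIn A b Λ) (hX : ‖X‖ < δ) {s : Set ℂ}
    (h : ∀ z ∈ s, ∀ i, δ ≤ ‖(Λ i : ℂ) - z‖) :
    ContinuousOn (unbResolvent (addBounded A X)) s := fun z hz =>
  (hA.hasDerivAt_resolvent hX (h z hz)).continuousAt.continuousWithinAt

/-- The difference of the Riesz projections of the perturbed and of the diagonal operator. -/
theorem IsDiagonalIn.rieszProjection_sub_specProj (hA : IsDiagonalIn A b Λ) (hρ : 0 ≤ ρ)
    (hX : ‖X‖ < δ) (h : ∀ z ∈ Metric.sphere c ρ, ∀ i, δ ≤ ‖(Λ i : ℂ) - z‖) :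
    rieszProjection (addBounded A X) c ρ - b.specProj {i | ‖(Λ i : ℂ) - c‖ < ρ} =
      (2 * Real.pi * Complex.I : ℂ)⁻¹ • ∮ z in C(c, ρ),
        unbResolvent (addBounded A X) z * X * diagResolvent b Λ z := by
  have hδ : 0 < δ := (norm_nonneg X).trans_lt hX
  have hc1 := hA.continuousOn_resolvent hX h
  have hc2 := hA.continuousOn_diagResolvent hδ h
  have hπ : (2 * Real.pi * Complex.I : ℂ) ≠ 0 := by simp [Real.pi_ne_zero]
  have e : (∮ z in C(c, ρ), unbResolvent (addBounded A X) z) -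
      (∮ z in C(c, ρ), diagResolvent b Λ z) =
      -∮ z in C(c, ρ), unbResolvent (addBounded A X) z * X * diagResolvent b Λ z := by
    rw [← circleIntegral.integral_sub (hc1.circleIntegrable hρ) (hc2.circleIntegrable hρ),
      ← neg_one_smul ℂ (∮ z in C(c, ρ), unbResolvent (addBounded A X) z * X * diagResolvent b Λ z),
      ← circleIntegral.integral_smul]
    refine circleIntegral.integral_congr hρ fun z hz => ?_
    rw [neg_one_smul]
    exact hA.resolvent_sub hX (h z hz)
  rw [hA.circleIntegral_diagResolvent hρ hδ h, sub_neg_eq_add] at e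
  rw [rieszProjection, eq_sub_of_add_eq e, smul_sub, smul_neg, smul_smul, inv_mul_cancel₀ hπ,
    one_smul]
  abel

theorem IsDiagonalIn.norm_resolvent_mul_le (hA : IsDiagonalIn A b Λ) {z : ℂ} (hδ : 0 < δ)
    (hX : 2 * ‖X‖ ≤ δ) (h : ∀ i, δ ≤ ‖(Λ i : ℂ) - z‖) :
    ‖unbResolvent (addBounded A X) z * X * diagResolvent b Λ z‖ ≤ 2 * ‖X‖ / δ ^ 2 := by
  have hX' : ‖X‖ < δ := by linarith [norm_nonneg X]
  have h1 : ‖unbResolvent (addBounded A X) z‖ ≤ 2 / δ := by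
    refine (hA.norm_resolvent_le hX' h).trans ?_
    rw [inv_le_comm₀ (by linarith) (by positivity), inv_div]
    linarith
  calc _ ≤ ‖unbResolvent (addBounded A X) z‖ * ‖X‖ * ‖diagResolvent b Λ z‖ :=
        (norm_mul_le _ _).trans (by gcongr; exact norm_mul_le _ _)
    _ ≤ 2 / δ * ‖X‖ * δ⁻¹ := by gcongr; exact norm_diagResolvent_le hδ h
    _ = _ := by field_simp

theorem IsDiagonalIn.norm_rieszProjection_sub_specProj_le (hA : IsDiagonalIn A b Λ) (hρ : 0 < ρ)
    (hX : 2 * ‖X‖ ≤ ρ) (h : ∀ z ∈ Metric.sphere c ρ, ∀ i, ρ ≤ ‖(Λ i : ℂ) - z‖) :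
    ‖rieszProjection (addBounded A X) c ρ - b.specProj {i | ‖(Λ i : ℂ) - c‖ < ρ}‖ ≤
      2 * ‖X‖ / ρ := by
  rw [hA.rieszProjection_sub_specProj hρ.le (by linarith [norm_nonneg X]) h]
  refine (circleIntegral.norm_two_pi_i_inv_smul_integral_le_of_norm_le_const hρ.le fun z hz =>
    hA.norm_resolvent_mul_le hρ hX (h z hz)).trans_eq ?_
  field_simp

theorem IsDiagonalIn.rieszProjection_eq (hA : IsDiagonalIn A b Λ) {ρ' : ℝ} (hρ : 0 < ρ)
    (hρρ' : ρ ≤ ρ') (hX : ‖X‖ < δ)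
    (h : ∀ z, ρ ≤ ‖z - c‖ → ‖z - c‖ ≤ ρ' → ∀ i, δ ≤ ‖(Λ i : ℂ) - z‖) :
    rieszProjection (addBounded A X) c ρ' = rieszProjection (addBounded A X) c ρ := by
  have hm : ∀ z ∈ Metric.closedBall c ρ' \ Metric.ball c ρ,
      DifferentiableAt ℂ (unbResolvent (addBounded A X)) z := by
    intro z hz
    rw [Set.mem_sdiff, Metric.mem_closedBall, Metric.mem_ball, dist_eq_norm, not_lt] at hz
    exact (hA.hasDerivAt_resolvent hX (h z hz.2 hz.1)).differentiableAt
  rw [rieszProjection, rieszProjection,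
    Complex.circleIntegral_eq_of_differentiable_on_annulus_off_countable hρ hρρ' countable_empty
      (fun z hz => (hm z hz).continuousAt.continuousWithinAt) fun z hz => hm z
      (sdiff_subset_sdiff Metric.ball_subset_closedBall Metric.ball_subset_closedBall hz.1)]

theorem IsDiagonalIn.rieszProjection_eq_add (hA : IsDiagonalIn A b Λ) {w₀ : ℂ} {ρ' s r : ℝ}
    (hρ : 0 < ρ) (hρρ' : ρ ≤ ρ') (hs : 0 < s) (hsr : s < r) (hX : ‖X‖ < δ)
    (hin : ∀ z, ‖z - w₀‖ ≤ r → ρ < ‖z - c‖ ∧ ‖z - c‖ < ρ')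
    (h : ∀ z, ρ ≤ ‖z - c‖ → ‖z - c‖ ≤ ρ' → s ≤ ‖z - w₀‖ → ∀ i, δ ≤ ‖(Λ i : ℂ) - z‖) :
    rieszProjection (addBounded A X) c ρ' =
      rieszProjection (addBounded A X) c ρ + rieszProjection (addBounded A X) w₀ r := by
  rw [rieszProjection, rieszProjection, rieszProjection,
    circleIntegral_eq_add_of_differentiable_off_disc hρ hρρ' hs hsr hin fun z h1 h2 h3 =>
      (hA.hasDerivAt_resolvent hX (h z h1 h2 h3)).differentiableAt, smul_add, neg_add]

end Riesz

/-! ### An integral over a circle -/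

section CircleBound

theorem integral_inv_sq_add_mul_sq_le {δ a : ℝ} (hδ : 0 < δ) (ha : 0 < a) (t x y : ℝ) :
    ∫ θ in x..y, (δ ^ 2 + (a * θ - t) ^ 2)⁻¹ ≤ Real.pi / (δ * a) := by
  rw [intervalIntegral.integral_comp_mul_sub (fun u => (δ ^ 2 + u ^ 2)⁻¹) ha.ne',
    integral_inv_sq_add_sq hδ.ne', smul_eq_mul]
  have h1 := Real.arctan_lt_pi_div_two ((a * y - t) / δ)
  have h2 := Real.neg_pi_div_two_lt_arctan ((a * x - t) / δ)
  calc a⁻¹ * (δ⁻¹ * _) ≤ a⁻¹ * (δ⁻¹ * Real.pi) := by gcongr; linarith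
    _ = _ := by field_simp

/-- With `k π` the multiple of `π` nearest to `θ`, `|sin θ| ≥ (2/π) |θ - k π|`, whence `δ² + q² ≤ 2
d²`. Summing over `k = 0, 1, 2` avoids tracking which multiple is nearest. -/
theorem inv_max_sq_le {δ ρ d θ : ℝ} (hδ : 0 < δ) (hρ : 0 < ρ) (hθ0 : 0 ≤ θ)
    (hθ : θ ≤ 2 * Real.pi) (h1 : δ ≤ d) (h2 : ρ * |Real.sin θ| ≤ d) :
    (d ^ 2)⁻¹ ≤ 2 * ∑ k ∈ Finset.range 3,
      (δ ^ 2 + (ρ * (2 / Real.pi) * θ - ρ * (2 / Real.pi) * (k * Real.pi)) ^ 2)⁻¹ := by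
  have hπ := Real.pi_pos
  obtain ⟨k, hk, hkθ⟩ : ∃ k ∈ Finset.range 3, |θ - k * Real.pi| ≤ Real.pi / 2 := by
    rcases le_or_gt θ (Real.pi / 2) with h | h
    · exact ⟨0, by simp, by rw [abs_le]; constructor <;> push_cast <;> linarith⟩
    · rcases le_or_gt θ (3 * Real.pi / 2) with h' | h'
      · exact ⟨1, by simp, by rw [abs_le]; constructor <;> push_cast <;> linarith⟩
      · exact ⟨2, by simp, by rw [abs_le]; constructor <;> push_cast <;> linarith⟩
  have hsin := Real.mul_abs_le_abs_sin hkθ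
  have habs : |Real.sin (θ - k * Real.pi)| = |Real.sin θ| := by
    rw [Real.sin_sub_nat_mul_pi, abs_mul, abs_pow, abs_neg, abs_one, one_pow, one_mul]
  rw [habs] at hsin
  set q := ρ * (2 / Real.pi) * θ - ρ * (2 / Real.pi) * (k * Real.pi) with hq
  have hqd : |q| ≤ d := by
    have : |q| = ρ * (2 / Real.pi * |θ - k * Real.pi|) := by
      rw [hq, ← mul_sub, abs_mul, abs_of_pos (by positivity : 0 < ρ * (2 / Real.pi)), mul_assoc]
    rw [this]
    exact (by gcongr : _ ≤ ρ * |Real.sin θ|).trans h2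
  have h3 : δ ^ 2 + q ^ 2 ≤ 2 * d ^ 2 := by
    have e1 : q ^ 2 ≤ d ^ 2 := sq_le_sq' (by linarith [neg_abs_le q]) ((le_abs_self q).trans hqd)
    have e2 : δ ^ 2 ≤ d ^ 2 := by gcongr
    linarith
  have h4 : (d ^ 2)⁻¹ ≤ 2 * (δ ^ 2 + q ^ 2)⁻¹ := by
    have hd : 0 < d := hδ.trans_le h1
    rw [← div_eq_mul_inv, le_div_iff₀ (by positivity), inv_mul_le_iff₀ (by positivity)]
    linarith
  refine h4.trans ?_
  gcongr
  exact Finset.single_le_sum (f := fun k : ℕ =>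
    (δ ^ 2 + (ρ * (2 / Real.pi) * θ - ρ * (2 / Real.pi) * (k * Real.pi)) ^ 2)⁻¹)
    (fun i _ => by positivity) hk

/-- The bound is free of `ρ`: the integrand is of size `δ⁻²` only near the two real points of the
circle, and the arc length factor `ρ` cancels against the slope `2ρ/π` in the arctangent integral.
The trivial bound would grow with the radius. -/
theorem norm_circleIntegral_le_of_norm_le_inv_sq {E : Type*} [NormedAddCommGroup E]
    [NormedSpace ℂ E] {f : ℂ → E} {c δ ρ M : ℝ} (hδ : 0 < δ) (hρ : 0 < ρ) (hM : 0 ≤ M)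
    (h : ∀ z ∈ Metric.sphere (c : ℂ) ρ, ∃ d, δ ≤ d ∧ |z.im| ≤ d ∧ ‖f z‖ ≤ M / d ^ 2) :
    ‖∮ z in C((c : ℂ), ρ), f z‖ ≤ 3 * Real.pi ^ 2 * M / δ := by
  have hπ := Real.pi_pos
  set a := ρ * (2 / Real.pi) with ha
  have ha0 : 0 < a := by positivity
  let g : ℕ → ℝ → ℝ := fun k θ => (δ ^ 2 + (a * θ - a * (k * Real.pi)) ^ 2)⁻¹
  have hg : ∀ k, Continuous (g k) := fun k =>
    Continuous.inv₀ (by fun_prop) fun θ => by positivity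
  have hbound : ∀ θ ∈ Ioc 0 (2 * Real.pi),
      ‖deriv (circleMap (c : ℂ) ρ) θ • f (circleMap (c : ℂ) ρ θ)‖ ≤
        (2 * M * ρ) * ∑ k ∈ Finset.range 3, g k θ := by
    intro θ hθ
    obtain ⟨d, h1, h2, h3⟩ := h _ (circleMap_mem_sphere (c : ℂ) hρ.le θ)
    have him : |(circleMap (c : ℂ) ρ θ).im| = ρ * |Real.sin θ| := by
      have : (circleMap (c : ℂ) ρ θ).im = ρ * Real.sin θ := by
        rw [circleMap, Complex.add_im, Complex.ofReal_im, zero_add, Complex.im_ofReal_mul,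
          Complex.exp_ofReal_mul_I_im]
      rw [this, abs_mul, abs_of_pos hρ]
    rw [him] at h2
    have hder : ‖deriv (circleMap (c : ℂ) ρ) θ‖ = ρ := by
      rw [deriv_circleMap]; simp [abs_of_pos hρ]
    rw [norm_smul, hder]
    calc ρ * ‖f _‖ ≤ ρ * (M * (d ^ 2)⁻¹) := by gcongr; exact h3
      _ ≤ ρ * (M * (2 * ∑ k ∈ Finset.range 3, g k θ)) := by
        gcongr
        exact inv_max_sq_le hδ hρ hθ.1.le hθ.2 h1 h2
      _ = _ := by ring
  have hgi : ∀ k, IntervalIntegrable (g k) volume 0 (2 * Real.pi) := fun k =>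
    (hg k).intervalIntegrable _ _
  calc _ ≤ ∫ θ in (0)..2 * Real.pi, (2 * M * ρ) * ∑ k ∈ Finset.range 3, g k θ :=
        intervalIntegral.norm_integral_le_of_norm_le (by positivity)
          (Eventually.of_forall hbound)
          (Continuous.intervalIntegrable (by fun_prop) _ _)
    _ = (2 * M * ρ) * ∑ k ∈ Finset.range 3, ∫ θ in (0)..2 * Real.pi, g k θ := by
        rw [intervalIntegral.integral_const_mul,
          intervalIntegral.integral_finsetSum fun k _ => hgi k]
    _ ≤ (2 * M * ρ) * ∑ k ∈ Finset.range 3, Real.pi / (δ * a) := by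
        gcongr with k
        exact integral_inv_sq_add_mul_sq_le hδ ha0 _ _ _
    _ = _ := by
        rw [Finset.sum_const, Finset.card_range, nsmul_eq_mul, ha]
        push_cast
        field_simp

end CircleBound

/-! ### The circles around the points of the spectrum -/

/-- The sequence `λ₁ < λ₂ < …` has gaps larger than `2 r` from the index `i₀ - 1` on. -/
structure HasGaps (lam : ℕ → ℝ) (i₀ : ℕ) (r : ℝ) : Prop where
  strictMonoOn : StrictMonoOn lam (Ici 1)
  two_le : 2 ≤ i₀
  pos : 0 < r
  gap : ∀ i, i₀ ≤ i → 2 * r < lam i - lam (i - 1)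

/-- The radius of the circle that separates `λ₁, …, λ_n` from `λ_{n+1}, …` -/
def separatingRadius (lam : ℕ → ℝ) (i₀ n : ℕ) : ℝ :=
  (lam n + lam (n + 1)) / 2 - circleCenter lam i₀ 0

theorem norm_ofReal_sub_ofReal (x y : ℝ) : ‖(x : ℂ) - (y : ℂ)‖ = |x - y| := by
  rw [← Complex.ofReal_sub, Complex.norm_real, Real.norm_eq_abs]

namespace HasGaps

variable {lam : ℕ → ℝ} {i₀ : ℕ} {r : ℝ}

theorem le (hG : HasGaps lam i₀ r) {i j : ℕ} (hi : 1 ≤ i) (hij : i ≤ j) : lam i ≤ lam j :=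
  hG.strictMonoOn.monotoneOn hi (hi.trans hij) hij

theorem lt (hG : HasGaps lam i₀ r) {i j : ℕ} (hi : 1 ≤ i) (hij : i < j) : lam i < lam j :=
  hG.strictMonoOn hi (hi.trans hij.le) hij

theorem gap_succ (hG : HasGaps lam i₀ r) {n : ℕ} (hn : i₀ ≤ n + 1) :
    2 * r < lam (n + 1) - lam n := by
  simpa using hG.gap (n + 1) hn

theorem circleCenter_zero : circleCenter lam i₀ 0 = (lam 1 + lam (i₀ - 1)) / 2 := if_pos rfl

/-- The centre is the midpoint of `λ₁` and `λ_{i₀-1}`, so among `λ₁, …, λ_n` none is farther from it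
than `λ_n`. -/
theorem abs_sub_center_le (hG : HasGaps lam i₀ r) {n j : ℕ} (hn : i₀ ≤ n + 1) (hj : 1 ≤ j)
    (hjn : j ≤ n) : |lam j - circleCenter lam i₀ 0| ≤ lam n - circleCenter lam i₀ 0 := by
  have h1 := hG.le hj hjn
  have h2 := hG.le le_rfl hj
  have h3 : lam (i₀ - 1) ≤ lam n := hG.le (by have := hG.two_le; omega) (by omega)
  rw [circleCenter_zero, abs_le]
  constructor <;> linarith

theorem le_norm_sub_of_le (hG : HasGaps lam i₀ r) {n j : ℕ} (hn : i₀ ≤ n + 1) (hj : 1 ≤ j)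
    (hjn : j ≤ n) (z : ℂ) : ‖z - (circleCenter lam i₀ 0 : ℂ)‖ - (lam n - circleCenter lam i₀ 0) ≤
      ‖(lam j : ℂ) - z‖ := by
  have h := hG.abs_sub_center_le hn hj hjn
  rw [← norm_ofReal_sub_ofReal] at h
  have h2 := norm_sub_le_norm_sub_add_norm_sub z (lam j : ℂ) (circleCenter lam i₀ 0 : ℂ)
  rw [norm_sub_rev z (lam j : ℂ)] at h2
  linarith

theorem le_norm_sub_of_lt (hG : HasGaps lam i₀ r) {n j : ℕ} (hjn : n + 1 ≤ j) (z : ℂ) :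
    lam (n + 1) - circleCenter lam i₀ 0 - ‖z - (circleCenter lam i₀ 0 : ℂ)‖ ≤
      ‖(lam j : ℂ) - z‖ := by
  have h := hG.le (Nat.le_add_left 1 n) hjn
  have h2 := norm_sub_le_norm_sub_add_norm_sub (lam j : ℂ) z (circleCenter lam i₀ 0 : ℂ)
  rw [norm_ofReal_sub_ofReal] at h2
  have h3 := le_abs_self (lam j - circleCenter lam i₀ 0)
  linarith

/-- The distance to the spectrum between two consecutive eigenvalues. -/
theorem le_norm_sub (hG : HasGaps lam i₀ r) {n : ℕ} (hn : i₀ ≤ n + 1) {z : ℂ} {δ : ℝ}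
    (h1 : δ ≤ ‖z - (circleCenter lam i₀ 0 : ℂ)‖ - (lam n - circleCenter lam i₀ 0))
    (h2 : δ ≤ lam (n + 1) - circleCenter lam i₀ 0 - ‖z - (circleCenter lam i₀ 0 : ℂ)‖)
    {j : ℕ} (hj : 1 ≤ j) : δ ≤ ‖(lam j : ℂ) - z‖ := by
  rcases Nat.lt_or_ge n j with h | h
  · exact h2.trans (hG.le_norm_sub_of_lt h z)
  · exact h1.trans (hG.le_norm_sub_of_le hn hj h z)

/-- The distance to the spectrum near an isolated eigenvalue. -/
theorem le_norm_sub_of_near (hG : HasGaps lam i₀ r) {i : ℕ} {z : ℂ} {δ : ℝ}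
    (h0 : δ ≤ ‖z - (lam i : ℂ)‖) (h1 : ‖z - (lam i : ℂ)‖ ≤ lam i - lam (i - 1) - δ)
    (h2 : ‖z - (lam i : ℂ)‖ ≤ lam (i + 1) - lam i - δ) {j : ℕ} (hj : 1 ≤ j) :
    δ ≤ ‖(lam j : ℂ) - z‖ := by
  have h3 := norm_sub_le_norm_sub_add_norm_sub (lam j : ℂ) z (lam i : ℂ)
  rw [norm_ofReal_sub_ofReal] at h3
  rcases lt_trichotomy j i with h | h | h
  · have h4 := hG.le hj (show j ≤ i - 1 by omega)
    have h5 := neg_abs_le (lam j - lam i)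
    linarith
  · rw [h, norm_sub_rev]; exact h0
  · have h4 := hG.le (show 1 ≤ i + 1 by omega) (show i + 1 ≤ j from h)
    have h5 := le_abs_self (lam j - lam i)
    linarith

theorem le_norm_sub_of_mem_sphere (hG : HasGaps lam i₀ r) {i : ℕ} (hi : i ∈ circleIndex i₀)
    {z : ℂ} (hz : z ∈ Metric.sphere (circleCenter lam i₀ i : ℂ) (circleRadius lam i₀ r i)) {j : ℕ}
    (hj : 1 ≤ j) : r ≤ ‖(lam j : ℂ) - z‖ := by
  have h2 := hG.two_le
  have hz' := norm_sub_of_mem_sphere hz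
  rcases hi with rfl | hi
  · rw [circleRadius, if_pos rfl] at hz'
    have hg := hG.gap_succ (n := i₀ - 1) (by omega)
    refine hG.le_norm_sub (n := i₀ - 1) (by omega) ?_ ?_ hj <;>
    · rw [hz', circleCenter_zero]
      linarith
  · have hi0 : i ≠ 0 := by omega
    rw [circleRadius, if_neg hi0, circleCenter, if_neg hi0] at hz'
    have hg1 := hG.gap i hi
    have hg2 := hG.gap_succ (n := i) (by omega)
    refine hG.le_norm_sub_of_near (i := i) ?_ ?_ ?_ hj <;> rw [hz'] <;> linarith

variable {H : Type*} [NormedAddCommGroup H] [InnerProductSpace ℂ H] {ι : Type*}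
  {A : H →ₗ.[ℂ] H} {b : HilbertBasis ι ℂ H} {Λ : ι → ℝ} {X : H →L[ℂ] H}

theorem tendsto_specProj (hG : HasGaps lam i₀ r) (hΛ : ∀ k, ∃ j, 1 ≤ j ∧ Λ k = lam j) (u : H) :
    Tendsto (fun n => b.specProj {k | Λ k ≤ lam n} u) atTop (𝓝 u) := by
  -- The eigenvalues are numbered from `1`; the shift keeps the meaningless value `lam 0` out.
  let S : ℕ → Set ι := fun j => {k | Λ k = lam (j + 1)}
  have hd : Pairwise (Function.onFun Disjoint S) := by
    intro i j hij
    refine disjoint_left.2 fun k hi hj => hij ?_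
    have : lam (i + 1) = lam (j + 1) := Eq.trans (Eq.symm hi) hj
    have := hG.strictMonoOn.injOn (Nat.le_add_left 1 i) (Nat.le_add_left 1 j) this
    omega
  have hU : ∀ k, ∃ j, k ∈ S j := fun k => by
    obtain ⟨j, hj, hk⟩ := hΛ k
    exact ⟨j - 1, by change Λ k = lam (j - 1 + 1); rw [hk, Nat.sub_add_cancel hj]⟩
  refine (b.hasSum_specProj hd hU u).tendsto_sum_nat.congr' ?_
  filter_upwards [eventually_ge_atTop 1] with n hn
  rw [← _root_.sum_apply, b.sum_specProj _ (hd.set_pairwise _)]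
  congr 2
  ext k
  obtain ⟨j, hj, hk⟩ := hΛ k
  simp only [mem_iUnion, Finset.mem_range, S, mem_ofPred_eq, exists_prop, hk]
  constructor
  · rintro ⟨i, hi, h⟩
    rw [h]
    exact hG.le (by omega) (by omega)
  · intro h
    have : j ≤ n := by
      by_contra! h'
      exact (hG.lt hn h').not_ge h
    exact ⟨j - 1, by omega, by rw [Nat.sub_add_cancel hj]⟩

variable [CompleteSpace H]

/-- The circle `γ₀` expands to the first separating circle without meeting the spectrum. Passing
from one separating circle to the next crosses only the disc around `λ_{n+1}`, which contributes
`Q_{n+1}`. -/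
theorem sum_circleProjection (hG : HasGaps lam i₀ r) (hA : IsDiagonalIn A b Λ)
    (hΛ : ∀ k, ∃ j, 1 ≤ j ∧ Λ k = lam j) (hX : ‖X‖ < r) {n : ℕ} (hn : i₀ - 1 ≤ n) :
    ∑ i ∈ (Finset.range (n + 1)).filter (· ∈ circleIndex i₀),
      circleProjection (addBounded A X) lam i₀ r i =
      rieszProjection (addBounded A X) (circleCenter lam i₀ 0 : ℂ) (separatingRadius lam i₀ n) := by
  have h2 := hG.two_le
  have hr := hG.pos
  induction n, hn using Nat.le_induction with
  | base =>
    have hf : (Finset.range (i₀ - 1 + 1)).filter (· ∈ circleIndex i₀) = {0} := by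
      ext i
      rw [Finset.mem_filter, Finset.mem_range, Finset.mem_singleton]
      change i < i₀ - 1 + 1 ∧ (i = 0 ∨ i₀ ≤ i) ↔ i = 0
      omega
    have hg := hG.gap_succ (n := i₀ - 1) (by omega)
    have hl := hG.le le_rfl (show 1 ≤ i₀ - 1 by omega)
    have hR : circleRadius lam i₀ r 0 = (lam (i₀ - 1) - lam 1) / 2 + r := if_pos rfl
    rw [hf, Finset.sum_singleton, circleProjection]
    refine (hA.rieszProjection_eq ?_ ?_ hX fun z h3 h4 k => ?_).symm
    · rw [hR]; linarith
    · rw [hR, separatingRadius, circleCenter_zero]; linarith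
    · obtain ⟨j, hj, hk⟩ := hΛ k
      rw [hk]
      rw [hR] at h3
      rw [separatingRadius] at h4
      refine hG.le_norm_sub (n := i₀ - 1) (by omega) ?_ ?_ hj
      · rw [circleCenter_zero] at h3 ⊢; linarith
      · linarith
  | succ n hn ih =>
    have hn1 : n + 1 ∈ circleIndex i₀ := Or.inr (by omega)
    rw [Finset.range_add_one, Finset.filter_insert, if_pos hn1, Finset.sum_insert (by simp), ih,
      add_comm]
    -- A hole of radius `s` strictly between `‖X‖` and `r`: outside it the perturbed resolvent
    -- exists, and `γ_{n+1}` surrounds it.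
    obtain ⟨s, hs1, hs2⟩ := exists_between hX
    have hg1 := hG.gap_succ (n := n) (by omega)
    have hg2 := hG.gap_succ (n := n + 1) (by omega)
    have hl := hG.abs_sub_center_le (n := n) (by omega) (by omega) le_rfl
    have hl0 := abs_nonneg (lam n - circleCenter lam i₀ 0)
    have hc : circleCenter lam i₀ (n + 1) = lam (n + 1) := if_neg (by omega)
    have hR : circleRadius lam i₀ r (n + 1) = r := if_neg (by omega)
    rw [circleProjection, hc, hR]
    refine (hA.rieszProjection_eq_add (s := s) ?_ ?_ ((norm_nonneg X).trans_lt hs1) hs2 hs1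
      (fun z hz => ?_) fun z h3 h4 h5 k => ?_).symm
    · rw [separatingRadius]; linarith
    · rw [separatingRadius, separatingRadius]; linarith
    · have e1 := norm_sub_le_norm_sub_add_norm_sub (lam (n + 1) : ℂ) z (circleCenter lam i₀ 0 : ℂ)
      have e2 := norm_sub_le_norm_sub_add_norm_sub z (lam (n + 1) : ℂ) (circleCenter lam i₀ 0 : ℂ)
      have e3 : ‖(lam (n + 1) : ℂ) - (circleCenter lam i₀ 0 : ℂ)‖ =
          lam (n + 1) - circleCenter lam i₀ 0 := by
        rw [norm_ofReal_sub_ofReal, abs_of_nonneg (by linarith)]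
      rw [norm_sub_rev (lam (n + 1) : ℂ) z] at e1
      rw [e3] at e1 e2
      rw [separatingRadius, separatingRadius]
      constructor <;> linarith
    · obtain ⟨j, hj, hk⟩ := hΛ k
      rw [hk]
      rw [separatingRadius] at h3 h4
      rcases lt_trichotomy j (n + 1) with h | h | h
      · refine le_trans ?_ (hG.le_norm_sub_of_le (n := n) (by omega) hj (by omega) z)
        linarith
      · rw [h, norm_sub_rev]; exact h5
      · refine le_trans ?_ (hG.le_norm_sub_of_lt (n := n + 1) h z)
        linarith

theorem setOf_norm_lt_separatingRadius (hG : HasGaps lam i₀ r)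
    (hΛ : ∀ k, ∃ j, 1 ≤ j ∧ Λ k = lam j) {n : ℕ} (hn : i₀ - 1 ≤ n) :
    {k | ‖(Λ k : ℂ) - (circleCenter lam i₀ 0 : ℂ)‖ < separatingRadius lam i₀ n} =
      {k | Λ k ≤ lam n} := by
  have h2 := hG.two_le
  have hlt := hG.lt (show 1 ≤ n by omega) n.lt_succ_self
  ext k
  obtain ⟨j, hj, hk⟩ := hΛ k
  rw [mem_ofPred_eq, mem_ofPred_eq, hk, norm_ofReal_sub_ofReal, separatingRadius]
  rcases Nat.lt_or_ge n j with h | h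
  · have h3 := hG.le (show 1 ≤ n + 1 by omega) h
    have h4 := le_abs_self (lam j - circleCenter lam i₀ 0)
    exact ⟨fun h' => by linarith, fun h' => by linarith⟩
  · have h3 := hG.abs_sub_center_le (n := n) (by omega) hj h
    exact ⟨fun _ => hG.le hj h, fun _ => by linarith⟩

/-- On the separating circle the distance to the real spectrum is at least `max δ |Im z|`, with `δ`
half the gap; the radius-free circle estimate applies to the perturbation term. -/
theorem norm_sub_specProj_le (hG : HasGaps lam i₀ r) (hA : IsDiagonalIn A b Λ)
    (hΛ : ∀ k, ∃ j, 1 ≤ j ∧ Λ k = lam j) {n : ℕ} (hn : i₀ - 1 ≤ n)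
    (hX : 2 * ‖X‖ ≤ (lam (n + 1) - lam n) / 2) :
    ‖rieszProjection (addBounded A X) (circleCenter lam i₀ 0 : ℂ) (separatingRadius lam i₀ n) -
      b.specProj {k | Λ k ≤ lam n}‖ ≤
        3 * Real.pi * ‖X‖ / ((lam (n + 1) - lam n) / 2) := by
  have h2 := hG.two_le
  have hlt := hG.lt (show 1 ≤ n by omega) n.lt_succ_self
  have hl := (abs_nonneg _).trans (hG.abs_sub_center_le (n := n) (by omega) (by omega) le_rfl)
  set δ := (lam (n + 1) - lam n) / 2 with hδ
  have hδ0 : 0 < δ := by rw [hδ]; linarith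
  have hρ : 0 < separatingRadius lam i₀ n := by rw [separatingRadius]; linarith
  have hdist : ∀ z ∈ Metric.sphere (circleCenter lam i₀ 0 : ℂ) (separatingRadius lam i₀ n), ∀ k,
      δ ≤ ‖(Λ k : ℂ) - z‖ := by
    intro z hz k
    obtain ⟨j, hj, hk⟩ := hΛ k
    have hz' := norm_sub_of_mem_sphere hz
    rw [separatingRadius] at hz'
    rw [hk]
    refine hG.le_norm_sub (n := n) (by omega) ?_ ?_ hj <;> rw [hz', hδ] <;> linarith
  have hXδ : ‖X‖ < δ := by
    rcases (norm_nonneg X).eq_or_lt with h | h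
    · rwa [← h]
    · linarith
  have hπ := Real.pi_pos
  rw [← hG.setOf_norm_lt_separatingRadius hΛ hn,
    hA.rieszProjection_sub_specProj hρ.le hXδ hdist, norm_smul]
  have hnorm : ‖(2 * Real.pi * Complex.I : ℂ)⁻¹‖ = (2 * Real.pi)⁻¹ := by simp [hπ.le]
  rw [hnorm]
  have hint := norm_circleIntegral_le_of_norm_le_inv_sq (M := 2 * ‖X‖)
    (f := fun z => unbResolvent (addBounded A X) z * X * diagResolvent b Λ z)
    (c := circleCenter lam i₀ 0) hδ0 hρ (by positivity) fun z hz =>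
    ⟨max δ |z.im|, le_max_left _ _, le_max_right _ _,
      hA.norm_resolvent_mul_le (lt_max_of_lt_left hδ0) (hX.trans (le_max_left _ _)) fun k =>
        max_le (hdist z hz k) (by simpa using Complex.abs_im_le_norm ((Λ k : ℂ) - z))⟩
  calc _ ≤ (2 * Real.pi)⁻¹ * (3 * Real.pi ^ 2 * (2 * ‖X‖) / δ) := by gcongr
    _ = _ := by field_simp

/-- The Riesz projections of the perturbed operator over the circles sum up to the identity. -/
theorem tendsto_sum_circleProjection (hG : HasGaps lam i₀ r) (hA : IsDiagonalIn A b Λ)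
    (hΛ : ∀ k, ∃ j, 1 ≤ j ∧ Λ k = lam j) (hX : ‖X‖ < r)
    (hgap : Tendsto (fun i => lam (i + 1) - lam i) atTop atTop) (u : H) :
    Tendsto (fun n : ℕ => ∑ i ∈ (Finset.range (n + 1)).filter (· ∈ circleIndex i₀),
      circleProjection (addBounded A X) lam i₀ r i u) atTop (𝓝 u) := by
  have hδ : Tendsto (fun i => (lam (i + 1) - lam i) / 2) atTop atTop :=
    hgap.atTop_div_const two_pos
  rw [← tendsto_sub_nhds_zero_iff]
  have h1 := (tendsto_sub_nhds_zero_iff.2 (hG.tendsto_specProj (b := b) hΛ u)).norm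
  have h2 := (hδ.const_div_atTop (3 * Real.pi * ‖X‖)).mul_const ‖u‖
  have h3 := h2.add h1
  rw [norm_zero, zero_mul, zero_add] at h3
  refine squeeze_zero_norm' ?_ h3
  filter_upwards [eventually_ge_atTop (i₀ - 1), hδ.eventually_ge_atTop (2 * ‖X‖)] with n hn hXn
  rw [← _root_.sum_apply, hG.sum_circleProjection hA hΛ hX hn]
  refine (norm_sub_le_norm_sub_add_norm_sub _ (b.specProj {k | Λ k ≤ lam n} u) _).trans ?_
  gcongr
  rw [← _root_.sub_apply]
  exact (ContinuousLinearMap.le_opNorm _ _).trans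
    (by gcongr; exact hG.norm_sub_specProj_le hA hΛ hn hXn)

end HasGaps

/-! ### Riesz projections at an isolated eigenvalue -/

section Isolated

variable {H : Type*} [NormedAddCommGroup H] [InnerProductSpace ℂ H] {ι : Type*}
  {b : HilbertBasis ι ℂ H} {Λ : ι → ℝ} {c ρ : ℝ}

open Classical in
/-- The reduced resolvent at the eigenvalue `c`. -/
def reducedResolvent (b : HilbertBasis ι ℂ H) (Λ : ι → ℝ) (c : ℝ) (z : ℂ) : H →L[ℂ] H :=
  b.diag fun k => if Λ k = c then 0 else ((Λ k : ℂ) - z)⁻¹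

theorem norm_reduced_le {δ : ℝ} {z : ℂ} (hδ : 0 < δ) (h : ∀ k, Λ k ≠ c → δ ≤ ‖(Λ k : ℂ) - z‖)
    [∀ k, Decidable (Λ k = c)] (k : ι) :
    ‖if Λ k = c then 0 else ((Λ k : ℂ) - z)⁻¹‖ ≤ δ⁻¹ := by
  split_ifs with hk
  · rw [norm_zero]; positivity
  · rw [norm_inv]; exact inv_anti₀ hδ (h k hk)

theorem norm_reducedResolvent_le {δ : ℝ} {z : ℂ} (hδ : 0 < δ)
    (h : ∀ k, Λ k ≠ c → δ ≤ ‖(Λ k : ℂ) - z‖) : ‖reducedResolvent b Λ c z‖ ≤ δ⁻¹ :=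
  b.norm_diag_le (by positivity) (norm_reduced_le hδ h)

theorem reducedResolvent_basis_of_eq {δ : ℝ} {z : ℂ} (hδ : 0 < δ)
    (h : ∀ k, Λ k ≠ c → δ ≤ ‖(Λ k : ℂ) - z‖) {k : ι} (hk : Λ k = c) :
    reducedResolvent b Λ c z (b k) = 0 := by
  rw [reducedResolvent, b.diag_apply_basis (norm_reduced_le hδ h), if_pos hk, zero_smul]

theorem reducedResolvent_basis_of_ne {δ : ℝ} {z : ℂ} (hδ : 0 < δ)
    (h : ∀ k, Λ k ≠ c → δ ≤ ‖(Λ k : ℂ) - z‖) {k : ι} (hk : Λ k ≠ c) :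
    reducedResolvent b Λ c z (b k) = ((Λ k : ℂ) - z)⁻¹ • b k := by
  rw [reducedResolvent, b.diag_apply_basis (norm_reduced_le hδ h), if_neg hk]

theorem le_norm_sub_of_isolated (h : ∀ k, Λ k ≠ c → 2 * ρ ≤ |Λ k - c|) {z : ℂ} {k : ι}
    (hk : Λ k ≠ c) : 2 * ρ - ‖z - (c : ℂ)‖ ≤ ‖(Λ k : ℂ) - z‖ := by
  have h1 := h k hk
  have h2 := norm_sub_le_norm_sub_add_norm_sub (Λ k : ℂ) z (c : ℂ)
  rw [norm_ofReal_sub_ofReal] at h2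
  linarith

/-- With the eigenvalue `c` removed, all others have distance at least `2ρ` from `c`, so nothing is
singular in the closed disc of radius `ρ`. -/
theorem hasDerivAt_reducedResolvent (hρ : 0 < ρ) (h : ∀ k, Λ k ≠ c → 2 * ρ ≤ |Λ k - c|) {z : ℂ}
    (hz : z ∈ Metric.closedBall (c : ℂ) ρ) : HasDerivAt (reducedResolvent b Λ c)
      (reducedResolvent b Λ c z * reducedResolvent b Λ c z) z := by
  have hd : ∀ w, ‖w - (c : ℂ)‖ < 3 / 2 * ρ → ∀ k, Λ k ≠ c → ρ / 2 ≤ ‖(Λ k : ℂ) - w‖ :=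
    fun w hw k hk => by linarith [le_norm_sub_of_isolated (z := w) h hk]
  rw [Metric.mem_closedBall, dist_eq_norm] at hz
  have hz' : ‖z - (c : ℂ)‖ < 3 / 2 * ρ := by linarith
  have hρ2 : 0 < ρ / 2 := by positivity
  refine hasDerivAt_of_resolvent_identity (C := (ρ / 2)⁻¹) ?_
  have hc : ContinuousAt (fun w => ‖w - (c : ℂ)‖) z := by fun_prop
  filter_upwards [hc.eventually (gt_mem_nhds hz')] with w hw
  refine ⟨norm_reducedResolvent_le hρ2 (hd w hw), b.ext_clm fun k => ?_⟩
  rw [_root_.sub_apply, _root_.smul_apply, mul_apply_eq_comp]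
  by_cases hk : Λ k = c
  · rw [reducedResolvent_basis_of_eq hρ2 (hd w hw) hk,
      reducedResolvent_basis_of_eq hρ2 (hd z hz') hk,
      map_zero, smul_zero, sub_zero]
  · have hne : ∀ w, ‖w - (c : ℂ)‖ < 3 / 2 * ρ → (Λ k : ℂ) - w ≠ 0 := fun w hw e => by
      have := hd w hw k hk
      rw [e, norm_zero] at this
      linarith
    have h1 := hne w hw
    have h2 := hne z hz'
    rw [reducedResolvent_basis_of_ne hρ2 (hd z hz') hk, map_smul,
      reducedResolvent_basis_of_ne hρ2 (hd w hw) hk, smul_smul, smul_smul, ← sub_smul]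
    congr 1
    field_simp
    ring

variable {A : H →ₗ.[ℂ] H}

theorem le_norm_sub_of_mem_sphere_of_isolated
    (h : ∀ k, Λ k ≠ c → 2 * ρ ≤ |Λ k - c|) {z : ℂ} (hz : z ∈ Metric.sphere (c : ℂ) ρ) (k : ι) :
    ρ ≤ ‖(Λ k : ℂ) - z‖ := by
  have hz' := norm_sub_of_mem_sphere hz
  by_cases hk : Λ k = c
  · rw [hk, norm_sub_rev, hz']
  · linarith [le_norm_sub_of_isolated (z := z) h hk]

theorem one_sub_specProj_mul_diagResolvent (hρ : 0 < ρ)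
    (h : ∀ k, Λ k ≠ c → 2 * ρ ≤ |Λ k - c|) {z : ℂ} (hz : z ∈ Metric.sphere (c : ℂ) ρ) :
    (1 - b.specProj {k | Λ k = c}) * diagResolvent b Λ z = reducedResolvent b Λ c z ∧
      diagResolvent b Λ z * (1 - b.specProj {k | Λ k = c}) = reducedResolvent b Λ c z := by
  have hd := le_norm_sub_of_mem_sphere_of_isolated h hz
  have hP : ∀ k, Λ k = c → (1 - b.specProj {k | Λ k = c}) (b k) = 0 := fun k hk => by
    rw [_root_.sub_apply, one_apply_eq_self,
      b.specProj_basis_of_mem (show k ∈ {k | Λ k = c} from hk), sub_self]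
  have hP' : ∀ k, Λ k ≠ c → (1 - b.specProj {k | Λ k = c}) (b k) = b k := fun k hk => by
    rw [_root_.sub_apply, one_apply_eq_self,
      b.specProj_basis_of_notMem (show k ∉ {k | Λ k = c} from hk), sub_zero]
  constructor <;> refine b.ext_clm fun k => ?_ <;> rw [mul_apply_eq_comp] <;>
    by_cases hk : Λ k = c
  · rw [diagResolvent_basis hρ hd, map_smul, hP k hk, smul_zero,
      reducedResolvent_basis_of_eq hρ (fun k _ => hd k) hk]
  · rw [diagResolvent_basis hρ hd, map_smul, hP' k hk,
      reducedResolvent_basis_of_ne hρ (fun k _ => hd k) hk]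
  · rw [hP k hk, map_zero, reducedResolvent_basis_of_eq hρ (fun k _ => hd k) hk]
  · rw [hP' k hk, diagResolvent_basis hρ hd, reducedResolvent_basis_of_ne hρ (fun k _ => hd k) hk]

variable [CompleteSpace H] {X : H →L[ℂ] H}

theorem circleIntegral_mul_mul {f : ℂ → H →L[ℂ] H} {c : ℂ} {ρ : ℝ} (hf : CircleIntegrable f c ρ)
    (L M : H →L[ℂ] H) : L * (∮ z in C(c, ρ), f z) * M = ∮ z in C(c, ρ), L * f z * M := by
  let Φ : (H →L[ℂ] H) →L[ℂ] (H →L[ℂ] H) :=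
    ((ContinuousLinearMap.mul ℂ (H →L[ℂ] H)).flip M).comp (ContinuousLinearMap.mul ℂ (H →L[ℂ] H) L)
  have := Φ.intervalIntegral_comp_comm hf.out
  rw [circleIntegral, circleIntegral]
  refine this.symm.trans (intervalIntegral.integral_congr fun θ _ => ?_)
  exact map_smul Φ _ _

/-- With `P' = 1 - P`, the identity `T = D - D X T` gives `P' T = R - R X T`, where `R` is the
reduced resolvent. The term `R X R` is holomorphic inside the circle and integrates to zero, leaving
a term quadratic in `X`. -/
theorem IsDiagonalIn.compression_resolvent (hA : IsDiagonalIn A b Λ) (hρ : 0 < ρ)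
    (h : ∀ k, Λ k ≠ c → 2 * ρ ≤ |Λ k - c|) (hX : ‖X‖ < ρ) {z : ℂ}
    (hz : z ∈ Metric.sphere (c : ℂ) ρ) :
    (1 - b.specProj {k | Λ k = c}) *
        (unbResolvent (addBounded A X) z * X * diagResolvent b Λ z) *
        (1 - b.specProj {k | Λ k = c}) =
      reducedResolvent b Λ c z * X * reducedResolvent b Λ c z -
        reducedResolvent b Λ c z * X * unbResolvent (addBounded A X) z * X *
          reducedResolvent b Λ c z := by
  obtain ⟨e1, e2⟩ := one_sub_specProj_mul_diagResolvent (b := b) hρ h hz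
  have e3 := hA.resolvent_sub' hX (le_norm_sub_of_mem_sphere_of_isolated h hz)
  generalize unbResolvent (addBounded A X) z = T at e3 ⊢
  generalize diagResolvent b Λ z = D at e1 e2 e3 ⊢
  generalize reducedResolvent b Λ c z = R at e1 e2 ⊢
  generalize (1 - b.specProj {k | Λ k = c}) = P at e1 e2 ⊢
  have e4 : P * T = R - R * X * T := by
    rw [← e1, mul_assoc P D X, mul_assoc P (D * X) T, ← mul_sub, sub_eq_add_neg D, ← e3,
      add_sub_cancel]
  calc _ = P * T * X * (D * P) := by simp only [mul_assoc]
    _ = (R - R * X * T) * X * R := by rw [e4, e2]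
    _ = _ := by simp only [sub_mul]

theorem circleIntegral_reducedResolvent_mul_mul (hρ : 0 < ρ)
    (h : ∀ k, Λ k ≠ c → 2 * ρ ≤ |Λ k - c|) (X : H →L[ℂ] H) :
    (∮ z in C((c : ℂ), ρ), reducedResolvent b Λ c z * X * reducedResolvent b Λ c z) = 0 := by
  have hd : ∀ z ∈ Metric.closedBall (c : ℂ) ρ, DifferentiableAt ℂ
      (fun z => reducedResolvent b Λ c z * X * reducedResolvent b Λ c z) z := fun z hz =>
    have := (hasDerivAt_reducedResolvent (b := b) hρ h hz).differentiableAt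
    (this.mul_const X).mul this
  exact Complex.circleIntegral_eq_zero_of_differentiable_on_off_countable hρ.le countable_empty
    (fun w hw => (hd w hw).continuousAt.continuousWithinAt)
    fun w hw => hd w (Metric.ball_subset_closedBall hw.1)

theorem setOf_norm_lt_of_isolated (hρ : 0 < ρ) (h : ∀ k, Λ k ≠ c → 2 * ρ ≤ |Λ k - c|) :
    {k | ‖(Λ k : ℂ) - (c : ℂ)‖ < ρ} = {k | Λ k = c} := by
  ext k
  rw [mem_ofPred_eq, mem_ofPred_eq, norm_ofReal_sub_ofReal]
  refine ⟨fun h' => by_contra fun hk => ?_, fun h' => by rwa [h', sub_self, abs_zero]⟩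
  linarith [h k hk]

theorem IsDiagonalIn.compression_rieszProjection (hA : IsDiagonalIn A b Λ) (hρ : 0 < ρ)
    (h : ∀ k, Λ k ≠ c → 2 * ρ ≤ |Λ k - c|) (hX : ‖X‖ < ρ) :
    (1 - b.specProj {k | Λ k = c}) * (rieszProjection (addBounded A X) c ρ -
      b.specProj {k | Λ k = c}) * (1 - b.specProj {k | Λ k = c}) =
    -((2 * Real.pi * Complex.I : ℂ)⁻¹ • ∮ z in C((c : ℂ), ρ),
      reducedResolvent b Λ c z * X * unbResolvent (addBounded A X) z * X *
        reducedResolvent b Λ c z) := by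
  have hd : ∀ z ∈ Metric.sphere (c : ℂ) ρ, ∀ k, ρ ≤ ‖(Λ k : ℂ) - z‖ := fun z hz =>
    le_norm_sub_of_mem_sphere_of_isolated h hz
  have hRc : ContinuousOn (reducedResolvent b Λ c) (Metric.sphere (c : ℂ) ρ) := by
    intro z hz
    have hz' : z ∈ Metric.closedBall (c : ℂ) ρ := Metric.sphere_subset_closedBall hz
    exact (hasDerivAt_reducedResolvent (b := b) hρ h hz').continuousAt.continuousWithinAt
  have hTc : ContinuousOn (unbResolvent (addBounded A X)) (Metric.sphere (c : ℂ) ρ) :=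
    hA.continuousOn_resolvent hX hd
  have hi1 : CircleIntegrable (fun z => unbResolvent (addBounded A X) z * X * diagResolvent b Λ z)
      (c : ℂ) ρ := 
    ContinuousOn.circleIntegrable hρ.le ((hTc.mul continuousOn_const).mul
      (hA.continuousOn_diagResolvent hρ hd))
  have hi2 : CircleIntegrable (fun z => reducedResolvent b Λ c z * X * reducedResolvent b Λ c z)
      (c : ℂ) ρ := 
    ContinuousOn.circleIntegrable hρ.le ((hRc.mul continuousOn_const).mul hRc)
  have hi3 : CircleIntegrable (fun z => reducedResolvent b Λ c z * X *
      unbResolvent (addBounded A X) z * X * reducedResolvent b Λ c z) (c : ℂ) ρ :=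
    ContinuousOn.circleIntegrable hρ.le
      ((((hRc.mul continuousOn_const).mul hTc).mul continuousOn_const).mul hRc)
  have h1 := hA.rieszProjection_sub_specProj hρ.le hX hd
  rw [setOf_norm_lt_of_isolated hρ h] at h1
  have h2 : (∮ z in C((c : ℂ), ρ), (1 - b.specProj {k | Λ k = c}) *
      (unbResolvent (addBounded A X) z * X * diagResolvent b Λ z) *
      (1 - b.specProj {k | Λ k = c})) =
      -∮ z in C((c : ℂ), ρ), reducedResolvent b Λ c z * X * unbResolvent (addBounded A X) z * X *
        reducedResolvent b Λ c z := by
    rw [← zero_sub, ← circleIntegral_reducedResolvent_mul_mul (b := b) hρ h X,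
      ← circleIntegral.integral_sub hi2 hi3]
    exact circleIntegral.integral_congr hρ.le fun z hz => hA.compression_resolvent hρ h hX hz
  have h3 : ∀ (k : ℂ) (L I M : H →L[ℂ] H), L * (k • I) * M = k • (L * I * M) := fun k L I M => by
    rw [mul_smul_comm, smul_mul_assoc]
  rw [h1, h3, circleIntegral_mul_mul hi1, h2, smul_neg]

theorem IsDiagonalIn.norm_compression_le (hA : IsDiagonalIn A b Λ) (hρ : 0 < ρ)
    (h : ∀ k, Λ k ≠ c → 2 * ρ ≤ |Λ k - c|) (hX : 2 * ‖X‖ ≤ ρ) :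
    ‖(1 - b.specProj {k | Λ k = c}) * (rieszProjection (addBounded A X) c ρ -
      b.specProj {k | Λ k = c}) * (1 - b.specProj {k | Λ k = c})‖ ≤ 2 * ‖X‖ ^ 2 / ρ ^ 2 := by
  have hXρ : ‖X‖ < ρ := by linarith [norm_nonneg X]
  rw [hA.compression_rieszProjection hρ h hXρ, norm_neg]
  refine (circleIntegral.norm_two_pi_i_inv_smul_integral_le_of_norm_le_const hρ.le
    (C := ρ⁻¹ * ‖X‖ * (2 / ρ) * ‖X‖ * ρ⁻¹) fun z hz => ?_).trans_eq (by field_simp)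
  have hd := le_norm_sub_of_mem_sphere_of_isolated h hz
  have hRn : ‖reducedResolvent b Λ c z‖ ≤ ρ⁻¹ := norm_reducedResolvent_le hρ fun k _ => hd k
  have hTn : ‖unbResolvent (addBounded A X) z‖ ≤ 2 / ρ := by
    refine (hA.norm_resolvent_le hXρ hd).trans ?_
    rw [inv_le_comm₀ (by linarith) (by positivity), inv_div]
    linarith
  generalize unbResolvent (addBounded A X) z = T at hTn ⊢
  generalize reducedResolvent b Λ c z = R at hRn ⊢
  calc ‖R * X * T * X * R‖ ≤ ‖R‖ * ‖X‖ * ‖T‖ * ‖X‖ * ‖R‖ := by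
        refine (norm_mul_le _ _).trans ?_
        gcongr
        refine (norm_mul_le _ _).trans ?_
        gcongr
        refine (norm_mul_le _ _).trans ?_
        gcongr
        exact norm_mul_le _ _
    _ ≤ _ := by gcongr

theorem IsDiagonalIn.norm_rieszProjection_sub_specProj_le_of_isolated (hA : IsDiagonalIn A b Λ)
    (hρ : 0 < ρ) (h : ∀ k, Λ k ≠ c → 2 * ρ ≤ |Λ k - c|) (hX : 2 * ‖X‖ ≤ ρ) :
    ‖rieszProjection (addBounded A X) c ρ - b.specProj {k | Λ k = c}‖ ≤ 2 * ‖X‖ / ρ := by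
  rw [← setOf_norm_lt_of_isolated hρ h]
  exact hA.norm_rieszProjection_sub_specProj_le hρ hX fun z hz =>
    le_norm_sub_of_mem_sphere_of_isolated h hz

end Isolated

/-! ### Summable families of almost orthogonal operators -/

section AlmostOrthogonal

variable {H : Type*} [NormedAddCommGroup H] [InnerProductSpace ℂ H] {ι κ : Type*}

theorem sum_norm_sq_specProj_le (b : HilbertBasis ι ℂ H) (I : Finset κ) {S : κ → Set ι}
    (hd : (I : Set κ).PairwiseDisjoint S) (u : H) :
    ∑ i ∈ I, ‖b.specProj (S i) u‖ ^ 2 ≤ ‖u‖ ^ 2 := by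
  rw [← HilbertBasis.norm_sq_sum_of_orthogonal I fun i hi j hj hij =>
      b.inner_specProj_specProj (hd hi hj hij) u u, ← _root_.sum_apply, b.sum_specProj I hd]
  gcongr
  exact ((b.specProj _).le_opNorm u).trans
    (mul_le_of_le_one_left (norm_nonneg u) (b.norm_specProj_le _))

/-- Split `N = P N + (1 - P) N P + (1 - P) N (1 - P)`. The first parts have orthogonal ranges; the
second are summed by Cauchy–Schwarz and Bessel for `‖P_i u‖`; the third are of size `a_i²` and sum
absolutely. -/
theorem norm_sum_le_of_specProj (b : HilbertBasis ι ℂ H) (I : Finset κ) {S : κ → Set ι}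
    (hd : (I : Set κ).PairwiseDisjoint S) {N : κ → H →L[ℂ] H} {a : κ → ℝ}
    (hN : ∀ i ∈ I, ‖N i‖ ≤ a i)
    (hN' : ∀ i ∈ I, ‖(1 - b.specProj (S i)) * N i * (1 - b.specProj (S i))‖ ≤ a i ^ 2) :
    ‖∑ i ∈ I, N i‖ ≤ 2 * √(∑ i ∈ I, a i ^ 2) + ∑ i ∈ I, a i ^ 2 := by
  have hs : 0 ≤ ∑ i ∈ I, a i ^ 2 := Finset.sum_nonneg fun i _ => sq_nonneg _
  refine ContinuousLinearMap.opNorm_le_bound _ (by positivity) fun u => ?_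
  let P : κ → H →L[ℂ] H := fun i => b.specProj (S i)
  have hsplit : ∀ i, N i u = P i (N i u) + (1 - P i) (N i (P i u)) +
      ((1 - P i) * N i * (1 - P i)) u := fun i => by
    simp only [mul_apply_eq_comp, _root_.sub_apply, one_apply_eq_self, map_sub]
    abel
  have h1 : ‖∑ i ∈ I, P i (N i u)‖ ≤ √(∑ i ∈ I, a i ^ 2) * ‖u‖ := by
    rw [← Real.sqrt_sq (norm_nonneg u), ← Real.sqrt_mul hs]
    refine Real.le_sqrt_of_sq_le ?_
    rw [HilbertBasis.norm_sq_sum_of_orthogonal I fun i hi j hj hij =>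
      b.inner_specProj_specProj (hd hi hj hij) _ _, Finset.sum_mul]
    refine Finset.sum_le_sum fun i hi => ?_
    rw [← mul_pow]
    gcongr
    calc ‖P i (N i u)‖ ≤ 1 * ‖N i u‖ :=
          ((P i).le_opNorm _).trans (by gcongr; exact b.norm_specProj_le _)
      _ ≤ a i * ‖u‖ := by
        rw [one_mul]
        exact ((N i).le_opNorm u).trans (by gcongr; exact hN i hi)
  have h2 : ‖∑ i ∈ I, (1 - P i) (N i (P i u))‖ ≤ √(∑ i ∈ I, a i ^ 2) * ‖u‖ := by
    calc _ ≤ ∑ i ∈ I, a i * ‖P i u‖ := by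
          refine norm_sum_le_of_le _ fun i hi => ?_
          refine ((1 - P i).le_opNorm _).trans ?_
          refine (mul_le_of_le_one_left (norm_nonneg _) (b.norm_one_sub_specProj_le _)).trans ?_
          exact ((N i).le_opNorm _).trans (by gcongr; exact hN i hi)
      _ ≤ √(∑ i ∈ I, a i ^ 2) * √(∑ i ∈ I, ‖P i u‖ ^ 2) := Real.sum_mul_le_sqrt_mul_sqrt _ _ _
      _ ≤ _ := by
        gcongr
        exact Real.sqrt_le_iff.2 ⟨norm_nonneg u, sum_norm_sq_specProj_le b I hd u⟩
  have h3 : ‖∑ i ∈ I, ((1 - P i) * N i * (1 - P i)) u‖ ≤ (∑ i ∈ I, a i ^ 2) * ‖u‖ := by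
    rw [Finset.sum_mul]
    refine norm_sum_le_of_le _ fun i hi => ?_
    exact (ContinuousLinearMap.le_opNorm _ _).trans (by gcongr; exact hN' i hi)
  rw [_root_.sum_apply, Finset.sum_congr rfl fun i _ => hsplit i, Finset.sum_add_distrib,
    Finset.sum_add_distrib]
  refine (norm_add₃_le).trans ?_
  linarith

theorem summable_of_specProj [CompleteSpace H] (b : HilbertBasis ι ℂ H) {S : ℕ → Set ι} {m : ℕ}
    (hd : (Ici m).PairwiseDisjoint S) {N : ℕ → H →L[ℂ] H} {a : ℕ → ℝ}
    (hN : ∀ i, m ≤ i → ‖N i‖ ≤ a i)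
    (hN' : ∀ i, m ≤ i → ‖(1 - b.specProj (S i)) * N i * (1 - b.specProj (S i))‖ ≤ a i ^ 2)
    (hs : Summable fun i => a i ^ 2) : Summable N := by
  rw [summable_iff_vanishing_norm]
  intro ε hε
  -- With `m = min ε 1` the bound becomes `2 · m/4 + m/16 < ε`.
  set η := (min ε 1 / 4) ^ 2 with hη
  have hm : 0 < min ε 1 := lt_min hε one_pos
  obtain ⟨s, hs⟩ := summable_iff_vanishing_norm.1 hs η (by positivity)
  -- The estimates hold only from the index `m` on; the finitely many earlier terms are put into the
  -- exceptional set.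
  refine ⟨s ∪ Finset.range m, fun t ht => ?_⟩
  rw [Finset.disjoint_union_right] at ht
  have htm : ∀ i ∈ t, m ≤ i := fun i hi => by
    by_contra! h
    exact Finset.disjoint_left.1 ht.2 hi (Finset.mem_range.2 h)
  have h1 := hs t ht.1
  have h0 : 0 ≤ ∑ i ∈ t, a i ^ 2 := Finset.sum_nonneg fun i _ => sq_nonneg _
  rw [Real.norm_of_nonneg h0] at h1
  have h2 : √(∑ i ∈ t, a i ^ 2) ≤ min ε 1 / 4 := Real.sqrt_le_iff.2 ⟨by positivity, h1.le⟩
  have h3 : η ≤ min ε 1 / 16 := by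
    rw [hη]
    nlinarith [min_le_right ε 1]
  have h4 := min_le_left ε 1
  refine (norm_sum_le_of_specProj b t (fun i hi j hj => hd (htm i hi) (htm j hj))
    (fun i hi => hN i (htm i hi))
    fun i hi => hN' i (htm i hi)).trans_lt ?_
  linarith

theorem Summable.exists_norm_sum_le {E : Type*} [NormedAddCommGroup E] [CompleteSpace E]
    {f : κ → E} (hf : Summable f) : ∃ C, ∀ I : Finset κ, ‖∑ i ∈ I, f i‖ ≤ C := by
  classical
  obtain ⟨s, hs⟩ := summable_iff_vanishing_norm.1 hf 1 one_pos
  refine ⟨∑ i ∈ s, ‖f i‖ + 1, fun I => ?_⟩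
  rw [← Finset.sum_inter_add_sum_sdiff I s f]
  refine (norm_add_le _ _).trans (add_le_add ?_ (hs _ Finset.sdiff_disjoint).le)
  exact (norm_sum_le _ _).trans (Finset.sum_le_sum_of_subset_of_nonneg Finset.inter_subset_right
    fun _ _ _ => norm_nonneg _)

end AlmostOrthogonal

/-! ### Unconditional convergence of the Riesz projections -/

namespace HasGaps

variable {lam : ℕ → ℝ} {i₀ : ℕ} {r : ℝ} {ι : Type*} {Λ : ι → ℝ}

/-- The indices of the eigenvalues inside the `i`-th circle. -/
def eigenSet (Λ : ι → ℝ) (lam : ℕ → ℝ) (i₀ i : ℕ) : Set ι :=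
  if i = 0 then {k | Λ k ≤ lam (i₀ - 1)} else {k | Λ k = lam i}

theorem disjoint_eigenSet (hG : HasGaps lam i₀ r) {i j : ℕ} (hi : i ∈ circleIndex i₀)
    (hj : j ∈ circleIndex i₀) (hij : i ≠ j) :
    Disjoint (eigenSet Λ lam i₀ i) (eigenSet Λ lam i₀ j) := by
  have h2 := hG.two_le
  have hlt : ∀ i, i₀ ≤ i → lam (i₀ - 1) < lam i := fun i hi => hG.lt (by omega) (by omega)
  rw [disjoint_left, eigenSet, eigenSet]
  rcases hi with rfl | hi <;> rcases hj with rfl | hj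
  · exact absurd rfl hij
  · rw [if_pos rfl, if_neg (by omega)]
    intro k h3 h4
    have h3 : Λ k ≤ lam (i₀ - 1) := h3
    have h4 : Λ k = lam j := h4
    linarith [hlt j hj]
  · rw [if_pos rfl, if_neg (by omega)]
    intro k h3 h4
    have h3 : Λ k = lam i := h3
    have h4 : Λ k ≤ lam (i₀ - 1) := h4
    linarith [hlt i hi]
  · rw [if_neg (by omega), if_neg (by omega)]
    intro k h3 h4
    have h5 : lam i = lam j := Eq.trans (Eq.symm h3) h4
    exact hij (hG.strictMonoOn.injOn (show 1 ≤ i by omega) (show 1 ≤ j by omega) h5)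

theorem exists_mem_eigenSet (hG : HasGaps lam i₀ r) (hΛ : ∀ k, ∃ j, 1 ≤ j ∧ Λ k = lam j) (k : ι) :
    ∃ i : circleIndex i₀, k ∈ eigenSet Λ lam i₀ i := by
  obtain ⟨j, hj, hk⟩ := hΛ k
  rcases Nat.lt_or_ge j i₀ with h | h
  · refine ⟨⟨0, Or.inl rfl⟩, ?_⟩
    change k ∈ eigenSet Λ lam i₀ 0
    rw [eigenSet, if_pos rfl]
    exact hk.trans_le (hG.le hj (by omega))
  · refine ⟨⟨j, Or.inr h⟩, ?_⟩
    change k ∈ eigenSet Λ lam i₀ j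
    rw [eigenSet, if_neg (by omega)]
    exact hk

variable {H : Type*} [NormedAddCommGroup H] [InnerProductSpace ℂ H] [CompleteSpace H]
  {A : H →ₗ.[ℂ] H} {b : HilbertBasis ι ℂ H} {X : H →L[ℂ] H}

/-- Half the distance of `λ_i` to the neighbouring eigenvalues. -/
def halfGap (lam : ℕ → ℝ) (i : ℕ) : ℝ := min (lam i - lam (i - 1)) (lam (i + 1) - lam i) / 2

/-- Between radius `r` and half the gap no point is closer than `r` to the spectrum, so the circle
may be enlarged. The estimates then improve as the gaps grow, instead of being stuck at the fixed
`r`. -/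
theorem circleProjection_eq (hG : HasGaps lam i₀ r) (hA : IsDiagonalIn A b Λ)
    (hΛ : ∀ k, ∃ j, 1 ≤ j ∧ Λ k = lam j) (hX : ‖X‖ < r) {i : ℕ} (hi : i₀ ≤ i) :
    circleProjection (addBounded A X) lam i₀ r i =
      rieszProjection (addBounded A X) (lam i : ℂ) (halfGap lam i) := by
  have h2 := hG.two_le
  have hg1 := hG.gap i hi
  have hg2 := hG.gap_succ (n := i) (by omega)
  have hm1 := min_le_left (lam i - lam (i - 1)) (lam (i + 1) - lam i)
  have hm2 := min_le_right (lam i - lam (i - 1)) (lam (i + 1) - lam i)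
  have hm := lt_min hg1 hg2
  have hc : circleCenter lam i₀ i = lam i := if_neg (by omega)
  have hR : circleRadius lam i₀ r i = r := if_neg (by omega)
  rw [circleProjection, hc, hR]
  refine (hA.rieszProjection_eq hG.pos ?_ hX fun z h3 h4 k => ?_).symm
  · rw [halfGap]; linarith
  · obtain ⟨j, hj, hk⟩ := hΛ k
    rw [hk]
    rw [halfGap] at h4
    exact hG.le_norm_sub_of_near (i := i) h3 (by linarith) (by linarith) hj

theorem summable_inv_halfGap_sq (hs : Summable fun i : ℕ => ((lam (i + 2) - lam (i + 1)) ^ 2)⁻¹)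
    (M : ℝ) : Summable fun i => (M / halfGap lam i) ^ 2 := by
  -- Adding the term with the arbitrary `lam 0` does not affect summability; in `h2` the term at `i
  -- = 0` is zero by truncated subtraction.
  have h1 : Summable fun i : ℕ => ((lam (i + 1) - lam i) ^ 2)⁻¹ :=
    (summable_nat_add_iff 1).1 hs
  have h2 : Summable fun i : ℕ => ((lam i - lam (i - 1)) ^ 2)⁻¹ :=
    (summable_nat_add_iff 1).1 (by simpa using h1)
  refine Summable.of_nonneg_of_le (fun i => sq_nonneg _) (fun i => ?_)
    ((h2.add h1).mul_left (4 * M ^ 2))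
  have h3 : ∀ x y : ℝ, ((min x y) ^ 2)⁻¹ ≤ (x ^ 2)⁻¹ + (y ^ 2)⁻¹ := fun x y => by
    rcases min_choice x y with h | h <;> rw [h]
    · exact le_add_of_nonneg_right (by positivity)
    · exact le_add_of_nonneg_left (by positivity)
  calc (M / halfGap lam i) ^ 2
      = 4 * M ^ 2 * ((min (lam i - lam (i - 1)) (lam (i + 1) - lam i)) ^ 2)⁻¹ := by
        rw [halfGap, div_div_eq_mul_div, div_pow, mul_pow, div_eq_mul_inv]; ring
    _ ≤ _ := by gcongr; exact h3 _ _

theorem summable_circleProjection_sub (hG : HasGaps lam i₀ r) (hA : IsDiagonalIn A b Λ)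
    (hΛ : ∀ k, ∃ j, 1 ≤ j ∧ Λ k = lam j) (hX : ‖X‖ < r)
    (hgap : Tendsto (fun i => lam (i + 1) - lam i) atTop atTop)
    (hs : Summable fun i : ℕ => ((lam (i + 2) - lam (i + 1)) ^ 2)⁻¹) :
    Summable fun i => circleProjection (addBounded A X) lam i₀ r i -
      b.specProj (eigenSet Λ lam i₀ i) := by
  have h2 := hG.two_le
  -- Gaps of at least `4‖X‖` make half the gap at least `2‖X‖`, as the perturbation estimates
  -- require.
  obtain ⟨m₀, hm₀⟩ := eventually_atTop.1 (hgap.eventually_ge_atTop (4 * ‖X‖))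
  have hδ : ∀ i, max i₀ (m₀ + 1) ≤ i → 0 < halfGap lam i ∧ 2 * ‖X‖ ≤ halfGap lam i ∧
      ∀ k, Λ k ≠ lam i → 2 * halfGap lam i ≤ |Λ k - lam i| := by
    intro i hi
    have hi1 : i₀ ≤ i := (le_max_left _ _).trans hi
    have hi2 : m₀ + 1 ≤ i := (le_max_right _ _).trans hi
    have hg1 := hG.gap i hi1
    have hg2 := hG.gap_succ (n := i) (by omega)
    have hg3 := hm₀ i (by omega)
    have hg4 := hm₀ (i - 1) (by omega)
    rw [Nat.sub_add_cancel (show 1 ≤ i by omega)] at hg4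
    have hpos := hG.pos
    have hm1 := min_le_left (lam i - lam (i - 1)) (lam (i + 1) - lam i)
    have hm2 := min_le_right (lam i - lam (i - 1)) (lam (i + 1) - lam i)
    have hm3 := lt_min hg1 hg2
    have hm4 := le_min hg4 hg3
    refine ⟨by rw [halfGap]; linarith, by rw [halfGap]; linarith, fun k hk => ?_⟩
    obtain ⟨j, hj, hkj⟩ := hΛ k
    rw [halfGap, hkj]
    have h5 := neg_abs_le (lam j - lam i)
    have h6 := le_abs_self (lam j - lam i)
    rcases lt_trichotomy j i with h | h | h
    · have := hG.le hj (show j ≤ i - 1 by omega)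
      linarith
    · exact absurd (hkj.trans (by rw [h])) hk
    · have := hG.le (show 1 ≤ i + 1 by omega) (show i + 1 ≤ j from h)
      linarith
  have heig : ∀ i, max i₀ (m₀ + 1) ≤ i → eigenSet Λ lam i₀ i = {k | Λ k = lam i} :=
    fun i hi => if_neg (by have := (le_max_left i₀ (m₀ + 1)).trans hi; omega)
  refine summable_of_specProj b (m := max i₀ (m₀ + 1)) (S := eigenSet Λ lam i₀)
    (a := fun i => 2 * ‖X‖ / halfGap lam i) ?_ (fun i hi => ?_) (fun i hi => ?_)
    (summable_inv_halfGap_sq hs _)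
  · intro i hi j hj hij
    exact hG.disjoint_eigenSet (Or.inr ((le_max_left _ _).trans hi))
      (Or.inr ((le_max_left _ _).trans hj)) hij
  · obtain ⟨h3, h4, h5⟩ := hδ i hi
    rw [hG.circleProjection_eq hA hΛ hX ((le_max_left _ _).trans hi), heig i hi]
    exact hA.norm_rieszProjection_sub_specProj_le_of_isolated h3 h5 h4
  · obtain ⟨h3, h4, h5⟩ := hδ i hi
    rw [hG.circleProjection_eq hA hΛ hX ((le_max_left _ _).trans hi), heig i hi]
    refine (hA.norm_compression_le h3 h5 h4).trans ?_
    rw [div_pow]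
    gcongr
    nlinarith [sq_nonneg ‖X‖]

/-- The differences `Q_i - P_i` are summable in norm and `∑ P_i u` converges unconditionally, so `∑
Q_i u` does too; its value is read off from the partial sums in the natural order. -/
theorem hasSum_circleProjection (hG : HasGaps lam i₀ r) (hA : IsDiagonalIn A b Λ)
    (hΛ : ∀ k, ∃ j, 1 ≤ j ∧ Λ k = lam j) (hX : ‖X‖ < r)
    (hgap : Tendsto (fun i => lam (i + 1) - lam i) atTop atTop)
    (hs : Summable fun i : ℕ => ((lam (i + 2) - lam (i + 1)) ^ 2)⁻¹) (u : H) :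
    HasSum (fun i : circleIndex i₀ => circleProjection (addBounded A X) lam i₀ r i u) u := by
  have h1 := (hG.summable_circleProjection_sub hA hΛ hX hgap hs).subtype (circleIndex i₀)
  have h2 := h1.hasSum.mapL (ContinuousLinearMap.apply ℂ H u)
  have h3 := b.hasSum_specProj (S := fun i : circleIndex i₀ => eigenSet Λ lam i₀ i)
    (fun i j hij => hG.disjoint_eigenSet i.2 j.2 fun h => hij (Subtype.ext h))
    (hG.exists_mem_eigenSet hΛ) u
  have h4 : Summable fun i : circleIndex i₀ =>
      circleProjection (addBounded A X) lam i₀ r i u := by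
    refine (h2.summable.add h3.summable).congr fun i => ?_
    simp
  have h5 := (hasSum_subtype_iff_indicator
    (f := fun i => circleProjection (addBounded A X) lam i₀ r i u)).1 h4.hasSum
  have h6 : Tendsto (fun n : ℕ => ∑ i ∈ (Finset.range (n + 1)).filter (· ∈ circleIndex i₀),
      circleProjection (addBounded A X) lam i₀ r i u) atTop
      (𝓝 (∑' i : circleIndex i₀, circleProjection (addBounded A X) lam i₀ r i u)) := by
    refine (h5.tendsto_sum_nat.comp (tendsto_add_atTop_nat 1)).congr fun n => ?_
    rw [Finset.sum_filter]
    exact Finset.sum_congr rfl fun i _ => indicator_apply _ _ _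
  have h7 := h4.hasSum
  rwa [tendsto_nhds_unique h6 (hG.tendsto_sum_circleProjection hA hΛ hX hgap u)] at h7

theorem exists_norm_sum_circleProjection_le (hG : HasGaps lam i₀ r) (hA : IsDiagonalIn A b Λ)
    (hΛ : ∀ k, ∃ j, 1 ≤ j ∧ Λ k = lam j) (hX : ‖X‖ < r)
    (hgap : Tendsto (fun i => lam (i + 1) - lam i) atTop atTop)
    (hs : Summable fun i : ℕ => ((lam (i + 2) - lam (i + 1)) ^ 2)⁻¹) :
    ∃ C : ℝ, ∀ I : Finset ℕ, (∀ i ∈ I, i ∈ circleIndex i₀) →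
      ‖∑ i ∈ I, circleProjection (addBounded A X) lam i₀ r i‖ ≤ C := by
  obtain ⟨C, hC⟩ := (hG.summable_circleProjection_sub hA hΛ hX hgap hs).exists_norm_sum_le
  -- `C` bounds the sums of `Q_i - P_i`, and `1` the norm of the orthogonal projection `∑ P_i`.
  refine ⟨C + 1, fun I hI => ?_⟩
  have h1 := b.norm_specProj_le (⋃ i ∈ I, eigenSet Λ lam i₀ i)
  rw [← b.sum_specProj I fun i hi j hj hij =>
    hG.disjoint_eigenSet (hI i hi) (hI j hj) hij] at h1
  have h2 := hC I
  rw [Finset.sum_sub_distrib] at h2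
  have h3 := norm_add_le_of_le h2 h1
  rwa [sub_add_cancel] at h3

end HasGaps

end

/-! ### The main theorem -/

theorem mainTheorem6 {H₀ H₁ : Type*}
    [NormedAddCommGroup H₀] [InnerProductSpace ℂ H₀] [CompleteSpace H₀]
    [NormedAddCommGroup H₁] [InnerProductSpace ℂ H₁] [CompleteSpace H₁]
    -- the entries of the operator matrix and the interval `J⁰ = (a, b)`
    (A₀ : H₀ →ₗ.[ℂ] H₀) (A₁ : H₁ →ₗ.[ℂ] H₁) (B₁₀ : H₀ →L[ℂ] H₁)
    (hA₀ : IsSelfAdjoint A₀) (hA₁ : IsSelfAdjoint A₁)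
    (a b : EReal) (hab : a < b)
    (E : ProjectionMeasure H₀) (hE : E.IsSpectralMeasureOf A₀)
    (hσ₀ : unbSpectrum A₀ = Complex.ofReal '' closure (realInterval a b))
    (hac : ∀ x : H₀, E.scalarMeasure x ≪ volume)
    (hσ₁ : unbSpectrum A₁ ⊆ Complex.ofReal '' realInterval a b)
    -- the analytic continuation `K` of `K'_B`
    (D : Set ℂ) (K : ℂ → H₁ →L[ℂ] H₁)
    (hK : IsContinuedDerivative a b D (couplingFunction E B₁₀) K)
    -- the contour `Γ^l` and the solution `X^{(l)}`
    (l : ℤˣ) (γ : ℝ → ℂ)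
    (hγ : IsBoundedContour a b (sideDomain D l) K γ)
    (hsmall : IsSmallContour A₁ K γ)
    (X : H₁ →L[ℂ] H₁) (hX : IsBasicSolution A₁ K γ X)
    -- `A₁` has compact resolvent and spectrum `λ₁ < λ₂ < …`, with gaps tending to infinity
    (hcomp : ∀ z ∈ unbResolventSet A₁, IsCompactOperator (unbResolvent A₁ z))
    (lam : ℕ → ℝ) (hlam : StrictMonoOn lam (Ici 1))
    (hspec : unbSpectrum A₁ = (fun i => (lam i : ℂ)) '' Ici 1)
    (htop : Tendsto lam atTop atTop)
    (hgap : Tendsto (fun i => lam (i + 1) - lam i) atTop atTop)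
    -- the number `i₀` and the radius `r`
    (i₀ : ℕ) (hi₀ : 2 ≤ i₀)
    (hi₀gap : ∀ i, i₀ ≤ i → 4 * rZero a b (sideDomain D l) A₁ K < lam i - lam (i - 1))
    (r : ℝ) (hr : rZero a b (sideDomain D l) A₁ K < r)
    (hrgap : ∀ i, i₀ ≤ i → 2 * r < lam i - lam (i - 1)) :
    (∀ i ∈ circleIndex i₀,
      Metric.sphere (circleCenter lam i₀ i : ℂ) (circleRadius lam i₀ r i) ⊆
        unbResolventSet (addBounded A₁ X)) ∧
    (∀ u : H₁, Tendsto
      (fun n : ℕ => ∑ i ∈ (Finset.range (n + 1)).filter (· ∈ circleIndex i₀),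
        circleProjection (addBounded A₁ X) lam i₀ r i u) atTop (𝓝 u)) ∧
    (Summable (fun i : ℕ => ((lam (i + 2) - lam (i + 1)) ^ 2)⁻¹) →
      (∀ σ : ℕ ≃ circleIndex i₀, ∀ u : H₁, Tendsto
        (fun n : ℕ => ∑ k ∈ Finset.range n,
          circleProjection (addBounded A₁ X) lam i₀ r (σ k) u) atTop (𝓝 u)) ∧
      ∃ C : ℝ, ∀ I : Finset ℕ, (∀ i ∈ I, i ∈ circleIndex i₀) →
        ‖∑ i ∈ I, circleProjection (addBounded A₁ X) lam i₀ r i‖ ≤ C) := by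
  -- `λ₁ - 1` is a real point below the whole spectrum; diagonalizing the resolvent there gives the
  -- eigenbasis.
  have hmem : ((lam 1 - 1 : ℝ) : ℂ) ∈ unbResolventSet A₁ := by
    by_contra h
    have h' : ((lam 1 - 1 : ℝ) : ℂ) ∈ unbSpectrum A₁ := h
    rw [hspec] at h'
    obtain ⟨i, hi, e⟩ := h'
    have h1 := hlam.monotoneOn (show 1 ≤ 1 from le_rfl) hi hi
    have h2 : lam i = lam 1 - 1 := Complex.ofReal_injective e
    linarith
  obtain ⟨R, hR⟩ := hmem
  have hc := hcomp _ ⟨R, hR⟩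
  rw [unbResolvent_eq hR] at hc
  obtain ⟨ι, e, Λ, hne, hRe⟩ := IsSelfAdjoint.exists_eigenbasis hA₁ hR hc
  have hA : IsDiagonalIn A₁ e Λ := fun z δ hδ h => hR.diag hne hRe hδ h
  have hΛσ : ∀ k, (Λ k : ℂ) ∈ unbSpectrum A₁ := fun k => by
    obtain ⟨hd, hk⟩ := hR.mem_domain_of_eigen (hne k) (hRe k)
    refine mem_unbSpectrum_of_eigen hd hk fun h0 => ?_
    have := e.orthonormal.1 k
    rw [h0, norm_zero] at this
    exact zero_ne_one this
  have hΛ : ∀ k, ∃ j, 1 ≤ j ∧ Λ k = lam j := fun k => by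
    have h := hΛσ k
    rw [hspec] at h
    obtain ⟨j, hj, hk⟩ := h
    exact ⟨j, hj, Complex.ofReal_injective hk.symm⟩
  have hΛJ : ∀ k, Λ k ∈ realInterval a b := fun k => by
    obtain ⟨x, hx, hk⟩ := hσ₁ (hΛσ k)
    exact Complex.ofReal_injective hk ▸ hx
  have hXr : ‖X‖ < r := (hX.norm_le_rZero hK hA hΛσ hΛJ hγ hsmall).trans_lt hr
  have hG : HasGaps lam i₀ r := ⟨hlam, hi₀, (norm_nonneg X).trans_lt hXr, hrgap⟩
  refine ⟨fun i hi z hz => hA.mem_unbResolventSet hXr fun k => ?_,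
    hG.tendsto_sum_circleProjection hA hΛ hXr hgap, fun hs =>
    ⟨fun σ u => ?_, hG.exists_norm_sum_circleProjection_le hA hΛ hXr hgap hs⟩⟩
  · obtain ⟨j, hj, hk⟩ := hΛ k
    rw [hk]
    exact hG.le_norm_sub_of_mem_sphere hi hz hj
  -- A `HasSum` does not depend on the order of the terms, so any enumeration `σ` may be inserted.
  · exact ((Equiv.hasSum_iff σ).2
      (hG.hasSum_circleProjection hA hΛ hXr hgap hs u)).tendsto_sum_nat
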